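/- For a non-zero polynomial $f\in\mathbb{Q}[X]$, let $L(f)$ be the set of those complex roots of $f$ of largest modulus whose multiplicity in $f$ is largest among the roots of largest modulus. For $A\in\mathbb{Q}^{d\times d}$ let $m_A$ be its minimal polynomial, and for $x\in\mathbb{Q}^d$ let $m_{A,x}$ be the monic polynomial of least degree with $m_{A,x}(A)x=0$. Call $x$ non-trivial with respect to $A$ if $x\neq 0$ and $L(m_{A,x})\subseteq L(m_A)$ (this holds, for instance, if $x\ne 0$ and $m_{A,x}=m_A$). There are an algorithm $\mathcal{W}$ and an algorithm $\mathcal{D}$ such that for every $d$, every $A\in\mathbb{Q}^{d\times d}$ and every $x\in\mathbb{Q}^d$ that is non-trivial with respect to $A$ the following holds. Let $\lambda_1,\dots,\lambda_r$ be the distinct complex eigenvalues of $A$ of largest modulus, and let $p\le r$ be the number of those among them whose multiplicity in $m_A$ is the largest, so that $p=|L(m_A)|$. (1) On input $(A,x)$, $\mathcal{W}$ halts and outputs a basis of a $p$-dimensional subspace $W\subseteq\mathbb{R}^d$ whose vectors have real algebraic entries; each entry is given by a non-zero integer polynomial together with a disc with rational centre and rational radius in which the entry is the only root of that polynomial. (2)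 If $A$ is not nilpotent, then $A^nx\neq0$ for all $n$, and the orbit converges to $W$ in real projective space: $\lim_{n\to\infty}d(\mathbb{P}A^nx,\mathbb{P}W)=0$, where $d(\mathbb{P}v,\mathbb{P}W)=\inf_{0\ne w\in W}\min\left(\left\|\frac{v}{\|v\|}-\frac{w}{\|w\|}\right\|,\left\|\frac{v}{\|v\|}+\frac{w}{\|w\|}\right\|\right)$. (3) For every subspace $U\subseteq\mathbb{Q}^d$, presented by a finite list of rational spanning vectors, such that $W$ intersects the real span of $U$ only in $0$, the algorithm $\mathcal{D}$ on input $(A,x,U)$ halts and correctly answers whether there is an $n\in\mathbb{N}=\{0,1,2,\dots\}$ with $A^nx\in U$. -/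

import Mathlib

open Polynomial

/-! ### Finite descriptions of rational data -/

/-- Finite description of a rational number: numerator and denominator. -/
abbrev RatCode := ℤ × ℕ

/-- The canonical description of a rational number (lowest terms, positive denominator). -/
def ratCode (q : ℚ) : RatCode := (q.num, q.den)

/-- The rational number described by a pair (numerator, denominator). -/
def RatCode.val (c : RatCode) : ℚ := (c.1 : ℚ) / (c.2 : ℚ)

/-- A rational vector, given to an algorithm as the list of its entries. -/
def vecCode {d : ℕ} (x : Fin d → ℚ) : List RatCode := List.ofFn fun i => ratCode (x i)

/-- A list of `k` rational vectors of length `d` (in particular the list of rows of a matrix),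
as given to an algorithm. -/
def rowsCode {k d : ℕ} (u : Fin k → Fin d → ℚ) : List (List RatCode) :=
  List.ofFn fun i => vecCode (u i)

/-! ### Finite descriptions of algebraic numbers and of subspaces with algebraic basis -/

/-- Finite description of an algebraic number: the integer coefficients of a polynomial
(constant coefficient first) and rational numbers `a`, `b`, `r`. -/
abbrev AlgCode := List ℤ × RatCode × RatCode × RatCode

/-- The integer polynomial with the given coefficients, constant coefficient first. -/
noncomputable def polyOfCoeffs (l : List ℤ) : ℤ[X] :=
  l.foldr (fun c P => C c + X * P) 0

/-- `(P, a, b, r)` represents `α` if `P` is a non-zero integer polynomial and `α` is the unique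
root of `P` inside the circle of radius `r` centred at `a + b i`. -/
def AlgCode.Represents (c : AlgCode) (α : ℂ) : Prop :=
  let P : ℤ[X] := polyOfCoeffs c.1
  let z : ℂ := ⟨(c.2.1.val : ℝ), (c.2.2.1.val : ℝ)⟩
  let r : ℝ := (c.2.2.2.val : ℝ)
  P ≠ 0 ∧ aeval α P = 0 ∧ ‖α - z‖ < r ∧ ∀ β : ℂ, aeval β P = 0 → ‖β - z‖ < r → β = α

/-- The list `b` of vectors of descriptions of algebraic numbers presents the real subspace `W`:
it describes, entry by entry, the vectors of a basis of `W`. -/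
def PresentsSubspace {d : ℕ} (b : List (List AlgCode))
    (W : Submodule ℝ (EuclideanSpace ℝ (Fin d))) : Prop :=
  ∃ w : List (EuclideanSpace ℝ (Fin d)),
    List.Forall₂ (fun (row : List AlgCode) (v : EuclideanSpace ℝ (Fin d)) =>
      List.Forall₂ AlgCode.Represents row (List.ofFn fun i => ((v i : ℝ) : ℂ))) b w ∧
    LinearIndependent ℝ w.get ∧
    Submodule.span ℝ {v | v ∈ w} = W

/-! ### Dominating and leading roots -/

/-- The multiplicity of the complex number `z` as a root of the rational polynomial `f`. -/
noncomputable def multIn (f : ℚ[X]) (z : ℂ) : ℕ :=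
  (f.map (algebraMap ℚ ℂ)).rootMultiplicity z

/-- The complex roots of `f` of largest modulus. -/
def dominatingRoots (f : ℚ[X]) : Set ℂ :=
  {z | aeval z f = 0 ∧ ∀ w : ℂ, aeval w f = 0 → ‖w‖ ≤ ‖z‖}

/-- The complex roots of `f` of largest modulus whose multiplicity in `f` is the largest among
the roots of largest modulus. -/
def leadingRoots (f : ℚ[X]) : Set ℂ :=
  {z | z ∈ dominatingRoots f ∧ ∀ w ∈ dominatingRoots f, multIn f w ≤ multIn f z}

/-- The ideal of all rational polynomials `f` with `f(A) x = 0`. -/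
noncomputable def vecAnnihilator {d : ℕ} (A : Matrix (Fin d) (Fin d) ℚ) (x : Fin d → ℚ) :
    Ideal ℚ[X] where
  carrier := {f | (aeval A f).mulVec x = 0}
  add_mem' := by
    intro f g hf hg
    simp only [Set.mem_ofPred_eq] at hf hg ⊢
    rw [map_add, Matrix.add_mulVec, hf, hg, add_zero]
  zero_mem' := by simp
  smul_mem' := by
    intro c f hf
    simp only [Set.mem_ofPred_eq] at hf ⊢
    rw [smul_eq_mul, map_mul, ← Matrix.mulVec_mulVec, hf, Matrix.mulVec_zero]

/-- The minimal polynomial of `x` with respect to `A` (up to a non-zero constant factor): the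
generator of the ideal of all `f` with `f(A) x = 0`. The multiplicity in it of an eigenvalue `z`
of `A` is the least `k` such that `(A - z)^k` annihilates the component of `x` in the generalised
eigenspace of `z`, that is, the height that `x` reaches in the Jordan blocks belonging to `z`. -/
noncomputable def vecMinpoly {d : ℕ} (A : Matrix (Fin d) (Fin d) ℚ) (x : Fin d → ℚ) : ℚ[X] :=
  Submodule.IsPrincipal.generator (vecAnnihilator A x)

/-- Non-triviality of the starting point: `x` is non-zero and the eigenvalues leading for `x` are
leading for `A`, so that the largest Jordan blocks of largest modulus in which `x` takes part
belong to the leading eigenvalues of `A`. In particular this holds if `x ≠ 0` and the minimal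
polynomial of `x` with respect to `A` is the minimal polynomial of `A`. -/
def NonTrivial {d : ℕ} (A : Matrix (Fin d) (Fin d) ℚ) (x : Fin d → ℚ) : Prop :=
  x ≠ 0 ∧ leadingRoots (vecMinpoly A x) ⊆ leadingRoots (minpoly ℚ A)

/-! ### Distance in real projective space -/

/-- A rational vector as a vector of Euclidean space. -/
noncomputable def realVec {d : ℕ} (x : Fin d → ℚ) : EuclideanSpace ℝ (Fin d) :=
  WithLp.toLp 2 fun i => (x i : ℝ)

/-- The real subspace spanned by finitely many rational vectors. -/
noncomputable def realSpan {k d : ℕ} (u : Fin k → Fin d → ℚ) :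
    Submodule ℝ (EuclideanSpace ℝ (Fin d)) :=
  Submodule.span ℝ (Set.range fun i => realVec (u i))

/-- The distance, in real projective space, of the points given by non-zero `v` and `w`. -/
noncomputable def projDist {d : ℕ} (v w : EuclideanSpace ℝ (Fin d)) : ℝ :=
  min ‖‖v‖⁻¹ • v - ‖w‖⁻¹ • w‖ ‖‖v‖⁻¹ • v + ‖w‖⁻¹ • w‖

/-- The distance, in real projective space, of the point given by `v ≠ 0` from the projective
subspace given by `W ≠ 0`. -/
noncomputable def projDistTo {d : ℕ} (v : EuclideanSpace ℝ (Fin d))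
    (W : Submodule ℝ (EuclideanSpace ℝ (Fin d))) : ℝ :=
  ⨅ w : {w : EuclideanSpace ℝ (Fin d) // w ∈ W ∧ w ≠ 0}, projDist v w.1

/-- The orbit of `x` under `A` converges, in real projective space, to the projective subspace
given by `W`. -/
def OrbitConvergesTo {d : ℕ} (A : Matrix (Fin d) (Fin d) ℚ) (x : Fin d → ℚ)
    (W : Submodule ℝ (EuclideanSpace ℝ (Fin d))) : Prop :=
  (∀ n : ℕ, (A ^ n).mulVec x ≠ 0) ∧
    Filter.Tendsto (fun n : ℕ => projDistTo (realVec ((A ^ n).mulVec x)) W)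
      Filter.atTop (nhds 0)

-- Both algorithms are unbounded searches for certificates, so semi-decidability suffices.
-- Everything to be verified is phrased as solvability, in complex algebraic numbers, of a finite
-- system of quadratic equations in which conjugation is allowed. Inequalities become equations
-- through slack unknowns, and v ≠ 0 becomes v ⬝ y = 1. Such solvability is semi-decidable
-- (`QSystem.exists_check_iff`). The real and imaginary parts of the unknowns that occur lie in ℚ(θ)
-- for one real algebraic integer θ. A certificate consists of an integer polynomial m with a change
-- of sign, integer polynomials giving D times these parts at θ, and quotients showing that m
-- divides every equation. Any real root of m then yields a solution. Conversely, θ can be scaled so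
-- that its minimal polynomial changes sign between integers.
--
-- The analysis rests on A^n x = ∑ C(n,k) λ_i^(n-k) v_{i,k}, summed over i and k, where v_{i,k} = (A
-- - λ_i)^k v_{i,0} and v_{i,0} is the component of x at λ_i. Let ρ > 0 be the largest modulus and t
-- the largest k with v_{i,k} ≠ 0 for some |λ_i| = ρ. The part with |λ_i| = ρ and k = t dominates
-- the rest by a factor of order n (`norm_sub_leading_mul_le`). It cannot cancel: vectors at
-- different eigenvalues are independent, so a linear form isolates one summand. Hence the orbit
-- converges to every real W whose complexification contains the vectors v_{i,t} with |λ_i| = ρ.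
--
-- Multiplicities in minimal polynomials are heights of Jordan chains
-- (`IsDecomposition.lt_rootMultiplicity_iff`), after the rational annihilator has been compared
-- with the complex one (`map_dvd_of_forall_dvd`). Non-triviality thus says that the non-zero
-- leading vectors of x sit at eigenvalues in L(m_A). One vector is chosen for each element of
-- L(m_A), compatibly with conjugation. Replacing conjugate pairs by real and imaginary parts gives
-- a real W of dimension p (`IsSpectralData.exists_basis`). A large integer multiple of the basis
-- has entries that can be isolated in discs around integers (`QSystem.eventually_exists_nearCode`).
--
-- A hit A^n x ∈ U is certified by n and coefficients. For a miss, W ∩ U = 0 provides a linear form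
-- that vanishes on U, is 1 on one leading vector and 0 on the others. It is non-zero on A^n x from
-- an explicit index on, and the finitely many earlier points are separated from U one by one. These
-- certificates are sound without reference to W; the hypothesis on W is needed only for their
-- existence. If ρ = 0, the orbit reaches 0 ∈ U.
--
-- Solutions over ℂ of linear equations with algebraic coefficients are made algebraic by a linear
-- retraction of ℂ onto the algebraic numbers (`exists_algebraic_retraction`).

attribute [fun_prop] Primrec

/-! ### Closure rules for primitive recursive functions, in the form used by `fun_prop` -/

namespace Primrec

variable {α β γ σ : Type*} [Primcodable α] [Primcodable β] [Primcodable γ] [Primcodable σ]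

attribute [fun_prop] Primrec.id Primrec.const Primrec.comp

@[fun_prop]
theorem fst_of {f : α → β × γ} (hf : Primrec f) : Primrec fun a => (f a).1 := fst.comp hf

@[fun_prop]
theorem snd_of {f : α → β × γ} (hf : Primrec f) : Primrec fun a => (f a).2 := snd.comp hf

@[fun_prop]
theorem pair_of {f : α → β} {g : α → γ} (hf : Primrec f) (hg : Primrec g) :
    Primrec fun a => (f a, g a) := hf.pair hg

@[fun_prop]
theorem encode_of {f : α → β} (hf : Primrec f) : Primrec fun a => Encodable.encode (f a) :=
  Primrec.encode.comp hf

@[fun_prop]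
theorem cons_of {f : α → β} {g : α → List β} (hf : Primrec f) (hg : Primrec g) :
    Primrec fun a => f a :: g a := list_cons.comp hf hg

@[fun_prop]
theorem append_of {f g : α → List β} (hf : Primrec f) (hg : Primrec g) :
    Primrec fun a => f a ++ g a := list_append.comp hf hg

@[fun_prop]
theorem map_of {f : α → List β} {g : α → β → σ} (hf : Primrec f)
    (hg : Primrec fun p : α × β => g p.1 p.2) : Primrec fun a => (f a).map (g a) :=
  list_map hf hg.to₂

@[fun_prop]
theorem flatMap_of {f : α → List β} {g : α → β → List σ} (hf : Primrec f)
    (hg : Primrec fun p : α × β => g p.1 p.2) : Primrec fun a => (f a).flatMap (g a) :=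
  list_flatMap hf hg.to₂

@[fun_prop]
theorem foldr_of {f : α → List β} {g : α → σ} {h : α → β → σ → σ} (hf : Primrec f)
    (hg : Primrec g) (hh : Primrec fun p : α × β × σ => h p.1 p.2.1 p.2.2) :
    Primrec fun a => (f a).foldr (h a) (g a) :=
  list_foldr (h := fun a p => h a p.1 p.2) hf hg hh.to₂

@[fun_prop]
theorem range_of {f : α → ℕ} (hf : Primrec f) : Primrec fun a => List.range (f a) :=
  list_range.comp hf

@[fun_prop]
theorem length_of {f : α → List β} (hf : Primrec f) : Primrec fun a => (f a).length :=
  list_length.comp hf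

@[fun_prop]
theorem getD_of {f : α → List β} {g : α → ℕ} {h : α → β} (hf : Primrec f) (hg : Primrec g)
    (hh : Primrec h) : Primrec fun a => (f a).getD (g a) (h a) :=
  (option_getD.comp (list_getElem?.comp hf hg) hh).of_eq fun a => by
    rw [List.getD_eq_getElem?_getD]

@[fun_prop]
theorem nat_add_of {f g : α → ℕ} (hf : Primrec f) (hg : Primrec g) :
    Primrec fun a => f a + g a := nat_add.comp hf hg

@[fun_prop]
theorem nat_sub_of {f g : α → ℕ} (hf : Primrec f) (hg : Primrec g) :
    Primrec fun a => f a - g a := nat_sub.comp hf hg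

@[fun_prop]
theorem nat_mul_of {f g : α → ℕ} (hf : Primrec f) (hg : Primrec g) :
    Primrec fun a => f a * g a := nat_mul.comp hf hg

@[fun_prop]
theorem nat_pow_of {f g : α → ℕ} (hf : Primrec f) (hg : Primrec g) :
    Primrec fun a => f a ^ g a :=
  (Primrec₂.unpaired'.1 Nat.Primrec.pow).comp hf hg

@[fun_prop]
theorem ite_eq_of [DecidableEq β] {u v : α → β} {f g : α → σ} (hu : Primrec u) (hv : Primrec v)
    (hf : Primrec f) (hg : Primrec g) : Primrec fun a => if u a = v a then f a else g a :=
  ite (Primrec.eq.comp hu hv) hf hg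

@[fun_prop]
theorem ite_lt_of {u v : α → ℕ} {f g : α → σ} (hu : Primrec u) (hv : Primrec v)
    (hf : Primrec f) (hg : Primrec g) : Primrec fun a => if u a < v a then f a else g a :=
  ite (nat_lt.comp hu hv) hf hg

@[fun_prop]
theorem cond_of {c : α → Bool} {f g : α → σ} (hc : Primrec c)
    (hf : Primrec f) (hg : Primrec g) : Primrec fun a => bif c a then f a else g a :=
  cond hc hf hg

@[fun_prop]
theorem and_of {f g : α → Bool} (hf : Primrec f) (hg : Primrec g) :
    Primrec fun a => f a && g a := Primrec.and.comp hf hg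

@[fun_prop]
theorem decide_eq_of [DecidableEq β] {f g : α → β} (hf : Primrec f) (hg : Primrec g) :
    Primrec fun a => decide (f a = g a) :=
  (ite (Primrec.eq.comp hf hg) (const true) (const false)).of_eq fun a => by
    by_cases h : f a = g a <;> simp [h]

@[fun_prop]
theorem decide_nat_lt_of {f g : α → ℕ} (hf : Primrec f) (hg : Primrec g) :
    Primrec fun a => decide (f a < g a) :=
  (ite (nat_lt.comp hf hg) (const true) (const false)).of_eq fun a => by
    by_cases h : f a < g a <;> simp [h]

@[fun_prop]
theorem all_of {f : α → List β} {g : α → β → Bool} (hf : Primrec f)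
    (hg : Primrec fun p : α × β => g p.1 p.2) : Primrec fun a => (f a).all (g a) :=
  (foldr_of (h := fun a b s => g a b && s) hf (const true) (by
      have : Primrec fun p : α × β × Bool => g p.1 p.2.1 :=
        hg.comp (show Primrec fun p : α × β × Bool => (p.1, p.2.1) by fun_prop)
      fun_prop)).of_eq fun a => by
    induction f a with
    | nil => rfl
    | cons b l ih => simp [ih]

@[fun_prop]
theorem any_of {f : α → List β} {g : α → β → Bool} (hf : Primrec f)
    (hg : Primrec fun p : α × β => g p.1 p.2) : Primrec fun a => (f a).any (g a) :=
  (foldr_of (h := fun a b s => bif g a b then true else s) hf (const false) (by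
      have : Primrec fun p : α × β × Bool => g p.1 p.2.1 :=
        hg.comp (show Primrec fun p : α × β × Bool => (p.1, p.2.1) by fun_prop)
      fun_prop)).of_eq fun a => by
    induction f a with
    | nil => rfl
    | cons b l ih => cases h : g a b <;> simp_all

/-! ### Integer arithmetic -/

/-- An integer and its image in ℕ ⊕ ℕ have the same code, so on codes this is the identity. -/
theorem intEquivNatSumNat : Primrec Equiv.intEquivNatSumNat :=
  Primrec.encode_iff.1 (Primrec.encode.of_eq fun z => by cases z <;> rfl)

theorem int_sumElim : Primrec (Sum.elim Int.ofNat Int.negSucc) :=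
  Primrec.encode_iff.1 (Primrec.encode.of_eq fun z => by rcases z with z | z <;> rfl)

@[fun_prop]
theorem int_natCast_of {f : α → ℕ} (hf : Primrec f) : Primrec fun a => ((f a : ℕ) : ℤ) :=
  int_sumElim.comp (sumInl.comp hf)

theorem int_negSucc : Primrec Int.negSucc := int_sumElim.comp sumInr

theorem int_casesOn_of {f : α → ℤ} {g h : α → ℕ → σ} (hf : Primrec f) (hg : Primrec₂ g)
    (hh : Primrec₂ h) :
    Primrec fun a => @Int.rec (fun _ => σ) (g a) (h a) (f a) :=
  (sumCasesOn (intEquivNatSumNat.comp hf) hg hh).of_eq fun a => by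
    cases f a <;> rfl

@[fun_prop]
theorem int_toNat_of {f : α → ℤ} (hf : Primrec f) : Primrec fun a => (f a).toNat :=
  (int_casesOn_of (g := fun _ n => n) (h := fun _ _ => 0) hf Primrec₂.right
    (Primrec₂.const 0)).of_eq fun a => by cases f a <;> rfl

@[fun_prop]
theorem int_natAbs_of {f : α → ℤ} (hf : Primrec f) : Primrec fun a => (f a).natAbs :=
  (int_casesOn_of (g := fun _ n => n) (h := fun _ n => n + 1) hf Primrec₂.right
    (Primrec.succ.comp₂ Primrec₂.right)).of_eq fun a => by cases f a <;> rfl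

/-- The only integer operation treated by cases on the sign: negation, sum and product reduce to it
by splitting integers into positive and negative parts. -/
theorem int_subNatNat {f g : α → ℕ} (hf : Primrec f) (hg : Primrec g) :
    Primrec fun a => (f a : ℤ) - (g a : ℤ) :=
  (show Primrec fun a => if f a < g a then Int.negSucc (g a - f a - 1) else ((f a - g a : ℕ) : ℤ)
    from by
      have h1 : Primrec fun a => Int.negSucc (g a - f a - 1) :=
        int_negSucc.comp (by fun_prop)
      fun_prop).of_eq fun a => by
    split_ifs with h
    · rw [Int.negSucc_eq]; omega
    · omega

@[fun_prop]
theorem int_neg_of {f : α → ℤ} (hf : Primrec f) : Primrec fun a => -f a :=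
  (int_subNatNat (f := fun a => (f a).natAbs - (f a).toNat) (g := fun a => (f a).toNat)
    (by fun_prop) (by fun_prop)).of_eq fun a => by omega

@[fun_prop]
theorem int_add_of {f g : α → ℤ} (hf : Primrec f) (hg : Primrec g) :
    Primrec fun a => f a + g a :=
  (int_subNatNat (f := fun a => (f a).toNat + (g a).toNat)
    (g := fun a => (-f a).toNat + (-g a).toNat)
    (by fun_prop) (by fun_prop)).of_eq fun a => by omega

@[fun_prop]
theorem int_sub_of {f g : α → ℤ} (hf : Primrec f) (hg : Primrec g) :
    Primrec fun a => f a - g a :=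
  (int_add_of hf (int_neg_of hg)).of_eq fun _ => (sub_eq_add_neg _ _).symm

@[fun_prop]
theorem int_mul_of {f g : α → ℤ} (hf : Primrec f) (hg : Primrec g) :
    Primrec fun a => f a * g a :=
  (int_subNatNat (f := fun a => (f a).toNat * (g a).toNat + (-f a).toNat * (-g a).toNat)
    (g := fun a => (f a).toNat * (-g a).toNat + (-f a).toNat * (g a).toNat)
    (by fun_prop) (by fun_prop)).of_eq fun a => by
    have h1 : f a = (f a).toNat - (-f a).toNat := by omega
    have h2 : g a = (g a).toNat - (-g a).toNat := by omega
    conv_rhs => rw [h1, h2]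
    push_cast
    ring

@[fun_prop]
theorem decide_int_le_of {f g : α → ℤ} (hf : Primrec f) (hg : Primrec g) :
    Primrec fun a => decide (f a ≤ g a) :=
  (show Primrec fun a => decide ((f a - g a).toNat = 0) by fun_prop).of_eq fun a => by
    congr 1; rw [eq_iff_iff]; omega

@[fun_prop]
theorem int_listSum_of {f : α → List ℤ} (hf : Primrec f) : Primrec fun a => (f a).sum :=
  foldr_of (h := fun _ b s => b + s) hf (const 0) (by fun_prop)

end Primrec

/-! ### Integer polynomials as lists of coefficients -/

theorem polyOfCoeffs_cons (c : ℤ) (l : List ℤ) :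
    polyOfCoeffs (c :: l) = C c + X * polyOfCoeffs l := rfl

theorem coeff_polyOfCoeffs (l : List ℤ) (i : ℕ) : (polyOfCoeffs l).coeff i = l.getD i 0 := by
  induction l generalizing i with
  | nil => simp [polyOfCoeffs]
  | cons c l ih =>
    rw [polyOfCoeffs_cons]
    cases i with
    | zero => simp
    | succ i => rw [coeff_add, coeff_C_succ, coeff_X_mul, ih]; simp

theorem sum_map_range {M : Type*} [AddCommMonoid M] (f : ℕ → M) (n : ℕ) :
    ((List.range n).map f).sum = ∑ i ∈ Finset.range n, f i := by
  induction n with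
  | zero => simp
  | succ n ih => simp [List.range_succ, Finset.sum_range_succ, ih]

theorem getD_map_range {M : Type*} (f : ℕ → M) (n i : ℕ) (d : M) :
    ((List.range n).map f).getD i d = if i < n then f i else d := by
  rw [List.getD_eq_getElem?_getD]
  split_ifs with h <;> simp [h]

theorem getD_of_length_le {M : Type*} {l : List M} {i : ℕ} {d : M} (h : l.length ≤ i) :
    l.getD i d = d := by
  rw [List.getD_eq_getElem?_getD]; simp [h]

theorem exists_coeffs (p : ℤ[X]) : ∃ l, polyOfCoeffs l = p :=
  ⟨(List.range (p.natDegree + 1)).map p.coeff, by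
    ext i
    rw [coeff_polyOfCoeffs, getD_map_range]
    split_ifs with h
    · rfl
    · rw [coeff_eq_zero_of_natDegree_lt (by omega)]⟩

namespace CoeffList

/-- Sum of two polynomials given by coefficient lists. -/
def add (p q : List ℤ) : List ℤ :=
  (List.range (p.length + q.length)).map fun i => p.getD i 0 + q.getD i 0

/-- Product of two polynomials given by coefficient lists. -/
def mul (p q : List ℤ) : List ℤ :=
  (List.range (p.length + q.length)).map fun n =>
    ((List.range (n + 1)).map fun i => p.getD i 0 * q.getD (n - i) 0).sum

/-- Scalar multiple of a polynomial given by its coefficient list. -/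
def smul (c : ℤ) (p : List ℤ) : List ℤ := p.map fun a => c * a

/-- Value of a polynomial given by its coefficient list. -/
def eval (p : List ℤ) (z : ℤ) : ℤ := p.foldr (fun c a => c + z * a) 0

/-- Whether a coefficient list describes the zero polynomial. -/
def isZero (p : List ℤ) : Bool := p.all fun a => decide (a = 0)

variable {α : Type*} [Primcodable α]

@[fun_prop]
theorem primrec_add {f g : α → List ℤ} (hf : Primrec f) (hg : Primrec g) :
    Primrec fun a => add (f a) (g a) := by unfold add; fun_prop

@[fun_prop]
theorem primrec_mul {f g : α → List ℤ} (hf : Primrec f) (hg : Primrec g) :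
    Primrec fun a => mul (f a) (g a) := by unfold mul; fun_prop

@[fun_prop]
theorem primrec_smul {f : α → ℤ} {g : α → List ℤ} (hf : Primrec f) (hg : Primrec g) :
    Primrec fun a => smul (f a) (g a) := by unfold smul; fun_prop

@[fun_prop]
theorem primrec_eval {f : α → List ℤ} {g : α → ℤ} (hf : Primrec f) (hg : Primrec g) :
    Primrec fun a => eval (f a) (g a) := by unfold eval; fun_prop

@[fun_prop]
theorem primrec_isZero {f : α → List ℤ} (hf : Primrec f) :
    Primrec fun a => isZero (f a) := by unfold isZero; fun_prop

theorem polyOfCoeffs_add (p q : List ℤ) :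
    polyOfCoeffs (add p q) = polyOfCoeffs p + polyOfCoeffs q := by
  ext i
  rw [coeff_add, coeff_polyOfCoeffs, coeff_polyOfCoeffs, coeff_polyOfCoeffs, add, getD_map_range]
  split_ifs with h
  · rfl
  · rw [getD_of_length_le (by omega), getD_of_length_le (by omega), add_zero]

/-- Beyond the sum of the lengths every term of the convolution has an index outside one of the
lists, where `getD` returns 0. Superfluous zeros at the end of a list are harmless. -/
theorem polyOfCoeffs_mul (p q : List ℤ) :
    polyOfCoeffs (mul p q) = polyOfCoeffs p * polyOfCoeffs q := by
  ext n
  rw [coeff_mul, coeff_polyOfCoeffs, mul, getD_map_range, sum_map_range,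
    Finset.Nat.sum_antidiagonal_eq_sum_range_succ
      (fun i j => (polyOfCoeffs p).coeff i * (polyOfCoeffs q).coeff j)]
  simp only [coeff_polyOfCoeffs]
  split_ifs with h
  · rfl
  · refine (Finset.sum_eq_zero fun i hi => ?_).symm
    rw [Finset.mem_range] at hi
    by_cases hip : p.length ≤ i
    · rw [getD_of_length_le hip, zero_mul]
    · rw [getD_of_length_le (l := q) (by omega), mul_zero]

theorem polyOfCoeffs_smul (c : ℤ) (p : List ℤ) :
    polyOfCoeffs (smul c p) = C c * polyOfCoeffs p := by
  induction p with
  | nil => simp [smul, polyOfCoeffs]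
  | cons a p ih =>
    rw [smul, List.map_cons, polyOfCoeffs_cons, ← smul, ih, polyOfCoeffs_cons, C_mul]
    ring

theorem eval_polyOfCoeffs (p : List ℤ) (z : ℤ) : (polyOfCoeffs p).eval z = eval p z := by
  induction p with
  | nil => simp [eval, polyOfCoeffs]
  | cons a p ih => rw [polyOfCoeffs_cons]; simp [ih, eval]

theorem isZero_iff (p : List ℤ) : isZero p = true ↔ polyOfCoeffs p = 0 := by
  constructor
  · intro h
    ext i
    rw [coeff_polyOfCoeffs, List.getD_eq_getElem?_getD, coeff_zero]
    by_cases hi : i < p.length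
    · simp only [isZero, List.all_eq_true, decide_eq_true_eq] at h
      simpa [hi] using h _ (List.getElem_mem hi)
    · simp [not_lt.1 hi]
  · intro h
    simp only [isZero, List.all_eq_true, decide_eq_true_eq]
    intro a ha
    obtain ⟨i, hi, rfl⟩ := List.getElem_of_mem ha
    have := coeff_polyOfCoeffs p i
    rw [h, coeff_zero, List.getD_eq_getElem?_getD] at this
    simpa [hi] using this.symm

end CoeffList

/-! ### Systems of quadratic equations in complex unknowns -/

/-- `(c, u, v, b)` stands for `c` times the unknown `u` times the unknown `v`, conjugated if
`b` is `true`. The unknown `[]` stands for `1`. -/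
abbrev QTerm := ℤ × List ℕ × List ℕ × Bool

/-- A list of equations; each equation asks that the sum of its terms vanishes. -/
abbrev QSystem := List (List QTerm)

/-- The value of a term. -/
noncomputable def QTerm.value (a : List ℕ → ℂ) (t : QTerm) : ℂ :=
  t.1 * a t.2.1 * (bif t.2.2.2 then (starRingEnd ℂ) (a t.2.2.1) else a t.2.2.1)

/-- The assignment `a` solves the system `S`. -/
def QSystem.Holds (a : List ℕ → ℂ) (S : QSystem) : Prop :=
  ∀ e ∈ S, (e.map (QTerm.value a)).sum = 0

/-- The assignment `a` solves the system `S` in algebraic numbers. -/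
structure QSystem.Solves (a : List ℕ → ℂ) (S : QSystem) : Prop where
  one : a [] = 1
  alg : ∀ v, IsAlgebraic ℚ (a v)
  holds : S.Holds a

namespace QSystem

/-- The list with index `2 * encode v + b` in `R`: a polynomial giving the real part (`b = 0`) or
the imaginary part (`b = 1`) of the unknown `v`. -/
def part (R : List (List ℤ)) (v : List ℕ) (b : ℕ) : List ℤ :=
  R.getD (2 * Encodable.encode v + b) []

/-- The real part of a term. -/
def termRe (R : List (List ℤ)) (t : QTerm) : List ℤ :=
  CoeffList.smul t.1 (CoeffList.add (CoeffList.mul (part R t.2.1 0) (part R t.2.2.1 0))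
    (CoeffList.smul (bif t.2.2.2 then 1 else -1)
      (CoeffList.mul (part R t.2.1 1) (part R t.2.2.1 1))))

/-- The imaginary part of a term. -/
def termIm (R : List (List ℤ)) (t : QTerm) : List ℤ :=
  CoeffList.smul t.1 (CoeffList.add (CoeffList.mul (part R t.2.1 1) (part R t.2.2.1 0))
    (CoeffList.smul (bif t.2.2.2 then -1 else 1)
      (CoeffList.mul (part R t.2.1 0) (part R t.2.2.1 1))))

/-- The real part of the left-hand side of an equation. -/
def eqnRe (R : List (List ℤ)) (e : List QTerm) : List ℤ :=
  e.foldr (fun t s => CoeffList.add (termRe R t) s) []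

/-- The imaginary part of the left-hand side of an equation. -/
def eqnIm (R : List (List ℤ)) (e : List QTerm) : List ℤ :=
  e.foldr (fun t s => CoeffList.add (termIm R t) s) []

/-- Whether `p` is the product of `m` and one of the polynomials in `Q`. -/
def isMultiple (m : List ℤ) (Q : List (List ℤ)) (p : List ℤ) : Bool :=
  Q.any fun q => CoeffList.isZero (CoeffList.add p (CoeffList.smul (-1) (CoeffList.mul m q)))

/-- A certificate for the solvability of a system: a polynomial, a place where it is non-positive,
a place where it is positive, a common denominator, polynomials for the real and imaginary parts of
the unknowns, and quotients. -/
abbrev Cert := (List ℤ × ℤ × ℤ × ℤ) × List (List ℤ) × List (List ℤ)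

/-- Verification of a certificate. -/
def check (S : QSystem) (c : Cert) : Bool :=
  decide (CoeffList.eval c.1.1 c.1.2.1 ≤ 0) && decide (1 ≤ CoeffList.eval c.1.1 c.1.2.2.1) &&
  decide (0 < c.1.2.2.2.natAbs) && decide (part c.2.1 [] 0 = [c.1.2.2.2]) &&
  decide (part c.2.1 [] 1 = []) &&
  S.all fun e => isMultiple c.1.1 c.2.2 (eqnRe c.2.1 e) && isMultiple c.1.1 c.2.2 (eqnIm c.2.1 e)

section
variable {α : Type*} [Primcodable α]

@[fun_prop]
theorem primrec_part {R : α → List (List ℤ)} {v : α → List ℕ} {b : α → ℕ} (hR : Primrec R)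
    (hv : Primrec v) (hb : Primrec b) : Primrec fun a => part (R a) (v a) (b a) := by
  unfold part; fun_prop

@[fun_prop]
theorem primrec_termRe {R : α → List (List ℤ)} {t : α → QTerm} (hR : Primrec R)
    (ht : Primrec t) : Primrec fun a => termRe (R a) (t a) := by
  unfold termRe; fun_prop

@[fun_prop]
theorem primrec_termIm {R : α → List (List ℤ)} {t : α → QTerm} (hR : Primrec R)
    (ht : Primrec t) : Primrec fun a => termIm (R a) (t a) := by
  unfold termIm; fun_prop

@[fun_prop]
theorem primrec_eqnRe {R : α → List (List ℤ)} {t : α → List QTerm} (hR : Primrec R)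
    (ht : Primrec t) : Primrec fun a => eqnRe (R a) (t a) := by
  unfold eqnRe; fun_prop

@[fun_prop]
theorem primrec_eqnIm {R : α → List (List ℤ)} {t : α → List QTerm} (hR : Primrec R)
    (ht : Primrec t) : Primrec fun a => eqnIm (R a) (t a) := by
  unfold eqnIm; fun_prop

@[fun_prop]
theorem primrec_isMultiple {m p : α → List ℤ} {Q : α → List (List ℤ)} (hm : Primrec m)
    (hQ : Primrec Q) (hp : Primrec p) : Primrec fun a => isMultiple (m a) (Q a) (p a) := by
  unfold isMultiple; fun_prop

@[fun_prop]
theorem primrec_check {S : α → QSystem} {c : α → Cert} (hS : Primrec S) (hc : Primrec c) :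
    Primrec fun a => check (S a) (c a) := by
  unfold check; fun_prop

end

/-! ### Soundness of certificates -/

theorem isMultiple_iff (m : List ℤ) (Q : List (List ℤ)) (p : List ℤ) :
    isMultiple m Q p = true ↔ ∃ q ∈ Q, polyOfCoeffs p = polyOfCoeffs m * polyOfCoeffs q := by
  simp only [isMultiple, List.any_eq_true, CoeffList.isZero_iff, CoeffList.polyOfCoeffs_add,
    CoeffList.polyOfCoeffs_smul, CoeffList.polyOfCoeffs_mul]
  simp [add_neg_eq_zero]

/-- The value at `θ` of the polynomial with coefficients `p`. -/
noncomputable def val (θ : ℝ) (p : List ℤ) : ℝ := aeval θ (polyOfCoeffs p)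

theorem val_add (θ : ℝ) (p q : List ℤ) : val θ (CoeffList.add p q) = val θ p + val θ q := by
  simp [val, CoeffList.polyOfCoeffs_add]

theorem val_mul (θ : ℝ) (p q : List ℤ) : val θ (CoeffList.mul p q) = val θ p * val θ q := by
  simp [val, CoeffList.polyOfCoeffs_mul]

theorem val_smul (θ : ℝ) (c : ℤ) (p : List ℤ) : val θ (CoeffList.smul c p) = c * val θ p := by
  simp [val, CoeffList.polyOfCoeffs_smul]

/-- The equations, multiplied by the square of the common denominator, in terms of `θ`. -/
theorem val_eqn {θ D : ℝ} {R : List (List ℤ)} {a : List ℕ → ℂ} (e : List QTerm)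
    (h : ∀ t ∈ e, ∀ v, v = t.2.1 ∨ v = t.2.2.1 → D * a v = ⟨val θ (part R v 0), val θ (part R v 1)⟩) :
    (D : ℂ) ^ 2 * (e.map (QTerm.value a)).sum = ⟨val θ (eqnRe R e), val θ (eqnIm R e)⟩ := by
  induction e with
  | nil => simp [eqnRe, eqnIm, val, polyOfCoeffs]; rfl
  | cons t e ih =>
    have ih := ih fun t' ht' => h t' (List.mem_cons_of_mem _ ht')
    have h1 := h t List.mem_cons_self t.2.1 (Or.inl rfl)
    have h2 := h t List.mem_cons_self t.2.2.1 (Or.inr rfl)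
    rw [List.map_cons, List.sum_cons, mul_add, ih]
    have key : (D : ℂ) ^ 2 * QTerm.value a t = ⟨val θ (termRe R t), val θ (termIm R t)⟩ := by
      have : (D : ℂ) ^ 2 * QTerm.value a t = t.1 * (D * a t.2.1) *
          (bif t.2.2.2 then (starRingEnd ℂ) (D * a t.2.2.1) else (D * a t.2.2.1)) := by
        cases hb : t.2.2.2 <;> simp [QTerm.value, hb] <;> ring
      rw [this, h1, h2]
      apply Complex.ext
      · cases hb : t.2.2.2 <;>
          simp [termRe, hb, val_add, val_mul, val_smul] <;> ring
      · cases hb : t.2.2.2 <;>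
          simp [termIm, hb, val_add, val_mul, val_smul] <;> ring
    rw [key]
    apply Complex.ext <;> simp [eqnRe, eqnIm, val_add]

theorem isAlgebraic_ofReal {x : ℝ} (hx : IsAlgebraic ℚ x) : IsAlgebraic ℚ (x : ℂ) :=
  hx.algebraMap

theorem isAlgebraic_I : IsAlgebraic ℚ Complex.I :=
  ⟨X ^ 2 + 1, by
    intro h
    have := congrArg (eval 0) h
    simp at this, by simp⟩

theorem isAlgebraic_val {θ : ℝ} (hθ : IsAlgebraic ℚ θ) (p : List ℤ) :
    IsAlgebraic ℚ (val θ p) := by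
  induction p with
  | nil => simpa [val, polyOfCoeffs] using isAlgebraic_zero
  | cons c p ih =>
    have : val θ (c :: p) = c + θ * val θ p := by simp [val, polyOfCoeffs_cons]
    rw [this]
    exact (isAlgebraic_intCast c).add (hθ.mul ih)

/-- The unknowns are the values at θ of the listed polynomials, divided by D; by `val_eqn` every
equation holds after multiplication by D². The conditions on `part` make the unknown `[]` equal to D
/ D = 1. -/
theorem exists_solves_of_val {S : QSystem} {R : List (List ℤ)} {θ : ℝ} {D : ℤ}
    (hθ : IsAlgebraic ℚ θ) (hD : D ≠ 0) (h0 : part R [] 0 = [D]) (h1 : part R [] 1 = [])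
    (hS : ∀ e ∈ S, val θ (eqnRe R e) = 0 ∧ val θ (eqnIm R e) = 0) : ∃ a, S.Solves a := by
  have hDC : ((D : ℝ) : ℂ) ≠ 0 := by exact_mod_cast hD
  obtain ⟨a, ha⟩ : ∃ a : List ℕ → ℂ,
      ∀ v, ((D : ℝ) : ℂ) * a v = ⟨val θ (part R v 0), val θ (part R v 1)⟩ :=
    ⟨fun v => ((D : ℝ) : ℂ)⁻¹ * ⟨val θ (part R v 0), val θ (part R v 1)⟩, fun v => by
      rw [← mul_assoc, mul_inv_cancel₀ hDC, one_mul]⟩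
  refine ⟨a, ⟨?_, fun v => ?_, fun e he => ?_⟩⟩
  · refine mul_left_cancel₀ hDC ?_
    rw [ha, h0, h1]
    apply Complex.ext <;> simp [val, polyOfCoeffs]
  · have : a v = ((D : ℝ) : ℂ)⁻¹ *
        ((val θ (part R v 0) : ℂ) + (val θ (part R v 1) : ℂ) * Complex.I) := by
      rw [← Complex.mk_eq_add_mul_I, ← ha, ← mul_assoc, inv_mul_cancel₀ hDC, one_mul]
    rw [this]
    exact (isAlgebraic_ofReal (isAlgebraic_intCast D)).inv.mul
      ((isAlgebraic_ofReal (isAlgebraic_val hθ _)).add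
        ((isAlgebraic_ofReal (isAlgebraic_val hθ _)).mul isAlgebraic_I))
  · have h7 := val_eqn (θ := θ) (D := D) (R := R) (a := a) e fun _ _ v _ => ha v
    rw [(hS e he).1, (hS e he).2] at h7
    exact (mul_eq_zero.1 (h7.trans rfl)).resolve_left (pow_ne_zero _ hDC)

theorem aeval_real_intCast (p : ℤ[X]) (z : ℤ) : aeval (z : ℝ) p = ((p.eval z : ℤ) : ℝ) := by
  simpa using aeval_algebraMap_apply ℝ z p

theorem exists_root_of_eval {m : List ℤ} {lo hi : ℤ} (h1 : CoeffList.eval m lo ≤ 0)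
    (h2 : 1 ≤ CoeffList.eval m hi) : ∃ θ : ℝ, aeval θ (polyOfCoeffs m) = 0 := by
  have hc : Continuous fun x : ℝ => aeval x (polyOfCoeffs m) := by fun_prop
  refine mem_range_of_exists_le_of_exists_ge hc ⟨lo, ?_⟩ ⟨hi, ?_⟩
  · rw [aeval_real_intCast, CoeffList.eval_polyOfCoeffs]; exact_mod_cast h1
  · rw [aeval_real_intCast, CoeffList.eval_polyOfCoeffs]; exact_mod_cast (by omega)

theorem check_iff (S : QSystem) (c : Cert) : check S c = true ↔
    CoeffList.eval c.1.1 c.1.2.1 ≤ 0 ∧ 1 ≤ CoeffList.eval c.1.1 c.1.2.2.1 ∧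
    0 < c.1.2.2.2.natAbs ∧ part c.2.1 [] 0 = [c.1.2.2.2] ∧ part c.2.1 [] 1 = [] ∧
    ∀ e ∈ S, (∃ q ∈ c.2.2, polyOfCoeffs (eqnRe c.2.1 e) = polyOfCoeffs c.1.1 * polyOfCoeffs q) ∧
      ∃ q ∈ c.2.2, polyOfCoeffs (eqnIm c.2.1 e) = polyOfCoeffs c.1.1 * polyOfCoeffs q := by
  unfold check
  simp only [Bool.and_eq_true, decide_eq_true_eq, List.all_eq_true, isMultiple_iff, and_assoc]

/-- The change of sign yields a real root θ of m, and the quotients show that all equations vanish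
at θ. Irreducibility of m and uniqueness of θ play no role: each real root gives a solution. -/
theorem exists_solves_of_check {S : QSystem} {c : Cert} (h : check S c = true) :
    ∃ a, S.Solves a := by
  obtain ⟨h1, h2, h3, h4, h5, h6⟩ := (check_iff S c).1 h
  have hm : polyOfCoeffs c.1.1 ≠ 0 := by
    intro h0
    rw [← CoeffList.eval_polyOfCoeffs, h0, eval_zero] at h2
    omega
  obtain ⟨θ, hθ⟩ := exists_root_of_eval h1 h2
  have hθZ : IsAlgebraic ℤ θ := ⟨_, hm, hθ⟩
  have hθalg : IsAlgebraic ℚ θ := hθZ.extendScalars (FaithfulSMul.algebraMap_injective ℤ ℚ)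
  refine exists_solves_of_val hθalg (Int.natAbs_pos.1 h3) h4 h5 fun e he => ?_
  obtain ⟨⟨q, -, hq⟩, ⟨q', -, hq'⟩⟩ := h6 e he
  exact ⟨by rw [val, hq, map_mul, hθ, zero_mul], by rw [val, hq', map_mul, hθ, zero_mul]⟩

end QSystem

/-! ### Finitely many real algebraic numbers as polynomials in one algebraic integer -/

/-- The primitive element theorem for the number field generated by `s` inside ℝ. -/
theorem exists_aeval_eq_of_finite {s : Set ℝ} (hs : s.Finite) (halg : ∀ x ∈ s, IsAlgebraic ℚ x) :
    ∃ θ : ℝ, IsAlgebraic ℚ θ ∧ ∀ x ∈ s, ∃ p : ℚ[X], aeval θ p = x := by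
  have : Finite s := hs
  have : FiniteDimensional ℚ (IntermediateField.adjoin ℚ s) :=
    IntermediateField.finiteDimensional_adjoin fun x hx => (halg x hx).isIntegral
  obtain ⟨θ, hθ⟩ := Field.exists_primitive_element ℚ (IntermediateField.adjoin ℚ s)
  have hint : IsAlgebraic ℚ θ := Algebra.IsAlgebraic.isAlgebraic θ
  refine ⟨θ, hint.algebraMap, fun x hx => ?_⟩
  have hx' : (⟨x, IntermediateField.subset_adjoin ℚ s hx⟩ : IntermediateField.adjoin ℚ s) ∈
      (IntermediateField.adjoin ℚ {θ}).toSubalgebra := by rw [hθ]; trivial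
  rw [IntermediateField.adjoin_simple_toSubalgebra_of_isAlgebraic hint,
    Algebra.adjoin_singleton_eq_range_aeval] at hx'
  obtain ⟨p, hp⟩ := hx'
  refine ⟨p, ?_⟩
  have := congrArg (algebraMap (IntermediateField.adjoin ℚ s) ℝ) hp
  exact (aeval_algebraMap_apply ℝ θ p).trans this

/-- Otherwise, by density, the minimal polynomial is non-negative on ℝ and has a minimum at its root
θ. Its derivative then vanishes at θ, which is impossible for reasons of degree. -/
theorem exists_rat_aeval_minpoly_neg {θ : ℝ} (hθ : IsIntegral ℤ θ) :
    ∃ q : ℚ, aeval (q : ℝ) (minpoly ℤ θ) < 0 := by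
  have hc : Continuous fun x : ℝ => aeval x (minpoly ℤ θ) := by fun_prop
  by_contra! hcon
  have hall : ∀ y : ℝ, 0 ≤ aeval y (minpoly ℤ θ) := fun y => by
    have hcl : IsClosed {y : ℝ | 0 ≤ aeval y (minpoly ℤ θ)} := isClosed_le continuous_const hc
    exact (Rat.denseRange_cast (𝕜 := ℝ)).induction_on y hcl hcon
  have hmin : IsLocalMin (fun x : ℝ => aeval x (minpoly ℤ θ)) θ :=
    Filter.Eventually.of_forall fun y => by
      simpa only [minpoly.aeval] using hall y
  have hder := hmin.deriv_eq_zero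
  rw [Polynomial.deriv_aeval] at hder
  have hdvd := minpoly.isIntegrallyClosed_dvd hθ hder
  have hpos := minpoly.natDegree_pos hθ
  have h0 : derivative (minpoly ℤ θ) = 0 := by
    by_contra hne
    have := natDegree_le_of_dvd hdvd hne
    have := natDegree_derivative_lt hpos.ne'
    omega
  have := derivative_eq_zero.1 h0
  omega

theorem exists_one_le_eval {f : ℤ[X]} (hf : f.Monic) (hd : 0 < f.natDegree) :
    ∃ z : ℤ, 1 ≤ f.eval z := by
  have ht : Filter.Tendsto (fun x : ℝ => eval x (f.map (Int.castRingHom ℝ))) Filter.atTop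
      Filter.atTop := by
    refine tendsto_atTop_of_leadingCoeff_nonneg _ ?_ ?_
    · rw [← natDegree_pos_iff_degree_pos, hf.natDegree_map]; exact hd
    · rw [(hf.map _).leadingCoeff]; norm_num
  have ht' := ht.comp tendsto_natCast_atTop_atTop
  obtain ⟨n, hn⟩ := (ht'.eventually_ge_atTop 1).exists
  refine ⟨n, ?_⟩
  have h2 : eval ((n : ℤ) : ℝ) (f.map (Int.castRingHom ℝ)) = ((f.eval (n : ℤ) : ℤ) : ℝ) := by
    exact eval_map_apply (Int.castRingHom ℝ) (n : ℤ) (p := f)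
  simp only [Function.comp] at hn
  rw [← Int.cast_natCast (R := ℝ) n, h2] at hn
  exact_mod_cast hn

/-- A primitive element is scaled twice: by m to become integral, and by the denominator of a
rational point where its minimal polynomial is negative, so that this point becomes an integer. -/
theorem exists_integral_generator {s : Set ℝ} (hs : s.Finite) (halg : ∀ x ∈ s, IsAlgebraic ℚ x) :
    ∃ θ : ℝ, IsIntegral ℤ θ ∧ (∃ lo : ℤ, (minpoly ℤ θ).eval lo ≤ 0) ∧
      ∃ D : ℤ, D ≠ 0 ∧ ∀ x ∈ s, ∃ p : ℤ[X], aeval θ p = D * x := by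
  obtain ⟨θ₀, hθ₀, hx₀⟩ := exists_aeval_eq_of_finite hs halg
  obtain ⟨m, hm, hint⟩ : ∃ m : ℤ, m ≠ 0 ∧ IsIntegral ℤ (m • θ₀) := by
    have : IsAlgebraic ℤ θ₀ := (IsFractionRing.isAlgebraic_iff ℤ ℚ ℝ).2 hθ₀
    exact this.exists_integral_multiple
  obtain ⟨q, hq⟩ := exists_rat_aeval_minpoly_neg hint
  have hden : (q.den : ℤ) ≠ 0 := by exact_mod_cast q.den_ne_zero
  have hdenR : ((q.den : ℤ) : ℝ) ≠ 0 := by exact_mod_cast hden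
  refine ⟨(q.den : ℤ) • m • θ₀, hint.smul _, ⟨q.num, ?_⟩, ?_⟩
  -- Scaling the roots by `q.den` multiplies the value by a power of `q.den` and moves the point
  -- from `q` to `q.num`.
  · rw [IsIntegrallyClosed.minpoly_smul hden hint]
    have h1 := scaleRoots_eval₂_mul (p := minpoly ℤ (m • θ₀)) (algebraMap ℤ ℝ) (q : ℝ) (q.den : ℤ)
    have h2 : algebraMap ℤ ℝ (q.den : ℤ) * (q : ℝ) = ((q.num : ℤ) : ℝ) := by
      have h := Rat.den_mul_eq_num q
      have : ((q.den : ℚ) : ℝ) * (q : ℝ) = ((q.num : ℚ) : ℝ) := by rw [← Rat.cast_mul, h]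
      simpa using this
    rw [h2] at h1
    change aeval ((q.num : ℤ) : ℝ) _ = _ * aeval (q : ℝ) _ at h1
    have h3 : aeval ((q.num : ℤ) : ℝ) (scaleRoots (minpoly ℤ (m • θ₀)) q.den) ≤ 0 := by
      rw [h1]
      exact mul_nonpos_of_nonneg_of_nonpos (by simp) hq.le
    rw [QSystem.aeval_real_intCast] at h3
    exact_mod_cast h3
  -- Substituting X / (den · m) expresses `x` through the scaled generator; `b` clears the
  -- denominators for this one `x`, and D is the product of all these `b`.
  · have key : ∀ x ∈ s, ∃ b : ℤ, b ≠ 0 ∧ ∃ p : ℤ[X],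
        aeval ((q.den : ℤ) • m • θ₀) p = b * x := fun x hx => by
      obtain ⟨p, hp⟩ := hx₀ x hx
      obtain ⟨b, hb, hbp⟩ := IsLocalization.integerNormalization_spec (nonZeroDivisors ℤ)
        (p.comp (C (((q.den : ℚ) * m)⁻¹) * X))
      refine ⟨b, nonZeroDivisors.ne_zero hb, IsLocalization.integerNormalization (nonZeroDivisors ℤ)
        (p.comp (C (((q.den : ℚ) * m)⁻¹) * X)), ?_⟩
      rw [← aeval_map_algebraMap ℚ, hbp]
      have h5 : aeval ((q.den : ℤ) • m • θ₀) (p.comp (C (((q.den : ℚ) * m)⁻¹) * X)) = x := by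
        rw [aeval_comp, ← hp]
        congr 1
        have hmR : (m : ℝ) ≠ 0 := by exact_mod_cast hm
        simp only [map_mul, aeval_C, aeval_X, map_inv₀, zsmul_eq_mul]
        simp only [eq_ratCast, Rat.cast_natCast, Rat.cast_intCast, Int.cast_natCast] at *
        field_simp
      rw [map_zsmul, h5, zsmul_eq_mul]
    choose! b hb p hp using key
    refine ⟨∏ x ∈ hs.toFinset, b x,
      Finset.prod_ne_zero_iff.2 fun x hx => hb x (hs.mem_toFinset.1 hx), fun x hx => ?_⟩
    obtain ⟨c, hc⟩ := Finset.dvd_prod_of_mem b (hs.mem_toFinset.2 hx)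
    refine ⟨C c * p x, ?_⟩
    rw [hc, map_mul, hp x hx]
    simp
    ring

/-! ### Completeness of certificates -/

namespace QSystem

theorem exists_bound (S : QSystem) : ∃ N : ℕ, ∀ e ∈ S, ∀ t ∈ e, ∀ v, v = t.2.1 ∨ v = t.2.2.1 →
    2 * Encodable.encode v + 1 < N := by
  refine ⟨(S.flatten.map fun t => 2 * Encodable.encode t.2.1 + 2 * Encodable.encode t.2.2.1 + 2).sum,
    fun e he t ht v hv => ?_⟩
  have hmem : t ∈ S.flatten := List.mem_flatten.2 ⟨e, he, ht⟩
  have := List.single_le_sum (fun _ _ => Nat.zero_le _) _ (List.mem_map_of_mem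
    (f := fun t : QTerm => 2 * Encodable.encode t.2.1 + 2 * Encodable.encode t.2.2.1 + 2) hmem)
  rcases hv with rfl | rfl <;> omega

theorem isAlgebraic_re_im {z : ℂ} (hz : IsAlgebraic ℚ z) :
    IsAlgebraic ℚ z.re ∧ IsAlgebraic ℚ z.im := by
  have hconj : IsAlgebraic ℚ ((starRingEnd ℂ) z) :=
    hz.algHom ((Complex.conjAe.toAlgHom).restrictScalars ℚ)
  have hinj : Function.Injective (algebraMap ℝ ℂ) := Complex.ofReal_injective
  have h2 : IsAlgebraic ℚ (2 : ℂ)⁻¹ := by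
    have : IsAlgebraic ℚ ((2 : ℕ) : ℂ) := isAlgebraic_natCast 2
    exact_mod_cast this.inv
  constructor
  · rw [← isAlgebraic_algebraMap_iff (R := ℚ) (A := ℂ) hinj]
    have : algebraMap ℝ ℂ z.re = (z + (starRingEnd ℂ) z) * 2⁻¹ := by
      rw [Complex.add_conj]; simp; ring
    rw [this]
    exact (hz.add hconj).mul h2
  · rw [← isAlgebraic_algebraMap_iff (R := ℚ) (A := ℂ) hinj]
    have : algebraMap ℝ ℂ z.im = (z - (starRingEnd ℂ) z) * 2⁻¹ * Complex.I⁻¹ := by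
      rw [Complex.sub_conj]
      field_simp [Complex.I_ne_zero]
      simp
      ring
    rw [this]
    exact ((hz.sub hconj).mul h2).mul isAlgebraic_I.inv

theorem exists_check_of_solves {S : QSystem} {a : List ℕ → ℂ} (h : S.Solves a) :
    ∃ c, check S c = true := by
  obtain ⟨N, hN⟩ := exists_bound S
  -- The enumeration of real and imaginary parts matches the indices used by `part`.
  let β : ℕ → ℝ := fun n => if n % 2 = 0 then (a (Denumerable.ofNat (List ℕ) (n / 2))).re
    else (a (Denumerable.ofNat (List ℕ) (n / 2))).im
  have hβalg : ∀ x ∈ β '' Set.Iio N, IsAlgebraic ℚ x := by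
    rintro _ ⟨n, -, rfl⟩
    simp only [β]
    split_ifs
    exacts [(isAlgebraic_re_im (h.alg _)).1, (isAlgebraic_re_im (h.alg _)).2]
  obtain ⟨θ, hθ, ⟨lo, hlo⟩, D, hD, hp⟩ :=
    exists_integral_generator ((Set.finite_Iio N).image β) hβalg
  obtain ⟨hi, hhi⟩ := exists_one_le_eval (minpoly.monic hθ) (minpoly.natDegree_pos hθ)
  have hp' : ∀ n < N, ∃ l : List ℤ, val θ l = D * β n := fun n hn => by
    obtain ⟨p, hp⟩ := hp (β n) ⟨n, hn, rfl⟩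
    obtain ⟨l, rfl⟩ := exists_coeffs p
    exact ⟨l, hp⟩
  choose! P hP using hp'
  -- Entries 0 and 1 belong to the unknown `[]`, whose code is 0. `check` compares them literally
  -- with `[D]` and `[]`, so they are prescribed instead of chosen.
  let R : List (List ℤ) := [D] :: [] :: (List.range N).map fun n => P (n + 2)
  have hβ0 : ∀ v, β (2 * Encodable.encode v) = (a v).re := fun v => by simp [β]
  have hβ1 : ∀ v, β (2 * Encodable.encode v + 1) = (a v).im := fun v => by
    have e1 : (2 * Encodable.encode v + 1) % 2 ≠ 0 := by omega
    have e2 : (2 * Encodable.encode v + 1) / 2 = Encodable.encode v := by omega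
    simp only [β, if_neg e1, e2, Denumerable.ofNat_encode]
  have hR : ∀ n < N, val θ (R.getD n []) = D * β n := fun n hn => by
    match n with
    | 0 =>
      have := hβ0 []
      rw [show Encodable.encode ([] : List ℕ) = 0 from rfl, h.one] at this
      rw [show β 0 = 1 from this]
      simp [R, val, polyOfCoeffs]
    | 1 =>
      have := hβ1 []
      rw [show Encodable.encode ([] : List ℕ) = 0 from rfl, h.one] at this
      rw [show β 1 = 0 from this]
      simp [R, val, polyOfCoeffs]
    | n + 2 =>
      have : R.getD (n + 2) [] = P (n + 2) := by
        simp only [R, List.getD_cons_succ]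
        rw [getD_map_range, if_pos (by omega)]
      rw [this, hP _ hn]
  have hpart : ∀ e ∈ S, ∀ t ∈ e, ∀ v, v = t.2.1 ∨ v = t.2.2.1 →
      ((D : ℝ) : ℂ) * a v = ⟨val θ (part R v 0), val θ (part R v 1)⟩ := fun e he t ht v hv => by
    have hb := hN e he t ht v hv
    rw [part, part, hR _ (by omega), hR _ (by omega), hβ1, add_zero, hβ0]
    apply Complex.ext <;> simp
  obtain ⟨m, hm⟩ := exists_coeffs (minpoly ℤ θ)
  have hdvd : ∀ l : List ℤ, val θ l = 0 → ∃ q, polyOfCoeffs l = polyOfCoeffs m * polyOfCoeffs q :=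
    fun l hl => by
      obtain ⟨q, hq⟩ := minpoly.isIntegrallyClosed_dvd hθ hl
      obtain ⟨q, rfl⟩ := exists_coeffs q
      exact ⟨q, by rw [hq, hm]⟩
  choose! Q hQ using hdvd
  refine ⟨((m, lo, hi, D), R, S.map (fun e => Q (eqnRe R e)) ++ S.map fun e => Q (eqnIm R e)),
    (check_iff _ _).2 ⟨?_, ?_, Int.natAbs_pos.2 hD, rfl, rfl, fun e he => ?_⟩⟩
  · rw [← CoeffList.eval_polyOfCoeffs, hm]; exact hlo
  · rw [← CoeffList.eval_polyOfCoeffs, hm]; exact hhi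
  · have h1 := val_eqn (θ := θ) (D := D) (R := R) (a := a) e (hpart e he)
    rw [h.holds e he, mul_zero] at h1
    have hre : val θ (eqnRe R e) = 0 := (congrArg Complex.re h1).symm
    have him : val θ (eqnIm R e) = 0 := (congrArg Complex.im h1).symm
    exact ⟨⟨_, List.mem_append_left _ (List.mem_map_of_mem he), hQ _ hre⟩,
      ⟨_, List.mem_append_right _ (List.mem_map_of_mem he), hQ _ him⟩⟩

theorem exists_check_iff (S : QSystem) : (∃ c, check S c = true) ↔ ∃ a, S.Solves a :=
  ⟨fun ⟨_, h⟩ => exists_solves_of_check h, fun ⟨_, h⟩ => exists_check_of_solves h⟩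

/-! ### Generation of the systems -/

/-- The equations saying that the unknowns `[tag, l, m]` are the given rational numbers. -/
def constRow (tag l : ℕ) (row : List RatCode) : QSystem :=
  (List.range row.length).map fun m =>
    [(((row.getD m (0, 1)).2 : ℤ), [], [tag, l, m], false),
     (-(row.getD m (0, 1)).1, [], [], false)]

/-- The equations saying that the unknowns `[tag, l, m]` form the given rational matrix. -/
def constRows (tag : ℕ) (M : List (List RatCode)) : QSystem :=
  (List.range M.length).flatMap fun l => constRow tag l (M.getD l [])

/-- An equation that is solvable if and only if `b` is true. -/
def gate (b : Bool) : QSystem := [[(bif b then 0 else 1, [], [], false)]]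

/-- The spectral decomposition of the unit vectors (columns `c < d`) and of `x` (column `d`):
eigenvalues `[0, i]`, vectors `[1, c, i, k, ·]`. -/
def chainEqs (d r K : ℕ) : QSystem :=
  ((List.range (d + 1)).flatMap fun c => (List.range d).map fun l =>
    ((List.range r).map fun i => (1, [], [1, c, i, 0, l], false)) ++
      [(-1, [], [3, c, l], false)]) ++
  ((List.range (d + 1)).flatMap fun c => (List.range r).flatMap fun i =>
    (List.range K).flatMap fun k => (List.range d).map fun l =>
      ((List.range d).map fun m => (1, [2, l, m], [1, c, i, k, m], false)) ++
        [(-1, [0, i], [1, c, i, k, l], false), (-1, [], [1, c, i, k + 1, l], false)]) ++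
  ((List.range (d + 1)).flatMap fun c => (List.range r).flatMap fun i =>
    (List.range d).map fun l => [(1, [], [1, c, i, K, l], false)])

/-- Comparison of the moduli of the eigenvalues; `[6, i]` is `1` or `0` according to whether the
`i`-th eigenvalue is as large as the `i₀`-th one. -/
def modulusEqs (r i₀ : ℕ) : QSystem :=
  (List.range r).flatMap fun i =>
    [[(1, [0, i], [0, i], true), (1, [4, i], [4, i], true), (-1, [0, i₀], [0, i₀], true)],
     [(1, [6, i], [4, i], false)],
     [(1, [], [6, i], false), (1, [4, i], [5, i], false), (-1, [], [], false)]]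

/-- The component of `x` at the dominating eigenvalues has height `t + 1`. -/
def heightEqs (d r t i₀ : ℕ) : QSystem :=
  ((List.range r).flatMap fun i => (List.range d).map fun l =>
    [(1, [6, i], [1, d, i, t + 1, l], false)]) ++
  [((List.range d).map fun l => (1, [1, d, i₀, t, l], [7, l], false)) ++ [(-1, [], [], false)]]

/-- The part common to both algorithms. -/
def baseSystem (A : List (List RatCode)) (x : List RatCode) (r K t i₀ : ℕ) : QSystem :=
  constRows 2 A ++ constRow 3 x.length x ++
  ((List.range x.length).flatMap fun c => (List.range x.length).map fun l =>
    [(1, [], [3, c, l], false), (-(if c = l then 1 else 0), [], [], false)]) ++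
  chainEqs x.length r K ++ modulusEqs r i₀ ++ heightEqs x.length r t i₀ ++
  gate (decide (i₀ < r)) ++ gate (decide (t < K))

/-- `[9, i]` is `1` or `0` according to whether the `i`-th eigenvalue is leading; there are `p`
leading ones and their multiplicity is `s + 1`. -/
def leadingEqs (d r s p : ℕ) : QSystem :=
  ((List.range r).flatMap fun i => (List.range r).map fun j =>
    [(1, [0, i], [8, i, j], false), (-1, [0, j], [8, i, j], false),
     (-(if i = j then 0 else 1), [], [], false)]) ++
  ((List.range d).flatMap fun c => (List.range r).flatMap fun i => (List.range d).flatMap fun l =>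
    [[(1, [6, i], [1, c, i, s + 1, l], false)],
     [(1, [6, i], [1, c, i, s, l], false), (-1, [9, i], [1, c, i, s, l], false)]]) ++
  ((List.range r).flatMap fun i =>
    [[(1, [9, i], [9, i], false), (-1, [], [9, i], false)],
     [(1, [9, i], [6, i], false), (-1, [], [9, i], false)],
     ((List.range d).flatMap fun c => (List.range d).map fun l =>
       (1, [1, c, i, s, l], [10, i, c, l], false)) ++ [(-1, [], [9, i], false)]]) ++
  [((List.range r).map fun i => (1, [], [9, i], false)) ++ [(-(p : ℤ), [], [], false)]]

/-- The vectors `[11, k, ·]`, for `k < p`, are real and linearly independent, and their complex span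
contains the vectors to which the orbit converges. -/
def basisEqs (d r t p : ℕ) : QSystem :=
  ((List.range p).flatMap fun k => (List.range p).map fun k' =>
    ((List.range d).map fun l => (1, [12, k, l], [11, k', l], false)) ++
      [(-(if k = k' then 1 else 0), [], [], false)]) ++
  ((List.range p).flatMap fun k => (List.range d).map fun l =>
    [(1, [], [11, k, l], false), (-1, [], [11, k, l], true)]) ++
  ((List.range r).flatMap fun i => (List.range d).map fun l =>
    (1, [6, i], [1, d, i, t, l], false) ::
      (List.range p).map fun k => (-1, [13, i, k], [11, k, l], false))

/-- The pair `(n, q)` describes an algebraic number: a root `α` of `q (X - n)` with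
`|α - n| ≤ 1`. -/
abbrev NearCode := ℤ × List ℤ

/-- A condition ensuring that `q` is injective on the disc with radius `2` about `0`. -/
def dominated (q : List ℤ) : Bool :=
  decide (((List.range q.length).map fun j =>
    (j + 2) * (q.getD (j + 2) 0).natAbs * 2 ^ (j + 1)).sum < (q.getD 1 0).natAbs)

/-- The unknown `[11, k, l]` is described by the given pair. -/
def nearEqs (k l : ℕ) (c : NearCode) : QSystem :=
  [[(1, [], [14, k, l, 0], false), (-1, [], [], false)]] ++
  ((List.range c.2.length).map fun j =>
    [(1, [14, k, l, j], [11, k, l], false), (-c.1, [], [14, k, l, j], false),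
     (-1, [], [14, k, l, j + 1], false)]) ++
  [(List.range c.2.length).map fun j => (c.2.getD j 0, [], [14, k, l, j], false),
   [(1, [11, k, l], [11, k, l], false), (-(2 * c.1), [], [11, k, l], false),
    (c.1 * c.1, [], [], false), (1, [15, k, l], [15, k, l], true), (-1, [], [], false)]] ++
  gate (dominated c.2)

/-- The system for the computation of the limit subspace. -/
def limitSystem (A : List (List RatCode)) (x : List RatCode) (r K t i₀ s : ℕ)
    (codes : List (List NearCode)) : QSystem :=
  baseSystem A x r K t i₀ ++ gate (decide (s + 1 < K)) ++
  leadingEqs x.length r s codes.length ++ basisEqs x.length r t codes.length ++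
  ((List.range codes.length).flatMap fun k =>
    gate (decide ((codes.getD k []).length = x.length)) ++
    (List.range x.length).flatMap fun l => nearEqs k l ((codes.getD k []).getD l (0, [])))

/-- `[23, n, ·]` is the `n`-th point of the orbit, for `n ≤ N`. -/
def orbitEqs (d N : ℕ) : QSystem :=
  ((List.range d).map fun l => [(1, [], [23, 0, l], false), (-1, [], [3, d, l], false)]) ++
  ((List.range N).flatMap fun n => (List.range d).map fun l =>
    ((List.range d).map fun m => (1, [2, l, m], [23, n, m], false)) ++
      [(-1, [], [23, n + 1, l], false)])

/-- The system saying that the `n`-th point of the orbit is in the span of `U`. -/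
def hitSystem (A : List (List RatCode)) (x : List RatCode) (U : List (List RatCode)) (n : ℕ) :
    QSystem :=
  constRows 2 A ++ constRow 3 x.length x ++ constRows 16 U ++ orbitEqs x.length n ++
  (List.range x.length).map fun l =>
    ((List.range U.length).map fun j => (1, [24, j], [16, j, l], false)) ++
      [(-1, [], [23, n, l], false)]

/-- A linear form `[17, ·]` that vanishes on `U` and on all leading vectors of `x` but one. -/
def functionalEqs (d r K t i₀ u : ℕ) : QSystem :=
  ((List.range u).map fun j => (List.range d).map fun l => (1, [17, l], [16, j, l], false)) ++
  ((List.range r).flatMap fun i => (List.range K).map fun k =>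
    ((List.range d).map fun l => (1, [17, l], [1, d, i, k, l], false)) ++
      [(-1, [], [18, i, k], false)]) ++
  ((List.range r).map fun i => [(1, [6, i], [18, i, t], false),
    (-(if i = i₀ then 1 else 0), [], [], false)])

/-- The number `h` bounds all quantities that matter for the speed of convergence. -/
def boundEqs (r K i₀ h : ℕ) : QSystem :=
  ((List.range r).flatMap fun i => (List.range K).map fun k =>
    [(1, [18, i, k], [18, i, k], true), (1, [19, i, k], [19, i, k], true),
     (-(h : ℤ), [], [], false)]) ++
  ((List.range r).map fun i =>
    [((h : ℤ), [4, i], [4, i], true), (1, [], [6, i], false), (-1, [], [], false),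
     (-1, [20, i], [20, i], true)]) ++
  [[((h : ℤ), [0, i₀], [0, i₀], true), (-1, [], [], false), (-1, [21], [21], true)],
   [(1, [0, i₀], [0, i₀], true), (1, [22], [22], true), (-(h : ℤ), [], [], false)]]

/-- For each `n < N`, a linear form `[24, n, ·]` that vanishes on `U` but not at the `n`-th point of
the orbit. -/
def separationEqs (d N u : ℕ) : QSystem :=
  (List.range N).flatMap fun n =>
    (((List.range d).map fun l => (1, [24, n, l], [23, n, l], false)) ++ [(-1, [], [], false)]) ::
    (List.range u).map fun j => (List.range d).map fun l => (1, [24, n, l], [16, j, l], false)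

/-- The factor in the bound for the speed of convergence. -/
def ratioBound (K h : ℕ) : ℕ := K * 2 ^ K * (4 * h ^ 2) ^ K * h ^ K

/-- From this index on the orbit is far from the given subspace. -/
def escapeIndex (r K h : ℕ) : ℕ := 2 * K + r * K * h * ratioBound K h + 1

/-- The system saying that the orbit does not meet the span of `U`. -/
def missSystem (A : List (List RatCode)) (x : List RatCode) (U : List (List RatCode))
    (r K t i₀ h : ℕ) : QSystem :=
  baseSystem A x r K t i₀ ++ constRows 16 U ++ orbitEqs x.length (escapeIndex r K h) ++
  functionalEqs x.length r K t i₀ U.length ++ boundEqs r K i₀ h ++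
  separationEqs x.length (escapeIndex r K h) U.length

/-! ### The generation is primitive recursive -/

section
variable {α : Type*} [Primcodable α]

@[fun_prop]
theorem primrec_constRow {tag l : α → ℕ} {row : α → List RatCode} (h1 : Primrec tag)
    (h2 : Primrec l) (h3 : Primrec row) : Primrec fun a => constRow (tag a) (l a) (row a) := by
  unfold constRow; fun_prop

@[fun_prop]
theorem primrec_constRows {tag : α → ℕ} {M : α → List (List RatCode)} (h1 : Primrec tag)
    (h3 : Primrec M) : Primrec fun a => constRows (tag a) (M a) := by
  unfold constRows; fun_prop

@[fun_prop]
theorem primrec_gate {b : α → Bool} (h : Primrec b) : Primrec fun a => gate (b a) := by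
  unfold gate; fun_prop

@[fun_prop]
theorem primrec_chainEqs {d r K : α → ℕ} (h1 : Primrec d) (h2 : Primrec r) (h3 : Primrec K) :
    Primrec fun a => chainEqs (d a) (r a) (K a) := by
  unfold chainEqs; fun_prop

@[fun_prop]
theorem primrec_modulusEqs {r i₀ : α → ℕ} (h1 : Primrec r) (h2 : Primrec i₀) :
    Primrec fun a => modulusEqs (r a) (i₀ a) := by
  unfold modulusEqs; fun_prop

@[fun_prop]
theorem primrec_heightEqs {d r t i₀ : α → ℕ} (h1 : Primrec d) (h2 : Primrec r) (h3 : Primrec t)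
    (h4 : Primrec i₀) : Primrec fun a => heightEqs (d a) (r a) (t a) (i₀ a) := by
  unfold heightEqs; fun_prop

@[fun_prop]
theorem primrec_baseSystem {A : α → List (List RatCode)} {x : α → List RatCode}
    {r K t i₀ : α → ℕ} (hA : Primrec A) (hx : Primrec x) (h1 : Primrec r) (h2 : Primrec K)
    (h3 : Primrec t) (h4 : Primrec i₀) :
    Primrec fun a => baseSystem (A a) (x a) (r a) (K a) (t a) (i₀ a) := by
  unfold baseSystem; fun_prop

@[fun_prop]
theorem primrec_leadingEqs {d r s p : α → ℕ} (h1 : Primrec d) (h2 : Primrec r) (h3 : Primrec s)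
    (h4 : Primrec p) : Primrec fun a => leadingEqs (d a) (r a) (s a) (p a) := by
  unfold leadingEqs; fun_prop

@[fun_prop]
theorem primrec_basisEqs {d r t p : α → ℕ} (h1 : Primrec d) (h2 : Primrec r) (h3 : Primrec t)
    (h4 : Primrec p) : Primrec fun a => basisEqs (d a) (r a) (t a) (p a) := by
  unfold basisEqs; fun_prop

@[fun_prop]
theorem primrec_dominated {q : α → List ℤ} (h : Primrec q) : Primrec fun a => dominated (q a) := by
  unfold dominated
  have h1 : Primrec fun a => ((List.range (q a).length).map fun j =>
      (j + 2) * ((q a).getD (j + 2) 0).natAbs * 2 ^ (j + 1)).sum :=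
    Primrec.foldr_of (h := fun _ b s => b + s) (by fun_prop) (Primrec.const 0) (by fun_prop)
  fun_prop

@[fun_prop]
theorem primrec_nearEqs {k l : α → ℕ} {c : α → NearCode} (h1 : Primrec k) (h2 : Primrec l)
    (h3 : Primrec c) : Primrec fun a => nearEqs (k a) (l a) (c a) := by
  unfold nearEqs; fun_prop

@[fun_prop]
theorem primrec_limitSystem {A : α → List (List RatCode)} {x : α → List RatCode}
    {r K t i₀ s : α → ℕ} {codes : α → List (List NearCode)} (hA : Primrec A) (hx : Primrec x)
    (h1 : Primrec r) (h2 : Primrec K) (h3 : Primrec t) (h4 : Primrec i₀) (h5 : Primrec s)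
    (h6 : Primrec codes) :
    Primrec fun a => limitSystem (A a) (x a) (r a) (K a) (t a) (i₀ a) (s a) (codes a) := by
  unfold limitSystem; fun_prop

@[fun_prop]
theorem primrec_orbitEqs {d N : α → ℕ} (h1 : Primrec d) (h2 : Primrec N) :
    Primrec fun a => orbitEqs (d a) (N a) := by
  unfold orbitEqs; fun_prop

@[fun_prop]
theorem primrec_hitSystem {A U : α → List (List RatCode)} {x : α → List RatCode} {n : α → ℕ}
    (hA : Primrec A) (hx : Primrec x) (hU : Primrec U) (hn : Primrec n) :
    Primrec fun a => hitSystem (A a) (x a) (U a) (n a) := by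
  unfold hitSystem; fun_prop

@[fun_prop]
theorem primrec_functionalEqs {d r K t i₀ u : α → ℕ} (h1 : Primrec d) (h2 : Primrec r)
    (h3 : Primrec K) (h4 : Primrec t) (h5 : Primrec i₀) (h6 : Primrec u) :
    Primrec fun a => functionalEqs (d a) (r a) (K a) (t a) (i₀ a) (u a) := by
  unfold functionalEqs; fun_prop

@[fun_prop]
theorem primrec_boundEqs {r K i₀ h : α → ℕ} (h1 : Primrec r) (h2 : Primrec K) (h3 : Primrec i₀)
    (h4 : Primrec h) : Primrec fun a => boundEqs (r a) (K a) (i₀ a) (h a) := by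
  unfold boundEqs; fun_prop

@[fun_prop]
theorem primrec_separationEqs {d N u : α → ℕ} (h1 : Primrec d) (h2 : Primrec N)
    (h3 : Primrec u) : Primrec fun a => separationEqs (d a) (N a) (u a) := by
  unfold separationEqs; fun_prop

@[fun_prop]
theorem primrec_escapeIndex {r K h : α → ℕ} (h1 : Primrec r) (h2 : Primrec K)
    (h3 : Primrec h) : Primrec fun a => escapeIndex (r a) (K a) (h a) := by
  unfold escapeIndex ratioBound; fun_prop

@[fun_prop]
theorem primrec_missSystem {A U : α → List (List RatCode)} {x : α → List RatCode}
    {r K t i₀ h : α → ℕ} (hA : Primrec A) (hx : Primrec x) (hU : Primrec U)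
    (h1 : Primrec r) (h2 : Primrec K) (h3 : Primrec t) (h4 : Primrec i₀) (h5 : Primrec h) :
    Primrec fun a => missSystem (A a) (x a) (U a) (r a) (K a) (t a) (i₀ a) (h a) := by
  unfold missSystem; fun_prop

end

/-! ### The meaning of the systems -/

theorem holds_nil (a : List ℕ → ℂ) : Holds a [] ↔ True := by simp [Holds]

theorem holds_cons (a : List ℕ → ℂ) (e : List QTerm) (S : QSystem) :
    Holds a (e :: S) ↔ (e.map (QTerm.value a)).sum = 0 ∧ Holds a S := by simp [Holds]

theorem holds_append (a : List ℕ → ℂ) (S T : QSystem) :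
    Holds a (S ++ T) ↔ Holds a S ∧ Holds a T := by
  simp [Holds, or_imp, forall_and]

theorem holds_flatMap_range (a : List ℕ → ℂ) (n : ℕ) (f : ℕ → QSystem) :
    Holds a ((List.range n).flatMap f) ↔ ∀ i < n, Holds a (f i) := by
  simp only [Holds, List.mem_flatMap, List.mem_range]
  exact ⟨fun h i hi e he => h e ⟨i, hi, he⟩, fun h e ⟨i, hi, he⟩ => h i hi e he⟩

theorem holds_map_range (a : List ℕ → ℂ) (n : ℕ) (f : ℕ → List QTerm) :
    Holds a ((List.range n).map f) ↔ ∀ i < n, ((f i).map (QTerm.value a)).sum = 0 := by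
  simp [Holds]

theorem sum_map_flatMap_range {M N : Type*} [AddCommMonoid N] (n : ℕ) (f : ℕ → List M)
    (g : M → N) : (((List.range n).flatMap f).map g).sum =
      ∑ i ∈ Finset.range n, ((f i).map g).sum := by
  induction n with
  | zero => simp
  | succ n ih => simp [List.range_succ, Finset.sum_range_succ, ih, List.flatMap_append]

theorem value_mk (a : List ℕ → ℂ) (c : ℤ) (u v : List ℕ) :
    QTerm.value a (c, u, v, false) = c * a u * a v := rfl

theorem value_mk_conj (a : List ℕ → ℂ) (c : ℤ) (u v : List ℕ) :
    QTerm.value a (c, u, v, true) = c * a u * (starRingEnd ℂ) (a v) := rfl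

attribute [local simp] holds_nil holds_cons holds_append holds_flatMap_range holds_map_range
  sum_map_flatMap_range value_mk value_mk_conj sum_map_range Function.comp_def

variable {a : List ℕ → ℂ}

/-- The vector of the unknowns `p ++ [l]` for `l < d`. -/
def vec (a : List ℕ → ℂ) (d : ℕ) (p : List ℕ) : Fin d → ℂ := fun l => a (p ++ [(l : ℕ)])

/-- The matrix of the unknowns `[2, l, m]`. -/
def mat (a : List ℕ → ℂ) (d : ℕ) : Matrix (Fin d) (Fin d) ℂ := Matrix.of fun l m => a [2, l, m]

theorem forall_lt_iff_fin {d : ℕ} {p : ℕ → Prop} : (∀ l < d, p l) ↔ ∀ l : Fin d, p l :=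
  ⟨fun h l => h l l.2, fun h l hl => h ⟨l, hl⟩⟩

theorem add_neg_add_neg_eq_zero {x y z : ℂ} : x + (-y + -z) = 0 ↔ x = y + z :=
  ⟨fun h => by linear_combination h, fun h => by linear_combination h⟩

theorem add_add_neg_eq_zero {x y z : ℂ} : x + (y + -z) = 0 ↔ x + y = z :=
  ⟨fun h => by linear_combination h, fun h => by linear_combination h⟩

theorem holds_gate (ha : a [] = 1) (b : Bool) : Holds a (gate b) ↔ b = true := by
  unfold gate
  cases b <;> simp [ha]

theorem holds_chainEqs (ha : a [] = 1) (d r K : ℕ) : Holds a (chainEqs d r K) ↔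
    (∀ c ≤ d, ∑ i ∈ Finset.range r, vec a d [1, c, i, 0] = vec a d [3, c]) ∧
    (∀ c ≤ d, ∀ i < r, ∀ k < K, (mat a d).mulVec (vec a d [1, c, i, k]) =
      a [0, i] • vec a d [1, c, i, k] + vec a d [1, c, i, k + 1]) ∧
    ∀ c ≤ d, ∀ i < r, vec a d [1, c, i, K] = 0 := by
  unfold chainEqs
  simp only [funext_iff, Finset.sum_apply, Matrix.mulVec, dotProduct, vec, mat, Pi.add_apply,
    Pi.smul_apply, Matrix.of_apply, Pi.zero_apply, smul_eq_mul, List.cons_append, List.nil_append]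
  simp [ha, add_neg_eq_zero, add_neg_add_neg_eq_zero, forall_lt_iff_fin (d := d),
    Finset.sum_range (n := d)]

/-- The slack `[4, i]` forces |λ_i| ≤ |λ_{i₀}|, with equality exactly if it vanishes. The last two
conditions make `[6, i]` equal to 1 if `[4, i]` is zero; otherwise `[6, i]` is 0 and `[5, i]` is the
inverse of `[4, i]`. -/
theorem holds_modulusEqs (ha : a [] = 1) (r i₀ : ℕ) : Holds a (modulusEqs r i₀) ↔
    ∀ i < r, ‖a [0, i]‖ ^ 2 + ‖a [4, i]‖ ^ 2 = ‖a [0, i₀]‖ ^ 2 ∧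
      (a [6, i] = 0 ∨ a [4, i] = 0) ∧ a [6, i] + a [4, i] * a [5, i] = 1 := by
  unfold modulusEqs
  simp [ha, add_add_neg_eq_zero, Complex.mul_conj']
  norm_cast

/-- The auxiliary vector `[7]` witnesses that the component of `x` at `i₀` has not died out at level
`t`. -/
theorem holds_heightEqs (ha : a [] = 1) (d r t i₀ : ℕ) : Holds a (heightEqs d r t i₀) ↔
    (∀ i < r, a [6, i] • vec a d [1, d, i, t + 1] = 0) ∧
      vec a d [1, d, i₀, t] ⬝ᵥ vec a d [7] = 1 := by
  unfold heightEqs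
  simp only [funext_iff, dotProduct, vec, Pi.smul_apply, Pi.zero_apply, smul_eq_mul,
    List.cons_append, List.nil_append]
  simp [ha, add_neg_eq_zero, forall_lt_iff_fin (d := d), Finset.sum_range (n := d)]

/-- Each entry is fixed by denominator times unknown equals numerator, which has integer
coefficients. -/
theorem holds_constRow_vecCode (ha : a [] = 1) (tag l : ℕ) {d : ℕ} (x : Fin d → ℚ) :
    Holds a (constRow tag l (vecCode x)) ↔ vec a d [tag, l] = fun i => (x i : ℂ) := by
  unfold constRow
  simp only [funext_iff, vec, List.cons_append, List.nil_append]
  have hlen : (vecCode x).length = d := by simp [vecCode]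
  rw [holds_map_range, hlen, forall_lt_iff_fin]
  refine forall_congr' fun i => ?_
  have hget : (vecCode x).getD i (0, 1) = ((x i).num, (x i).den) := by
    simp [vecCode, ratCode]
  have hden : ((x i).den : ℂ) ≠ 0 := by exact_mod_cast (x i).den_ne_zero
  rw [hget]
  simp only [List.map_cons, List.map_nil, List.sum_cons, List.sum_nil, value_mk, ha]
  push_cast
  rw [show ((x i : ℚ) : ℂ) = ((x i).num : ℂ) / ((x i).den : ℂ) from Rat.cast_def _, eq_div_iff hden]
  constructor <;> intro h <;> linear_combination h

theorem holds_constRows_rowsCode (ha : a [] = 1) (tag : ℕ) {k d : ℕ} (u : Fin k → Fin d → ℚ) :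
    Holds a (constRows tag (rowsCode u)) ↔
      ∀ j : Fin k, vec a d [tag, j] = fun i => (u j i : ℂ) := by
  unfold constRows
  have hlen : (rowsCode u).length = k := by simp [rowsCode]
  rw [holds_flatMap_range, hlen, forall_lt_iff_fin]
  refine forall_congr' fun j => ?_
  have hget : (rowsCode u).getD j [] = vecCode (u j) := by simp [rowsCode]
  rw [hget, holds_constRow_vecCode ha]

theorem length_vecCode {d : ℕ} (x : Fin d → ℚ) : (vecCode x).length = d := by simp [vecCode]

theorem length_rowsCode {k d : ℕ} (u : Fin k → Fin d → ℚ) : (rowsCode u).length = k := by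
  simp [rowsCode]

theorem holds_constRows_matrix (ha : a [] = 1) {d : ℕ} (A : Matrix (Fin d) (Fin d) ℚ) :
    Holds a (constRows 2 (rowsCode A)) ↔ mat a d = A.map (algebraMap ℚ ℂ) := by
  refine (holds_constRows_rowsCode ha 2 A).trans ?_
  simp [← Matrix.ext_iff, funext_iff, mat, vec]

theorem holds_unitEqs (ha : a [] = 1) (d : ℕ) :
    Holds a ((List.range d).flatMap fun c => (List.range d).map fun l =>
      [(1, [], [3, c, l], false), (-(if c = l then 1 else 0), [], [], false)]) ↔
    ∀ c : Fin d, vec a d [3, c] = fun l => if c = l then 1 else 0 := by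
  simp only [funext_iff, vec, List.cons_append, List.nil_append]
  simp [ha, add_neg_eq_zero, forall_lt_iff_fin (d := d), Fin.ext_iff]

/-- The unknowns `[8, i, j]` invert differences of eigenvalues, so these are distinct. The
idempotent `[9, i]` must be 1 if a chain at a dominating eigenvalue is non-zero at level `s`; the
witnesses `[10, i, c]` exclude 1 in all other cases. Summing the idempotents counts the leading
eigenvalues. -/
theorem holds_leadingEqs (ha : a [] = 1) (d r s p : ℕ) : Holds a (leadingEqs d r s p) ↔
    (∀ i < r, ∀ j < r, (a [0, i] - a [0, j]) * a [8, i, j] = if i = j then 0 else 1) ∧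
    (∀ c < d, ∀ i < r, a [6, i] • vec a d [1, c, i, s + 1] = 0 ∧
      (a [6, i] - a [9, i]) • vec a d [1, c, i, s] = 0) ∧
    (∀ i < r, a [9, i] * a [9, i] = a [9, i] ∧ a [9, i] * a [6, i] = a [9, i] ∧
      ∑ c ∈ Finset.range d, vec a d [1, c, i, s] ⬝ᵥ vec a d [10, i, c] = a [9, i]) ∧
    ∑ i ∈ Finset.range r, a [9, i] = p := by
  unfold leadingEqs
  simp only [funext_iff, dotProduct, vec, Pi.smul_apply, Pi.zero_apply, smul_eq_mul,
    List.cons_append, List.nil_append, ← forall_and (α := Fin d)]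
  simp [ha, add_neg_eq_zero, add_neg_add_neg_eq_zero, forall_lt_iff_fin (d := d),
    Finset.sum_range (n := d), sub_mul, sub_eq_iff_eq_add']

/-- Independence is witnessed by a dual family `[12, k]`, membership of the leading vectors in the
span by coefficients `[13, i, k]`. -/
theorem holds_basisEqs (ha : a [] = 1) (d r t p : ℕ) : Holds a (basisEqs d r t p) ↔
    (∀ k < p, ∀ k' < p, vec a d [12, k] ⬝ᵥ vec a d [11, k'] = if k = k' then 1 else 0) ∧
    (∀ k < p, ∀ l : Fin d, vec a d [11, k] l = (starRingEnd ℂ) (vec a d [11, k] l)) ∧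
    ∀ i < r, a [6, i] • vec a d [1, d, i, t] =
      ∑ k ∈ Finset.range p, a [13, i, k] • vec a d [11, k] := by
  unfold basisEqs
  simp only [funext_iff, dotProduct, vec, Pi.smul_apply, smul_eq_mul,
    List.cons_append, List.nil_append, Finset.sum_apply]
  simp [ha, add_neg_eq_zero, forall_lt_iff_fin (d := d),
    Finset.sum_range (n := d)]

/-- The unknowns `[14, k, l, j]` are the powers of the difference of the entry and the integer
`c.1`, so that an equation of any degree becomes quadratic. For a real entry the slack `[15, k, l]`
says that this difference is at most 1 in modulus. -/
theorem holds_nearEqs (ha : a [] = 1) (k l : ℕ) (c : NearCode) : Holds a (nearEqs k l c) ↔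
    (a [14, k, l, 0] = 1 ∧
    (∀ j < c.2.length, a [14, k, l, j + 1] = a [14, k, l, j] * (a [11, k, l] - c.1)) ∧
    ∑ j ∈ Finset.range c.2.length, (c.2.getD j 0 : ℂ) * a [14, k, l, j] = 0 ∧
    (a [11, k, l] - c.1) ^ 2 + (‖a [15, k, l]‖ : ℂ) ^ 2 = 1) ∧ dominated c.2 = true := by
  have e1 : ∀ j, a [14, k, l, j] * a [11, k, l] + (-(c.1 * a [14, k, l, j]) +
      -a [14, k, l, j + 1]) = 0 ↔
      a [14, k, l, j + 1] = a [14, k, l, j] * (a [11, k, l] - c.1) := fun j =>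
    ⟨fun h => by linear_combination -h, fun h => by linear_combination -h⟩
  have e2 : a [11, k, l] * a [11, k, l] + (-(2 * c.1 * a [11, k, l]) + (c.1 * c.1 +
      ((‖a [15, k, l]‖ : ℂ) ^ 2 + -1))) = 0 ↔
      (a [11, k, l] - c.1) ^ 2 + (‖a [15, k, l]‖ : ℂ) ^ 2 = 1 :=
    ⟨fun h => by linear_combination h, fun h => by linear_combination h⟩
  unfold nearEqs
  simp [ha, add_neg_eq_zero, holds_gate, and_assoc, e1, e2, Complex.mul_conj']

theorem holds_orbitEqs (ha : a [] = 1) (d N : ℕ) : Holds a (orbitEqs d N) ↔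
    vec a d [23, 0] = vec a d [3, d] ∧
    ∀ n < N, (mat a d).mulVec (vec a d [23, n]) = vec a d [23, n + 1] := by
  unfold orbitEqs
  simp only [funext_iff, dotProduct, vec, mat, Matrix.mulVec, Matrix.of_apply,
    List.cons_append, List.nil_append]
  simp [ha, add_neg_eq_zero, forall_lt_iff_fin (d := d), Finset.sum_range (n := d)]

theorem holds_functionalEqs (ha : a [] = 1) (d r K t i₀ u : ℕ) :
    Holds a (functionalEqs d r K t i₀ u) ↔
    (∀ j < u, vec a d [17] ⬝ᵥ vec a d [16, j] = 0) ∧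
    (∀ i < r, ∀ k < K, vec a d [17] ⬝ᵥ vec a d [1, d, i, k] = a [18, i, k]) ∧
    ∀ i < r, a [6, i] * a [18, i, t] = if i = i₀ then 1 else 0 := by
  unfold functionalEqs
  simp only [dotProduct, vec, List.cons_append, List.nil_append]
  simp [ha, add_neg_eq_zero, Finset.sum_range (n := d)]

/-- All conditions are inequalities with slack. The second one says h(ρ² - |λ_i|²) ≥ 1 at
non-dominating eigenvalues; at dominating ones `[4, i] = 0` and `[6, i] = 1` make it void. -/
theorem holds_boundEqs (ha : a [] = 1) (r K i₀ h : ℕ) : Holds a (boundEqs r K i₀ h) ↔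
    (∀ i < r, ∀ k < K, ‖a [18, i, k]‖ ^ 2 + ‖a [19, i, k]‖ ^ 2 = h) ∧
    (∀ i < r, (h : ℂ) * (‖a [4, i]‖ : ℂ) ^ 2 + a [6, i] = 1 + (‖a [20, i]‖ : ℂ) ^ 2) ∧
    h * ‖a [0, i₀]‖ ^ 2 = 1 + ‖a [21]‖ ^ 2 ∧ ‖a [0, i₀]‖ ^ 2 + ‖a [22]‖ ^ 2 = h := by
  have e1 : ∀ x y z w : ℂ, x + (y + (-z + -w)) = 0 ↔ x + y = z + w := fun x y z w =>
    ⟨fun h => by linear_combination h, fun h => by linear_combination h⟩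
  have e2 : ∀ x w : ℂ, x + (-1 + -w) = 0 ↔ x = 1 + w := fun x w =>
    ⟨fun h => by linear_combination h, fun h => by linear_combination h⟩
  unfold boundEqs
  simp only [holds_append, holds_flatMap_range, holds_map_range, holds_cons, holds_nil, value_mk,
    value_mk_conj, List.map_cons, List.map_nil, List.sum_cons, List.sum_nil, ha, mul_assoc,
    Complex.mul_conj', Int.cast_neg, Int.cast_one, neg_mul, one_mul, mul_one, add_zero, e1, e2]
  simp [add_add_neg_eq_zero, and_assoc]
  norm_cast

theorem holds_separationEqs (ha : a [] = 1) (d N u : ℕ) : Holds a (separationEqs d N u) ↔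
    ∀ n < N, vec a d [24, n] ⬝ᵥ vec a d [23, n] = 1 ∧
      ∀ j < u, vec a d [24, n] ⬝ᵥ vec a d [16, j] = 0 := by
  unfold separationEqs
  simp only [dotProduct, vec, List.cons_append, List.nil_append]
  simp [ha, add_neg_eq_zero, Finset.sum_range (n := d)]

theorem holds_combinationEqs (ha : a [] = 1) (d u n : ℕ) :
    Holds a ((List.range d).map fun l =>
      ((List.range u).map fun j => (1, [24, j], [16, j, l], false)) ++
        [(-1, [], [23, n, l], false)]) ↔
    ∑ j ∈ Finset.range u, a [24, j] • vec a d [16, j] = vec a d [23, n] := by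
  simp only [funext_iff, vec, List.cons_append, List.nil_append, Finset.sum_apply, Pi.smul_apply,
    smul_eq_mul]
  simp [ha, add_neg_eq_zero, forall_lt_iff_fin (d := d)]

end QSystem

/-! ### Decomposition into generalised eigenvectors -/

section Chains

variable {E : Type*} [AddCommGroup E] [Module ℂ E] {T : Module.End ℂ E}

theorem eq_zero_of_isCoprime_aeval {p q : ℂ[X]} (h : IsCoprime p q) {w : E}
    (hp : aeval T p w = 0) (hq : aeval T q w = 0) : w = 0 := by
  obtain ⟨a, b, hab⟩ := h
  have : aeval T (a * p + b * q) w = 0 := by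
    simp [map_add, map_mul, Module.End.mul_apply, hp, hq]
  rwa [hab, map_one, Module.End.one_apply] at this

theorem aeval_eq_zero_of_dvd {p q : ℂ[X]} (h : p ∣ q) {w : E} (hp : aeval T p w = 0) :
    aeval T q w = 0 := by
  obtain ⟨a, rfl⟩ := h
  rw [mul_comm, map_mul, Module.End.mul_apply, hp, map_zero]

theorem aeval_aeval_comm (p q : ℂ[X]) (w : E) : aeval T p (aeval T q w) = aeval T q (aeval T p w) := by
  rw [← Module.End.mul_apply, ← map_mul, mul_comm, map_mul, Module.End.mul_apply]

/-- Generalised eigenvectors belonging to different eigenvalues are independent. -/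
theorem eq_zero_of_sum_eq_zero {ι : Type*} [DecidableEq ι] {s : Finset ι} {lam : ι → ℂ}
    (hinj : ∀ i ∈ s, ∀ j ∈ s, lam i = lam j → i = j) {K : ℕ} {w : ι → E}
    (hw : ∀ i ∈ s, aeval T ((X - C (lam i)) ^ K) (w i) = 0) (hsum : ∑ i ∈ s, w i = 0) :
    ∀ i ∈ s, w i = 0 := by
  intro i hi
  refine eq_zero_of_isCoprime_aeval (T := T) (p := ∏ j ∈ s.erase i, (X - C (lam j)) ^ K)
    (q := (X - C (lam i)) ^ K) ?_ ?_ (hw i hi)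
  · refine IsCoprime.prod_left fun j hj => IsCoprime.pow ?_
    refine isCoprime_X_sub_C_of_isUnit_sub (isUnit_iff_ne_zero.2 ?_)
    rw [Finset.mem_erase] at hj
    exact sub_ne_zero.2 fun h => hj.1 (hinj j hj.2 i hi h)
  · have h1 : ∀ j ∈ s, j ≠ i → aeval T (∏ j ∈ s.erase i, (X - C (lam j)) ^ K) (w j) = 0 :=
      fun j hj hji => aeval_eq_zero_of_dvd
        (Finset.dvd_prod_of_mem _ (Finset.mem_erase.2 ⟨hji, hj⟩)) (hw j hj)
    have h2 := congrArg (aeval T (∏ j ∈ s.erase i, (X - C (lam j)) ^ K)) hsum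
    rw [map_sum, map_zero, Finset.sum_eq_single_of_mem i hi h1] at h2
    exact h2

/-- A chain of generalised eigenvectors. -/
structure IsJordanChain (T : Module.End ℂ E) (lam : ℂ) (K : ℕ) (v : ℕ → E) : Prop where
  step : ∀ k < K, T (v k) = lam • v k + v (k + 1)
  last : v K = 0

namespace IsJordanChain

variable {lam : ℂ} {K : ℕ} {v : ℕ → E}

theorem aeval_pow (h : IsJordanChain T lam K v) {j : ℕ} (hj : j ≤ K) :
    aeval T ((X - C lam) ^ j) (v 0) = v j := by
  induction j with
  | zero => simp
  | succ j ih =>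
    rw [pow_succ', map_mul, Module.End.mul_apply, ih (by omega)]
    simp [h.step j (by omega)]

theorem aeval_pow_last (h : IsJordanChain T lam K v) {j : ℕ} (hj : K ≤ j) :
    aeval T ((X - C lam) ^ j) (v 0) = 0 :=
  aeval_eq_zero_of_dvd (pow_dvd_pow _ hj) (by rw [h.aeval_pow le_rfl, h.last])

theorem eq_zero_of_le (h : IsJordanChain T lam K v) {j k : ℕ} (hj : v j = 0) (hjk : j ≤ k)
    (hk : k ≤ K) : v k = 0 := by
  rw [← h.aeval_pow hk]
  exact aeval_eq_zero_of_dvd (pow_dvd_pow _ hjk) (by rw [h.aeval_pow (hjk.trans hk), hj])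

/-- Write f = (X - λ)^e g with g(λ) ≠ 0. Then `v e` is annihilated by g and by (X - λ)^K, which are
coprime, so `v e = 0`; since `v k ≠ 0`, this forces e > k. -/
theorem dvd_of_aeval_eq_zero (h : IsJordanChain T lam K v) {f : ℂ[X]} (hf : aeval T f (v 0) = 0)
    {k : ℕ} (hk : k < K) (hv : v k ≠ 0) : (X - C lam) ^ (k + 1) ∣ f := by
  by_cases hf0 : f = 0
  · rw [hf0]; exact dvd_zero _
  obtain ⟨g, hg, hgr⟩ := exists_eq_pow_rootMultiplicity_mul_and_not_dvd f hf0 lam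
  set e := rootMultiplicity lam f
  by_contra hnd
  have hek : e ≤ k := by
    by_contra hlt
    exact hnd ((pow_dvd_pow _ (by omega)).trans ⟨g, hg⟩)
  refine hv (h.eq_zero_of_le ?_ hek hk.le)
  have hcop : IsCoprime g ((X - C lam) ^ K) := by
    refine IsCoprime.pow_right ?_
    exact ((irreducible_X_sub_C lam).coprime_iff_not_dvd.2 hgr).symm
  refine eq_zero_of_isCoprime_aeval (T := T) hcop ?_ ?_
  · rw [← h.aeval_pow (hek.trans hk.le), ← Module.End.mul_apply, ← map_mul, mul_comm, ← hg, hf]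
  · rw [← h.aeval_pow (hek.trans hk.le), aeval_aeval_comm, h.aeval_pow le_rfl, h.last, map_zero]

/-- The binomial theorem for T = (T - λ) + λ. Both sums are padded to a common length: terms with k
≥ K vanish because the chain has ended, terms with k > n because the binomial coefficient is zero,
whatever the truncated exponent n - k. -/
theorem pow_apply (h : IsJordanChain T lam K v) (n : ℕ) :
    (T ^ n) (v 0) = ∑ k ∈ Finset.range K, ((n.choose k : ℂ) * lam ^ (n - k)) • v k := by
  have h1 : (T ^ n) (v 0) = aeval T (((X - C lam) + C lam) ^ n) (v 0) := by simp
  have h2 : ∀ m, ∑ k ∈ Finset.range (K + m), ((n.choose k : ℂ) * lam ^ (n - k)) •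
      aeval T ((X - C lam) ^ k) (v 0) =
      ∑ k ∈ Finset.range K, ((n.choose k : ℂ) * lam ^ (n - k)) • v k := fun m => by
    rw [Finset.sum_range_add, Finset.sum_eq_zero (s := Finset.range m), add_zero]
    · exact Finset.sum_congr rfl fun k hk => by
        rw [h.aeval_pow (Finset.mem_range.1 hk).le]
    · intro k _
      rw [h.aeval_pow_last (by omega), smul_zero]
  have h3 : ∀ m, ∑ k ∈ Finset.range (n + 1 + m), ((n.choose k : ℂ) * lam ^ (n - k)) •
      aeval T ((X - C lam) ^ k) (v 0) = ∑ k ∈ Finset.range (n + 1),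
        ((n.choose k : ℂ) * lam ^ (n - k)) • aeval T ((X - C lam) ^ k) (v 0) := fun m => by
    rw [Finset.sum_range_add, Finset.sum_eq_zero (s := Finset.range m), add_zero]
    intro k _
    rw [Nat.choose_eq_zero_of_lt (by omega), Nat.cast_zero, zero_mul, zero_smul]
  rw [← h2 (n + 1), add_comm K, h3, h1, (Commute.all _ _).add_pow, map_sum,
    LinearMap.sum_apply]
  refine Finset.sum_congr rfl fun k _ => ?_
  have : (X - C lam) ^ k * (C lam) ^ (n - k) * (n.choose k : ℂ[X]) =
      C ((n.choose k : ℂ) * lam ^ (n - k)) * (X - C lam) ^ k := by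
    rw [C_mul, C_pow, map_natCast]; ring
  rw [this, map_mul, aeval_C, Module.End.mul_apply, Module.algebraMap_end_apply]

end IsJordanChain

/-- A simultaneous decomposition of the vectors `y c` into generalised eigenvectors. -/
structure IsDecomposition {ι : Type*} (T : Module.End ℂ E) (y : ι → E) (r K : ℕ) (lam : ℕ → ℂ)
    (V : ι → ℕ → ℕ → E) : Prop where
  sum : ∀ c, ∑ i ∈ Finset.range r, V c i 0 = y c
  chain : ∀ c, ∀ i < r, IsJordanChain T (lam i) K (V c i)
  inj : ∀ i < r, ∀ j < r, lam i = lam j → i = j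

namespace IsDecomposition

variable {ι : Type*} {y : ι → E} {r K : ℕ} {lam : ℕ → ℂ} {V : ι → ℕ → ℕ → E}

theorem aeval_eq_zero_iff (h : IsDecomposition T y r K lam V) (c : ι) (f : ℂ[X]) :
    aeval T f (y c) = 0 ↔ ∀ i < r, aeval T f (V c i 0) = 0 := by
  constructor
  · intro hf i hi
    refine eq_zero_of_sum_eq_zero (T := T) (s := Finset.range r) (lam := lam) (K := K)
      (w := fun i => aeval T f (V c i 0)) (fun i hi j hj => h.inj i (Finset.mem_range.1 hi) j
        (Finset.mem_range.1 hj)) (fun i hi => ?_) ?_ i (Finset.mem_range.2 hi)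
    · rw [aeval_aeval_comm, (h.chain c i (Finset.mem_range.1 hi)).aeval_pow_last le_rfl, map_zero]
    · rw [← map_sum, h.sum, hf]
  · intro hf
    rw [← h.sum, map_sum]
    exact Finset.sum_eq_zero fun i hi => hf i (Finset.mem_range.1 hi)

/-- If `F` generates the annihilator of the vectors `y c`, its roots are among the `lam i`. -/
theorem exists_eq_of_isRoot (h : IsDecomposition T y r K lam V) {F : ℂ[X]}
    (hdvd : ∀ g : ℂ[X], (∀ c, aeval T g (y c) = 0) → F ∣ g) {z : ℂ} (hz : F.IsRoot z) :
    ∃ i < r, lam i = z := by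
  have hF : F ∣ ∏ i ∈ Finset.range r, (X - C (lam i)) ^ K :=
    hdvd _ fun c => (h.aeval_eq_zero_iff c _).2 fun i hi => aeval_eq_zero_of_dvd
      (Finset.dvd_prod_of_mem _ (Finset.mem_range.2 hi)) ((h.chain c i hi).aeval_pow_last le_rfl)
  have h0 := hz.dvd hF
  rw [IsRoot.def, eval_prod, Finset.prod_eq_zero_iff] at h0
  obtain ⟨i, hi, h0⟩ := h0
  rw [eval_pow, eval_sub, eval_X, eval_C] at h0
  refine ⟨i, Finset.mem_range.1 hi, ?_⟩
  by_contra hne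
  exact pow_ne_zero _ (sub_ne_zero.2 (Ne.symm hne)) h0

/-- The multiplicity of an eigenvalue in the generator of the annihilator is the height of the
vectors in the corresponding generalised eigenspace. -/
theorem lt_rootMultiplicity_iff (h : IsDecomposition T y r K lam V) {F : ℂ[X]} (hF0 : F ≠ 0)
    (hF : ∀ c, aeval T F (y c) = 0)
    (hdvd : ∀ g : ℂ[X], (∀ c, aeval T g (y c) = 0) → F ∣ g) {i k : ℕ} (hi : i < r) (hk : k < K) :
    k < F.rootMultiplicity (lam i) ↔ ∃ c, V c i k ≠ 0 := by
  constructor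
  · intro hlt
    by_contra! hall
    -- If all chains at λ_i died at level k, this product would annihilate all `y c`, but λ_i is a
    -- root of it of multiplicity only k.
    have hprod : F ∣ (X - C (lam i)) ^ k * ∏ j ∈ (Finset.range r).erase i, (X - C (lam j)) ^ K := by
      refine hdvd _ fun c => (h.aeval_eq_zero_iff c _).2 fun j hj => ?_
      by_cases hji : j = i
      · subst hji
        exact aeval_eq_zero_of_dvd (dvd_mul_right _ _)
          (by rw [(h.chain c j hj).aeval_pow hk.le, hall])
      · exact aeval_eq_zero_of_dvd ((Finset.dvd_prod_of_mem _
          (Finset.mem_erase.2 ⟨hji, Finset.mem_range.2 hj⟩)).trans (dvd_mul_left _ _))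
          ((h.chain c j hj).aeval_pow_last le_rfl)
    have h1 : (X - C (lam i)) ^ (k + 1) ∣ (X - C (lam i)) ^ k *
        ∏ j ∈ (Finset.range r).erase i, (X - C (lam j)) ^ K :=
      ((le_rootMultiplicity_iff hF0).1 hlt).trans hprod
    rw [pow_succ] at h1
    have h2 := (mul_dvd_mul_iff_left (pow_ne_zero k (X_sub_C_ne_zero (lam i)))).1 h1
    rw [dvd_iff_isRoot, IsRoot.def, eval_prod, Finset.prod_eq_zero_iff] at h2
    obtain ⟨j, hj, h2⟩ := h2
    rw [Finset.mem_erase, Finset.mem_range] at hj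
    rw [eval_pow, eval_sub, eval_X, eval_C] at h2
    by_cases hz : lam i - lam j = 0
    · exact hj.1 (h.inj j hj.2 i hi (sub_eq_zero.1 hz).symm)
    · exact pow_ne_zero _ hz h2
  · rintro ⟨c, hc⟩
    refine (le_rootMultiplicity_iff hF0).2 ?_
    exact (h.chain c i hi).dvd_of_aeval_eq_zero ((h.aeval_eq_zero_iff c F).1 (hF c) i hi) hk hc

end IsDecomposition

end Chains

/-! ### Annihilators over the rationals and over the complex numbers -/

/-- If the rational polynomial `m` divides all rational relations of a family of rational sequences,
it divides all complex relations. -/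
theorem map_dvd_of_forall_dvd {ι : Type*} {w : ι → ℕ → ℚ} {m : ℚ[X]}
    (hm : ∀ f : ℚ[X], (∀ c, (f.sum fun n b => b * w c n) = 0) → m ∣ f) {g : ℂ[X]}
    (hg : ∀ c, (g.sum fun n b => b * (w c n : ℂ)) = 0) : m.map (algebraMap ℚ ℂ) ∣ g := by
  -- Coordinates with respect to a ℚ-basis of ℂ split the complex relation g into rational
  -- relations, each divisible by m.
  let B := Module.Basis.ofVectorSpace ℚ ℂ
  let N := g.natDegree + 1
  let part : Module.Basis.ofVectorSpaceIndex ℚ ℂ → ℚ[X] := fun b =>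
    ∑ n ∈ Finset.range N, monomial n (B.repr (g.coeff n) b)
  have hcoeff : ∀ b n, (part b).coeff n = B.repr (g.coeff n) b := fun b n => by
    simp only [part, finsetSum_coeff, coeff_monomial, Finset.sum_ite_eq', Finset.mem_range]
    split_ifs with h
    · rfl
    · rw [coeff_eq_zero_of_natDegree_lt (by omega)]; simp
  have hdeg : ∀ b, (part b).natDegree < N := fun b => by
    refine Nat.lt_succ_of_le (natDegree_le_iff_coeff_eq_zero.2 fun n hn => ?_)
    rw [hcoeff, coeff_eq_zero_of_natDegree_lt (by omega)]; simp
  have hpart : ∀ b, m ∣ part b := fun b => hm _ fun c => by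
    have h1 := congrArg (fun z => B.repr z b) (hg c)
    rw [sum_over_range' _ (by simp) N (by omega)] at h1
    rw [sum_over_range' _ (by simp) N (hdeg b)]
    simp only [map_sum, map_zero, Finsupp.coe_zero, Pi.zero_apply, Finsupp.finsetSum_apply] at h1
    rw [← h1]
    refine Finset.sum_congr rfl fun n _ => ?_
    have : g.coeff n * (w c n : ℂ) = w c n • g.coeff n := by
      rw [Rat.smul_def, mul_comm]
    rw [this, map_smul, hcoeff, Finsupp.smul_apply, smul_eq_mul, mul_comm]
  have hsum : g = ∑ b ∈ (Finset.range N).biUnion fun n => (B.repr (g.coeff n)).support,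
      C (B b) * (part b).map (algebraMap ℚ ℂ) := by
    ext n
    simp only [finsetSum_coeff, coeff_C_mul, coeff_map, hcoeff]
    by_cases hn : n < N
    · conv_lhs => rw [← B.linearCombination_repr (g.coeff n)]
      rw [Finsupp.linearCombination_apply, Finsupp.sum]
      refine (Finset.sum_subset (Finset.subset_biUnion_of_mem
        (fun n => (B.repr (g.coeff n)).support) (Finset.mem_range.2 hn)) fun b _ hb => ?_).trans ?_
      · rw [Finsupp.notMem_support_iff.1 hb, zero_smul]
      · exact Finset.sum_congr rfl fun b _ => by rw [Algebra.smul_def, mul_comm]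
    · rw [coeff_eq_zero_of_natDegree_lt (by omega)]; simp
  rw [hsum]
  exact Finset.dvd_sum fun b _ => (Polynomial.map_dvd _ (hpart b)).mul_left _

/-! ### Leading roots of minimal polynomials -/

theorem isRoot_map_iff {f : ℚ[X]} {z : ℂ} : (f.map (algebraMap ℚ ℂ)).IsRoot z ↔ aeval z f = 0 := by
  rw [IsRoot.def, eval_map_algebraMap]

/-- Allows leading roots to be read off from a list that contains all roots and possibly other
numbers; the index in `hex` shows that the bounds ρ and s + 1 are attained. -/
theorem leadingRoots_eq {f : ℚ[X]} (hf : f ≠ 0) {r : ℕ} {lam : ℕ → ℂ}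
    (hroot : ∀ z, (f.map (algebraMap ℚ ℂ)).IsRoot z → ∃ i < r, lam i = z) {ρ : ℝ}
    (hρ : ∀ i < r, (f.map (algebraMap ℚ ℂ)).IsRoot (lam i) → ‖lam i‖ ≤ ρ) {s : ℕ}
    (hs : ∀ i < r, ‖lam i‖ = ρ → multIn f (lam i) ≤ s + 1)
    (hex : ∃ i < r, ‖lam i‖ = ρ ∧ s < multIn f (lam i)) :
    leadingRoots f = {z | ∃ i < r, lam i = z ∧ ‖lam i‖ = ρ ∧ s < multIn f (lam i)} := by
  have hf' : f.map (algebraMap ℚ ℂ) ≠ 0 := (Polynomial.map_ne_zero_iff (algebraMap ℚ ℂ).injective).2 hf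
  have hmult : ∀ z, 0 < multIn f z ↔ (f.map (algebraMap ℚ ℂ)).IsRoot z := fun z =>
    rootMultiplicity_pos hf'
  obtain ⟨i₀, hi₀, hi₀ρ, hi₀s⟩ := hex
  have hroot₀ : aeval (lam i₀) f = 0 := isRoot_map_iff.1 ((hmult _).1 (by omega))
  have hdom : ∀ z, z ∈ dominatingRoots f ↔ aeval z f = 0 ∧ ‖z‖ = ρ := fun z => by
    constructor
    · rintro ⟨h1, h2⟩
      obtain ⟨i, hi, rfl⟩ := hroot z (isRoot_map_iff.2 h1)
      exact ⟨h1, le_antisymm (hρ i hi (isRoot_map_iff.2 h1)) (hi₀ρ ▸ h2 _ hroot₀)⟩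
    · rintro ⟨h1, h2⟩
      refine ⟨h1, fun w hw => ?_⟩
      obtain ⟨i, hi, rfl⟩ := hroot w (isRoot_map_iff.2 hw)
      exact h2 ▸ hρ i hi (isRoot_map_iff.2 hw)
  ext z
  constructor
  · rintro ⟨h1, h2⟩
    obtain ⟨h3, h4⟩ := (hdom z).1 h1
    obtain ⟨i, hi, rfl⟩ := hroot z (isRoot_map_iff.2 h3)
    exact ⟨i, hi, rfl, h4, hi₀s.trans_le (h2 _ ((hdom _).2 ⟨hroot₀, hi₀ρ⟩))⟩
  · rintro ⟨i, hi, rfl, h1, h2⟩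
    refine ⟨(hdom _).2 ⟨isRoot_map_iff.1 ((hmult _).1 (by omega)), h1⟩, fun w hw => ?_⟩
    obtain ⟨h3, h4⟩ := (hdom w).1 hw
    obtain ⟨j, hj, rfl⟩ := hroot w (isRoot_map_iff.2 h3)
    exact (hs j hj h4).trans h2

section

variable {d : ℕ} (A : Matrix (Fin d) (Fin d) ℚ)

/-- The complex linear map given by a rational matrix. -/
noncomputable def complexEnd : Module.End ℂ (Fin d → ℂ) :=
  Matrix.toLin' (A.map (algebraMap ℚ ℂ))

/-- A rational vector as a complex vector. -/
noncomputable def complexVec (x : Fin d → ℚ) : Fin d → ℂ := fun i => (x i : ℂ)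

theorem complexEnd_complexVec (x : Fin d → ℚ) :
    complexEnd A (complexVec x) = complexVec (A.mulVec x) := by
  ext i
  simp [complexEnd, complexVec, Matrix.toLin'_apply, Matrix.mulVec, dotProduct]

theorem complexEnd_pow_complexVec (x : Fin d → ℚ) (n : ℕ) :
    (complexEnd A ^ n) (complexVec x) = complexVec ((A ^ n).mulVec x) := by
  induction n with
  | zero => simp
  | succ n ih =>
    rw [pow_succ', Module.End.mul_apply, ih, complexEnd_complexVec, Matrix.mulVec_mulVec, ← pow_succ']

theorem aeval_complexEnd (x : Fin d → ℚ) (g : ℂ[X]) (j : Fin d) :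
    aeval (complexEnd A) g (complexVec x) j =
      g.sum fun n b => b * (((A ^ n).mulVec x j : ℚ) : ℂ) := by
  rw [aeval_eq_sum_range, Polynomial.sum_over_range _ (by simp), LinearMap.sum_apply,
    Finset.sum_apply]
  refine Finset.sum_congr rfl fun n _ => ?_
  rw [LinearMap.smul_apply, complexEnd_pow_complexVec]
  rfl

theorem aeval_mulVec (x : Fin d → ℚ) (f : ℚ[X]) (j : Fin d) :
    (aeval A f).mulVec x j = f.sum fun n b => b * (A ^ n).mulVec x j := by
  rw [aeval_eq_sum_range, Polynomial.sum_over_range _ (by simp), Matrix.sum_mulVec,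
    Finset.sum_apply]
  refine Finset.sum_congr rfl fun n _ => ?_
  rw [Matrix.smul_mulVec]
  rfl

theorem aeval_complexEnd_map (x : Fin d → ℚ) (f : ℚ[X]) :
    aeval (complexEnd A) (f.map (algebraMap ℚ ℂ)) (complexVec x) =
      complexVec ((aeval A f).mulVec x) := by
  ext j
  rw [aeval_complexEnd, complexVec, aeval_mulVec,
    Polynomial.sum_over_range' _ (by simp) (f.natDegree + 1) (by
      rw [natDegree_map]; omega), Polynomial.sum_over_range _ (by simp)]
  push_cast
  exact Finset.sum_congr rfl fun n _ => by rw [coeff_map]; rfl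

theorem dvd_of_vecAnnihilator (x : Fin d → ℚ) {f : ℚ[X]} (hf : (aeval A f).mulVec x = 0) :
    vecMinpoly A x ∣ f :=
  (Submodule.IsPrincipal.mem_iff_generator_dvd (vecAnnihilator A x)).1 hf

theorem aeval_vecMinpoly (x : Fin d → ℚ) : (aeval A (vecMinpoly A x)).mulVec x = 0 :=
  Submodule.IsPrincipal.generator_mem (vecAnnihilator A x)

theorem minpoly_matrix_ne_zero : minpoly ℚ A ≠ 0 := minpoly.ne_zero (Algebra.IsIntegral.isIntegral A)

theorem vecMinpoly_ne_zero (x : Fin d → ℚ) : vecMinpoly A x ≠ 0 := by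
  intro h
  have := dvd_of_vecAnnihilator A x (f := minpoly ℚ A) (by rw [minpoly.aeval, Matrix.zero_mulVec])
  rw [h, zero_dvd_iff] at this
  exact minpoly_matrix_ne_zero A this

/-- Each coordinate of the orbit is a rational sequence, and g annihilates x exactly if it is a
relation of all these sequences. -/
theorem map_vecMinpoly_dvd (x : Fin d → ℚ) {g : ℂ[X]}
    (hg : aeval (complexEnd A) g (complexVec x) = 0) :
    (vecMinpoly A x).map (algebraMap ℚ ℂ) ∣ g := by
  refine map_dvd_of_forall_dvd (w := fun (j : Fin d) n => (A ^ n).mulVec x j) (fun f hf => ?_)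
    fun j => ?_
  · refine dvd_of_vecAnnihilator A x (funext fun j => ?_)
    rw [aeval_mulVec, hf]; rfl
  · rw [← aeval_complexEnd, hg]; rfl

theorem map_minpoly_dvd {g : ℂ[X]}
    (hg : ∀ c : Fin d, aeval (complexEnd A) g (complexVec (Pi.single c 1)) = 0) :
    (minpoly ℚ A).map (algebraMap ℚ ℂ) ∣ g := by
  refine map_dvd_of_forall_dvd
    (w := fun (j : Fin d × Fin d) n => (A ^ n).mulVec (Pi.single j.1 1) j.2) (fun f hf => ?_)
    fun j => ?_
  · refine minpoly.dvd ℚ A (Matrix.ext_of_mulVec_single fun c => funext fun j => ?_)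
    rw [aeval_mulVec, hf (c, j), Matrix.zero_mulVec]; rfl
  · rw [← aeval_complexEnd, hg]; rfl

/-- The relation between heights and multiplicities for the minimal polynomial. -/
theorem lt_multIn_minpoly_iff {r K : ℕ} {lam : ℕ → ℂ} {V : Fin d → ℕ → ℕ → Fin d → ℂ}
    (h : IsDecomposition (complexEnd A) (fun c : Fin d => complexVec (Pi.single c 1)) r K lam V)
    {i k : ℕ} (hi : i < r) (hk : k < K) :
    k < multIn (minpoly ℚ A) (lam i) ↔ ∃ c, V c i k ≠ 0 :=
  h.lt_rootMultiplicity_iff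
    ((Polynomial.map_ne_zero_iff (algebraMap ℚ ℂ).injective).2 (minpoly_matrix_ne_zero A))
    (fun c => by rw [aeval_complexEnd_map, minpoly.aeval, Matrix.zero_mulVec]; ext; simp [complexVec])
    (fun _ hg => map_minpoly_dvd A hg) hi hk

/-- The relation between heights and multiplicities for the minimal polynomial of a vector. -/
theorem lt_multIn_vecMinpoly_iff (x : Fin d → ℚ) {r K : ℕ} {lam : ℕ → ℂ}
    {V : Unit → ℕ → ℕ → Fin d → ℂ}
    (h : IsDecomposition (complexEnd A) (fun _ : Unit => complexVec x) r K lam V)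
    {i k : ℕ} (hi : i < r) (hk : k < K) :
    k < multIn (vecMinpoly A x) (lam i) ↔ V () i k ≠ 0 := by
  have := h.lt_rootMultiplicity_iff
    ((Polynomial.map_ne_zero_iff (algebraMap ℚ ℂ).injective).2 (vecMinpoly_ne_zero A x))
    (fun c => by rw [aeval_complexEnd_map, aeval_vecMinpoly]; ext; simp [complexVec])
    (fun _ hg => map_vecMinpoly_dvd A x (hg ())) hi hk
  rw [multIn, this]
  exact ⟨fun ⟨_, h⟩ => h, fun h => ⟨(), h⟩⟩

end

/-! ### The speed of convergence -/

section Growth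

theorem choose_mono_of_le_half {n a b : ℕ} (hab : a ≤ b) (hb : 2 * b ≤ n) :
    n.choose a ≤ n.choose b := by
  induction b, hab using Nat.le_induction with
  | base => exact le_rfl
  | succ b _ ih =>
    exact (ih (by omega)).trans (Nat.choose_le_succ_of_lt_half_left (by omega))

/-- Below n / 2 binomial coefficients increase, so k may be replaced by t - 1, and passing from t -
1 to t gains the factor (n - t + 1) / t. -/
theorem choose_mul_le {n k t K : ℕ} (hkt : k < t) (htK : t < K) (hn : 2 * K ≤ n) :
    n.choose k * (n - 2 * K) ≤ K * n.choose t := by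
  obtain ⟨u, rfl⟩ : ∃ u, t = u + 1 := ⟨t - 1, by omega⟩
  calc n.choose k * (n - 2 * K) ≤ n.choose u * (n - u) :=
        Nat.mul_le_mul (choose_mono_of_le_half (by omega) (by omega)) (by omega)
    _ = n.choose (u + 1) * (u + 1) := (Nat.choose_succ_right_eq n u).symm
    _ ≤ K * n.choose (u + 1) := by
        rw [mul_comm]; exact Nat.mul_le_mul_right _ (by omega)

/-- One term of the expansion of (1 + ε)^n. Using the term k + 1 instead of k produces the factor n
- k, hence a decay of order 1 / n also for eigenvalues of smaller modulus. -/
theorem choose_mul_pow_le {n k K : ℕ} (hkK : k < K) {ε : ℝ} (hε : 0 < ε) :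
    (n.choose k : ℝ) * (n - k : ℕ) * ε ^ (k + 1) ≤ K * (1 + ε) ^ n := by
  have h1 : (n.choose (k + 1) : ℝ) * ε ^ (k + 1) ≤ (1 + ε) ^ n := by
    by_cases hn : k + 1 ≤ n
    · rw [add_comm 1 ε, add_pow]
      refine le_trans (le_of_eq ?_) (Finset.single_le_sum (f := fun m => ε ^ m * 1 ^ (n - m) *
        (n.choose m : ℝ)) (fun m _ => by positivity) (Finset.mem_range.2 (by omega : k + 1 < n + 1)))
      simp [mul_comm]
    · rw [Nat.choose_eq_zero_of_lt (by omega)]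
      simp only [Nat.cast_zero, zero_mul]
      positivity
  have h2 : (n.choose k : ℝ) * (n - k : ℕ) = n.choose (k + 1) * (k + 1 : ℕ) := by
    exact_mod_cast (Nat.choose_succ_right_eq n k).symm
  rw [h2]
  calc (n.choose (k + 1) : ℝ) * (k + 1 : ℕ) * ε ^ (k + 1)
      = (k + 1 : ℕ) * ((n.choose (k + 1) : ℝ) * ε ^ (k + 1)) := by ring
    _ ≤ K * (1 + ε) ^ n := by
        have : ((k + 1 : ℕ) : ℝ) ≤ K := by exact_mod_cast hkK
        gcongr

variable {ρ : ℝ} {h K : ℕ}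

/-- The hypotheses give ρ ≤ h and 1 / ρ ≤ h, so changing the exponent by less than K costs at most
h^K. -/
theorem pow_sub_le (hρ0 : 0 < ρ) (h1 : 1 ≤ h * ρ ^ 2) (h2 : ρ ^ 2 ≤ h) {n k t : ℕ}
    (hk : k < K) (ht : t < K) (hn : K ≤ n) : ρ ^ (n - k) ≤ (h : ℝ) ^ K * ρ ^ (n - t) := by
  have hh : (1 : ℝ) ≤ h := by nlinarith [sq_nonneg ((h : ℝ) - 1), sq_nonneg (h * ρ ^ 2)]
  have hρh : ρ ≤ h := by nlinarith
  have hρh' : 1 ≤ ρ * h := by nlinarith [mul_pos hρ0 (by linarith : (0 : ℝ) < h)]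
  rcases le_total k t with hkt | hkt
  · rw [show n - k = (t - k) + (n - t) by omega, pow_add]
    refine mul_le_mul_of_nonneg_right ?_ (by positivity)
    calc ρ ^ (t - k) ≤ (h : ℝ) ^ (t - k) := by gcongr
      _ ≤ (h : ℝ) ^ K := pow_le_pow_right₀ hh (by omega)
  · rw [show n - t = (k - t) + (n - k) by omega, pow_add, ← mul_assoc]
    refine le_mul_of_one_le_left (by positivity) ?_
    calc (1 : ℝ) ≤ (ρ * h) ^ (k - t) := one_le_pow₀ hρh'
      _ = (h : ℝ) ^ (k - t) * ρ ^ (k - t) := by rw [mul_pow, mul_comm]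
      _ ≤ (h : ℝ) ^ K * ρ ^ (k - t) := by
        refine mul_le_mul_of_nonneg_right (pow_le_pow_right₀ hh (by omega)) (by positivity)

/-- A non-leading term is small compared with a leading term. -/
theorem term_mul_le (hρ0 : 0 < ρ) (h1 : 1 ≤ h * ρ ^ 2) (h2 : ρ ^ 2 ≤ h) {n k t : ℕ}
    (hk : k < K) (ht : t < K) (hn : 2 * K ≤ n) {l : ℝ} (hl : 0 ≤ l)
    (hlt : (l = ρ ∧ k < t) ∨ 1 ≤ h * (ρ ^ 2 - l ^ 2)) :
    (n.choose k : ℝ) * l ^ (n - k) * (n - 2 * K : ℕ) ≤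
      QSystem.ratioBound K h * (n.choose t * ρ ^ (n - t)) := by
  have hh : (1 : ℝ) ≤ h := by nlinarith [sq_nonneg ((h : ℝ) - 1), sq_nonneg (h * ρ ^ 2)]
  have hpow := pow_sub_le (n := n) hρ0 h1 h2 hk ht (by omega)
  -- At equal modulus a smaller binomial coefficient is responsible for the gain; otherwise the gap
  -- between the moduli is.
  rcases hlt with ⟨rfl, hkt⟩ | hgap
  · have hc : (n.choose k : ℝ) * (n - 2 * K : ℕ) ≤ K * n.choose t := by
      exact_mod_cast choose_mul_le hkt ht hn
    calc (n.choose k : ℝ) * l ^ (n - k) * (n - 2 * K : ℕ)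
        = (n.choose k * (n - 2 * K : ℕ)) * l ^ (n - k) := by ring
      _ ≤ (K * n.choose t) * (h ^ K * l ^ (n - t)) := by gcongr
      _ = (K * 1 * 1 * h ^ K) * (n.choose t * l ^ (n - t)) := by ring
      _ ≤ QSystem.ratioBound K h * (n.choose t * l ^ (n - t)) := by
        refine mul_le_mul_of_nonneg_right ?_ (by positivity)
        rw [QSystem.ratioBound]
        push_cast
        have e1 : (1 : ℝ) ≤ 2 ^ K := one_le_pow₀ (by norm_num)
        have e2 : (1 : ℝ) ≤ (4 * (h : ℝ) ^ 2) ^ K := one_le_pow₀ (by nlinarith)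
        gcongr
  -- Small enough for l (1 + ε) ≤ ρ: one has (1 + ε)² ≤ 1 + 3ε, and h · l² · 3ε ≤ 3/4 stays below
  -- the gap h (ρ² - l²) ≥ 1.
  · set ε : ℝ := 1 / (4 * h ^ 2) with hε
    have hh0 : (0 : ℝ) < h := by linarith
    have hεpos : 0 < ε := by positivity
    have hε1 : ε ≤ 1 := by
      rw [hε, div_le_one (by positivity)]; nlinarith
    have hεh : 4 * (h : ℝ) ^ 2 * ε = 1 := by rw [hε]; field_simp
    have hl1 : l * (1 + ε) ≤ ρ := by
      refine le_of_sq_le_sq ?_ hρ0.le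
      have e1 : (1 + ε) ^ 2 ≤ 1 + 3 * ε := by nlinarith
      have e2 : l ^ 2 * (1 + 3 * ε) ≤ ρ ^ 2 := by
        have e3 : l ^ 2 ≤ h := by nlinarith
        have e4 : h * (l ^ 2 * (3 * ε)) ≤ 1 := by
          calc h * (l ^ 2 * (3 * ε)) ≤ h * (h * (3 * ε)) := by gcongr
            _ = 3 / 4 * (4 * (h : ℝ) ^ 2 * ε) := by ring
            _ ≤ 1 := by rw [hεh]; norm_num
        have e5 : h * (l ^ 2 * (1 + 3 * ε)) ≤ h * ρ ^ 2 := by nlinarith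
        exact le_of_mul_le_mul_left e5 hh0
      calc (l * (1 + ε)) ^ 2 = l ^ 2 * (1 + ε) ^ 2 := by ring
        _ ≤ l ^ 2 * (1 + 3 * ε) := by gcongr
        _ ≤ ρ ^ 2 := e2
    have hc := choose_mul_pow_le (n := n) hk hεpos
    have hsub : ((n - 2 * K : ℕ) : ℝ) ≤ (n - k : ℕ) := by exact_mod_cast (by omega)
    have hchoose : (1 : ℝ) ≤ n.choose t := by exact_mod_cast Nat.choose_pos (by omega)
    have hε2 : (1 : ℝ) ≤ (4 * h ^ 2) ^ K * ε ^ (k + 1) := by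
      have : (4 * (h : ℝ) ^ 2) ^ (k + 1) * ε ^ (k + 1) = 1 := by rw [← mul_pow, hεh, one_pow]
      rw [← this]
      refine mul_le_mul_of_nonneg_right (pow_le_pow_right₀ (by nlinarith) (by omega)) (by positivity)
    have hmain : (n.choose k : ℝ) * l ^ (n - k) * (n - 2 * K : ℕ) ≤
        K * 2 ^ K * (4 * h ^ 2) ^ K * ρ ^ (n - k) := by
      calc (n.choose k : ℝ) * l ^ (n - k) * (n - 2 * K : ℕ)
          ≤ (n.choose k : ℝ) * l ^ (n - k) * (n - k : ℕ) * ((4 * h ^ 2) ^ K * ε ^ (k + 1)) := by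
            refine le_trans ?_ (le_mul_of_one_le_right (by positivity) hε2)
            gcongr
        _ = ((n.choose k : ℝ) * (n - k : ℕ) * ε ^ (k + 1)) * l ^ (n - k) * (4 * h ^ 2) ^ K := by ring
        _ ≤ (K * (1 + ε) ^ n) * l ^ (n - k) * (4 * h ^ 2) ^ K := by gcongr
        _ = K * (1 + ε) ^ k * (l * (1 + ε)) ^ (n - k) * (4 * h ^ 2) ^ K := by
            have e0 : (1 + ε) ^ n = (1 + ε) ^ k * (1 + ε) ^ (n - k) := by
              rw [← pow_add]; congr 1; omega
            rw [e0, mul_pow l (1 + ε)]; ring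
        _ ≤ K * 2 ^ K * ρ ^ (n - k) * (4 * h ^ 2) ^ K := by
            have e1 : (1 + ε) ^ k ≤ 2 ^ K :=
              (pow_le_pow_left₀ (by positivity) (by linarith) k).trans
                (pow_le_pow_right₀ (by norm_num) hk.le)
            gcongr
        _ = K * 2 ^ K * (4 * h ^ 2) ^ K * ρ ^ (n - k) := by ring
    calc _ ≤ _ := hmain
      _ ≤ K * 2 ^ K * (4 * h ^ 2) ^ K * (h ^ K * (n.choose t * ρ ^ (n - t))) := by
          refine mul_le_mul_of_nonneg_left (hpow.trans ?_) (by positivity)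
          refine mul_le_mul_of_nonneg_left ?_ (by positivity)
          exact le_mul_of_one_le_left (by positivity) hchoose
      _ = _ := by rw [QSystem.ratioBound]; push_cast; ring

/-- The difference of an exponential polynomial and its leading part. -/
theorem norm_sub_leading_mul_le {F : Type*} [NormedAddCommGroup F] [NormedSpace ℂ F] {r : ℕ}
    (hρ0 : 0 < ρ) (h1 : 1 ≤ h * ρ ^ 2) (h2 : ρ ^ 2 ≤ h) {lam δ : ℕ → ℂ} {t : ℕ} (ht : t < K)
    {w : ℕ → ℕ → F} {H : ℝ} (hw : ∀ i < r, ∀ k < K, ‖w i k‖ ≤ H)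
    (hδ : ∀ i < r, (δ i = 1 ∧ ‖lam i‖ = ρ ∧ ∀ k < K, t < k → w i k = 0) ∨
      (δ i = 0 ∧ 1 ≤ h * (ρ ^ 2 - ‖lam i‖ ^ 2))) {n : ℕ} (hn : 2 * K ≤ n) :
    ‖∑ i ∈ Finset.range r, ∑ k ∈ Finset.range K, ((n.choose k : ℂ) * lam i ^ (n - k)) • w i k -
      ∑ i ∈ Finset.range r, ((n.choose t : ℂ) * lam i ^ (n - t)) • δ i • w i t‖ *
        (n - 2 * K : ℕ) ≤
      r * K * H * QSystem.ratioBound K h * (n.choose t * ρ ^ (n - t)) := by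
  have hM : 0 ≤ QSystem.ratioBound K h * ((n.choose t : ℝ) * ρ ^ (n - t)) := by positivity
  -- At a dominating eigenvalue the term k = t cancels, terms with k > t vanish and those with k < t
  -- are small; at any other eigenvalue every term is small.
  have hterm : ∀ i < r, ∀ k < K,
      ‖((n.choose k : ℂ) * lam i ^ (n - k)) • (w i k - if k = t then δ i • w i t else 0)‖ *
        (n - 2 * K : ℕ) ≤ H * (QSystem.ratioBound K h * (n.choose t * ρ ^ (n - t))) := by
    intro i hi k hk
    have hH : 0 ≤ H := (norm_nonneg _).trans (hw i hi k hk)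
    have hsmall : ((‖lam i‖ = ρ ∧ k < t) ∨ 1 ≤ h * (ρ ^ 2 - ‖lam i‖ ^ 2)) →
        ‖((n.choose k : ℂ) * lam i ^ (n - k)) • w i k‖ * (n - 2 * K : ℕ) ≤
          H * (QSystem.ratioBound K h * (n.choose t * ρ ^ (n - t))) := fun hc => by
      have := term_mul_le hρ0 h1 h2 hk ht hn (norm_nonneg (lam i)) hc
      rw [norm_smul, norm_mul, norm_pow, Complex.norm_natCast]
      calc (n.choose k : ℝ) * ‖lam i‖ ^ (n - k) * ‖w i k‖ * (n - 2 * K : ℕ)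
          = ‖w i k‖ * ((n.choose k : ℝ) * ‖lam i‖ ^ (n - k) * (n - 2 * K : ℕ)) := by ring
        _ ≤ _ := mul_le_mul (hw i hi k hk) this (by positivity) hH
    rcases hδ i hi with ⟨hd, hl, hz⟩ | ⟨hd, hl⟩
    · rcases lt_trichotomy k t with hkt | rfl | hkt
      · rw [if_neg hkt.ne, sub_zero]; exact hsmall (Or.inl ⟨hl, hkt⟩)
      · rw [if_pos rfl, hd, one_smul, sub_self, smul_zero, norm_zero, zero_mul]
        exact mul_nonneg hH hM
      · rw [if_neg hkt.ne', sub_zero, hz k hk hkt, smul_zero, norm_zero, zero_mul]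
        exact mul_nonneg hH hM
    · rw [hd, zero_smul, ite_self, sub_zero]; exact hsmall (Or.inr hl)
  have hsplit : ∑ i ∈ Finset.range r, ∑ k ∈ Finset.range K,
      ((n.choose k : ℂ) * lam i ^ (n - k)) • w i k -
      ∑ i ∈ Finset.range r, ((n.choose t : ℂ) * lam i ^ (n - t)) • δ i • w i t =
      ∑ i ∈ Finset.range r, ∑ k ∈ Finset.range K,
        ((n.choose k : ℂ) * lam i ^ (n - k)) • (w i k - if k = t then δ i • w i t else 0) := by
    rw [← Finset.sum_sub_distrib]
    refine Finset.sum_congr rfl fun i _ => ?_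
    simp only [smul_sub, Finset.sum_sub_distrib, smul_ite, smul_zero, Finset.sum_ite_eq',
      Finset.mem_range, ht, if_true]
  rw [hsplit]
  calc _ ≤ (∑ i ∈ Finset.range r, ∑ k ∈ Finset.range K, ‖((n.choose k : ℂ) * lam i ^ (n - k)) •
        (w i k - if k = t then δ i • w i t else 0)‖) * (n - 2 * K : ℕ) := by
        refine mul_le_mul_of_nonneg_right ?_ (by positivity)
        exact (norm_sum_le _ _).trans (Finset.sum_le_sum fun i _ => norm_sum_le _ _)
    _ = ∑ i ∈ Finset.range r, ∑ k ∈ Finset.range K, ‖((n.choose k : ℂ) * lam i ^ (n - k)) •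
        (w i k - if k = t then δ i • w i t else 0)‖ * (n - 2 * K : ℕ) := by
        simp only [Finset.sum_mul]
    _ ≤ ∑ i ∈ Finset.range r, ∑ k ∈ Finset.range K,
        H * (QSystem.ratioBound K h * (n.choose t * ρ ^ (n - t))) :=
        Finset.sum_le_sum fun i hi => Finset.sum_le_sum fun k hk =>
          hterm i (Finset.mem_range.1 hi) k (Finset.mem_range.1 hk)
    _ = _ := by simp only [Finset.sum_const, Finset.card_range, nsmul_eq_mul]; ring

end Growth

/-! ### Spectral data of an orbit -/

/-- A decomposition of the unit vectors and of `x` into generalised eigenvectors, with the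
information which eigenvalues dominate and which height `x` reaches there. -/
structure IsSpectralData {d : ℕ} (A : Matrix (Fin d) (Fin d) ℚ) (x : Fin d → ℚ) (r K t i₀ : ℕ)
    (lam δ : ℕ → ℂ) (V : ℕ → ℕ → ℕ → Fin d → ℂ) : Prop where
  sum_unit : ∀ c : Fin d, ∑ i ∈ Finset.range r, V c i 0 = complexVec (Pi.single c 1)
  sum_vec : ∑ i ∈ Finset.range r, V d i 0 = complexVec x
  chain : ∀ c ≤ d, ∀ i < r, IsJordanChain (complexEnd A) (lam i) K (V c i)
  index_lt : i₀ < r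
  height_lt : t < K
  dominating : ∀ i < r,
    (δ i = 1 ∧ ‖lam i‖ = ‖lam i₀‖) ∨ (δ i = 0 ∧ ‖lam i‖ < ‖lam i₀‖)
  height : ∀ i < r, δ i = 1 → V d i (t + 1) = 0
  ne_zero : V d i₀ t ≠ 0

namespace IsSpectralData

variable {d : ℕ} {A : Matrix (Fin d) (Fin d) ℚ} {x : Fin d → ℚ} {r K t i₀ : ℕ}
  {lam δ : ℕ → ℂ} {V : ℕ → ℕ → ℕ → Fin d → ℂ}

theorem norm_le (h : IsSpectralData A x r K t i₀ lam δ V) {i : ℕ} (hi : i < r) :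
    ‖lam i‖ ≤ ‖lam i₀‖ := by
  rcases h.dominating i hi with h | h
  exacts [h.2.le, h.2.le]

theorem eq_one_iff (h : IsSpectralData A x r K t i₀ lam δ V) {i : ℕ} (hi : i < r) :
    δ i = 1 ↔ ‖lam i‖ = ‖lam i₀‖ := by
  rcases h.dominating i hi with h | h
  · exact ⟨fun _ => h.2, fun _ => h.1⟩
  · simp [h.1, h.2.ne]

theorem eq_zero_or_one (h : IsSpectralData A x r K t i₀ lam δ V) {i : ℕ} (hi : i < r) :
    δ i = 0 ∨ δ i = 1 := by
  rcases h.dominating i hi with h | h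
  exacts [Or.inr h.1, Or.inl h.1]

theorem eq_one (h : IsSpectralData A x r K t i₀ lam δ V) : δ i₀ = 1 :=
  (h.eq_one_iff h.index_lt).2 rfl

theorem eq_zero_of_lt (h : IsSpectralData A x r K t i₀ lam δ V) {i k : ℕ} (hi : i < r)
    (hδ : δ i = 1) (hk : k < K) (htk : t < k) : V d i k = 0 :=
  (h.chain d le_rfl i hi).eq_zero_of_le (h.height i hi hδ) htk hk.le

theorem pow_apply (h : IsSpectralData A x r K t i₀ lam δ V) (n : ℕ) :
    complexVec ((A ^ n).mulVec x) = ∑ i ∈ Finset.range r, ∑ k ∈ Finset.range K,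
      ((n.choose k : ℂ) * lam i ^ (n - k)) • V d i k := by
  rw [← complexEnd_pow_complexVec, ← h.sum_vec, map_sum]
  exact Finset.sum_congr rfl fun i hi =>
    (h.chain d le_rfl i (Finset.mem_range.1 hi)).pow_apply n

theorem isDecomposition_unit (h : IsSpectralData A x r K t i₀ lam δ V)
    (hinj : ∀ i < r, ∀ j < r, lam i = lam j → i = j) :
    IsDecomposition (complexEnd A) (fun c : Fin d => complexVec (Pi.single c 1)) r K lam
      (fun c => V c) :=
  ⟨h.sum_unit, fun c => h.chain c c.2.le, hinj⟩

/-- Independence of the components at different eigenvalues. -/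
theorem eq_zero_of_sum_eq_zero (h : IsSpectralData A x r K t i₀ lam δ V)
    (hinj : ∀ i < r, ∀ j < r, lam i = lam j → i = j) {m : ℕ → ℂ}
    (hm : ∑ i ∈ Finset.range r, m i • V d i t = 0) : ∀ i < r, m i • V d i t = 0 := fun i hi =>
  _root_.eq_zero_of_sum_eq_zero (T := complexEnd A) (K := K)
    (fun i hi j hj => hinj i (Finset.mem_range.1 hi) j (Finset.mem_range.1 hj))
    (fun j hj => by
      have hc := h.chain d le_rfl j (Finset.mem_range.1 hj)
      rw [map_smul, ← hc.aeval_pow h.height_lt.le, aeval_aeval_comm, hc.aeval_pow_last le_rfl,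
        map_zero, smul_zero]) hm i (Finset.mem_range.2 hi)

end IsSpectralData

namespace QSystem

variable {a : List ℕ → ℂ}

theorem holds_baseSystem (ha : a [] = 1) {d : ℕ} (A : Matrix (Fin d) (Fin d) ℚ) (x : Fin d → ℚ)
    (r K t i₀ : ℕ) : Holds a (baseSystem (rowsCode A) (vecCode x) r K t i₀) ↔
    mat a d = A.map (algebraMap ℚ ℂ) ∧ vec a d [3, d] = complexVec x ∧
    (∀ c : Fin d, vec a d [3, c] = complexVec (Pi.single c 1)) ∧ Holds a (chainEqs d r K) ∧
    Holds a (modulusEqs r i₀) ∧ Holds a (heightEqs d r t i₀) ∧ i₀ < r ∧ t < K := by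
  have hunit : ∀ c : Fin d, (fun l => if c = l then 1 else 0 : Fin d → ℂ) =
      complexVec (Pi.single c 1) := fun c => by
    ext l
    simp only [complexVec, Pi.single_apply, eq_comm (a := c)]
    split_ifs <;> simp
  unfold baseSystem
  simp only [holds_append, length_vecCode, holds_constRows_matrix ha, holds_constRow_vecCode ha,
    holds_unitEqs ha, holds_gate ha, decide_eq_true_eq, hunit, and_assoc]
  rfl

/-- Every solution, wherever it comes from, carries genuine spectral data. Distinctness of the
eigenvalues is not part of it: it comes from `leadingEqs` and is not needed for the soundness of a
miss. -/
theorem isSpectralData (ha : a [] = 1) {d : ℕ} {A : Matrix (Fin d) (Fin d) ℚ} {x : Fin d → ℚ}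
    {r K t i₀ : ℕ} (h : Holds a (baseSystem (rowsCode A) (vecCode x) r K t i₀)) :
    IsSpectralData A x r K t i₀ (fun i => a [0, i]) (fun i => a [6, i])
      (fun c i k => vec a d [1, c, i, k]) := by
  obtain ⟨hA, hx, hu, hc, hm, hh, hi₀, ht⟩ := (holds_baseSystem ha A x r K t i₀).1 h
  obtain ⟨h1, h2, h3⟩ := (holds_chainEqs ha _ _ _).1 hc
  obtain ⟨h4, h5⟩ := (holds_heightEqs ha _ _ _ _).1 hh
  rw [holds_modulusEqs ha] at hm
  refine ⟨fun c => (h1 c c.2.le).trans (hu c), (h1 d le_rfl).trans hx,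
    fun c hc i hi => ⟨fun k hk => ?_, h3 c hc i hi⟩, hi₀, ht, fun i hi => ?_,
    fun i hi hδ => ?_, fun h0 => ?_⟩
  · rw [complexEnd, ← hA, Matrix.toLin'_apply, h2 c hc i hi k hk]
  · obtain ⟨e1, e2, e3⟩ := hm i hi
    rcases e2 with e2 | e2
    · right
      refine ⟨e2, lt_of_pow_lt_pow_left₀ 2 (norm_nonneg _) ?_⟩
      have : a [4, i] ≠ 0 := by rintro h0; simp [e2, h0] at e3
      have := norm_pos_iff.2 this
      nlinarith
    · left
      rw [e2] at e1 e3
      refine ⟨by simpa using e3, ?_⟩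
      rw [norm_zero] at e1
      exact (sq_eq_sq₀ (norm_nonneg _) (norm_nonneg _)).1 (by simpa using e1)
  · have := h4 i hi
    rwa [hδ, one_smul] at this
  · rw [h0, zero_dotProduct] at h5
    exact zero_ne_one h5

end QSystem

/-! ### Convergence of the orbit -/

theorem complexVec_injective {d : ℕ} : Function.Injective (complexVec (d := d)) := fun _ _ h =>
  funext fun i => Rat.cast_injective (α := ℂ) (congrFun h i)

theorem complexVec_zero {d : ℕ} : complexVec (0 : Fin d → ℚ) = 0 := by
  ext; simp [complexVec]

section Norms

variable {d : ℕ}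

/-- The vector of the real parts. -/
noncomputable def reVec (z : Fin d → ℂ) : EuclideanSpace ℝ (Fin d) :=
  WithLp.toLp 2 fun l => (z l).re

theorem reVec_complexVec (x : Fin d → ℚ) : reVec (complexVec x) = realVec x := by
  ext l
  simp [reVec, complexVec, realVec]

theorem norm_reVec_le (z : Fin d → ℂ) : ‖reVec z‖ ≤ d * ‖z‖ := by
  have h : ‖reVec z‖ ^ 2 ≤ (d * ‖z‖) ^ 2 := by
    rw [EuclideanSpace.norm_sq_eq]
    calc ∑ l, ‖reVec z l‖ ^ 2 ≤ ∑ _l : Fin d, ‖z‖ ^ 2 :=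
          Finset.sum_le_sum fun l _ => pow_le_pow_left₀ (norm_nonneg _)
            ((Complex.abs_re_le_norm (z l)).trans (norm_le_pi_norm z l)) 2
      _ = d * ‖z‖ ^ 2 := by simp
      _ ≤ (d : ℝ) ^ 2 * ‖z‖ ^ 2 := by
          refine mul_le_mul_of_nonneg_right ?_ (by positivity)
          exact_mod_cast Nat.le_self_pow two_ne_zero d
      _ = _ := by ring
  exact le_of_sq_le_sq h (by positivity)

theorem norm_complexVec_le (x : Fin d → ℚ) : ‖complexVec x‖ ≤ ‖realVec x‖ := by
  refine (pi_norm_le_iff_of_nonneg (norm_nonneg _)).2 fun l => ?_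
  have h := EuclideanSpace.norm_sq_eq (realVec x)
  have h1 : ‖complexVec x l‖ ^ 2 ≤ ‖realVec x‖ ^ 2 := by
    rw [h]
    refine le_trans (le_of_eq ?_)
      (Finset.single_le_sum (f := fun l => ‖realVec x l‖ ^ 2) (fun _ _ => by positivity)
        (Finset.mem_univ l))
    rw [complexVec, realVec, Complex.norm_ratCast, Real.norm_eq_abs]
  exact le_of_sq_le_sq h1 (norm_nonneg _)

theorem projDist_nonneg (v w : EuclideanSpace ℝ (Fin d)) : 0 ≤ projDist v w :=
  le_min (norm_nonneg _) (norm_nonneg _)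

theorem projDistTo_nonneg (v : EuclideanSpace ℝ (Fin d))
    (W : Submodule ℝ (EuclideanSpace ℝ (Fin d))) : 0 ≤ projDistTo v W :=
  Real.iInf_nonneg fun _ => projDist_nonneg _ _

/-- Dividing both vectors by ‖v‖ leaves ‖v - w‖ / ‖v‖, and correcting the length of w costs |‖w‖ -
‖v‖| / ‖v‖, which is no larger. -/
theorem projDistTo_le {v w : EuclideanSpace ℝ (Fin d)}
    {W : Submodule ℝ (EuclideanSpace ℝ (Fin d))} (hv : v ≠ 0) (hw : w ∈ W) (hw0 : w ≠ 0) :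
    projDistTo v W ≤ 2 * ‖v - w‖ / ‖v‖ := by
  have h0 : projDistTo v W ≤ projDist v w :=
    ciInf_le (f := fun w : {w : EuclideanSpace ℝ (Fin d) // w ∈ W ∧ w ≠ 0} => projDist v w.1)
      ⟨0, fun _ ⟨_, h⟩ => h ▸ projDist_nonneg _ _⟩ ⟨w, hw, hw0⟩
  refine h0.trans ((min_le_left _ _).trans ?_)
  have hv' := norm_pos_iff.2 hv
  have hw' := norm_pos_iff.2 hw0
  have e : ‖v‖⁻¹ • v - ‖w‖⁻¹ • w = ‖v‖⁻¹ • (v - w) + (‖v‖⁻¹ - ‖w‖⁻¹) • w := by module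
  have e2 : |‖v‖⁻¹ - ‖w‖⁻¹| * ‖w‖ = |‖w‖ - ‖v‖| / ‖v‖ := by
    have : ‖v‖⁻¹ - ‖w‖⁻¹ = (‖w‖ - ‖v‖) / (‖v‖ * ‖w‖) := by field_simp
    rw [this, abs_div, abs_of_pos (mul_pos hv' hw')]
    field_simp
  rw [e]
  refine (norm_add_le _ _).trans ?_
  rw [norm_smul, norm_smul, Real.norm_eq_abs (_ - _), e2, norm_inv, norm_norm]
  have := abs_norm_sub_norm_le w v
  rw [norm_sub_rev] at this
  calc ‖v‖⁻¹ * ‖v - w‖ + |‖w‖ - ‖v‖| / ‖v‖ ≤ ‖v‖⁻¹ * ‖v - w‖ + ‖v - w‖ / ‖v‖ := by gcongr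
    _ = _ := by field_simp; ring

end Norms

theorem eventually_bounds {r : ℕ} {ρ : ℝ} (hρ : 0 < ρ) (l δ : ℕ → ℂ)
    (hl : ∀ i < r, δ i = 0 → ‖l i‖ < ρ) : ∀ᶠ h : ℕ in Filter.atTop, 1 ≤ h * ρ ^ 2 ∧ ρ ^ 2 ≤ h ∧
      ∀ i < r, δ i = 0 → 1 ≤ h * (ρ ^ 2 - ‖l i‖ ^ 2) := by
  have hex : ∀ m : ℝ, 0 < m → ∀ᶠ h : ℕ in Filter.atTop, 1 ≤ h * m := fun m hm =>
    (tendsto_natCast_atTop_atTop.atTop_mul_const hm).eventually_ge_atTop 1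
  have h3 : ∀ i ∈ Finset.range r, ∀ᶠ h : ℕ in Filter.atTop,
      δ i = 0 → 1 ≤ h * (ρ ^ 2 - ‖l i‖ ^ 2) := fun i hi => by
    by_cases hδ : δ i = 0
    · have := hl i (Finset.mem_range.1 hi) hδ
      filter_upwards [hex (ρ ^ 2 - ‖l i‖ ^ 2)
        (sub_pos.2 (pow_lt_pow_left₀ this (norm_nonneg _) two_ne_zero))] with h hh _ using hh
    · simp [hδ]
  have h4 := (Filter.eventually_all_finset (Finset.range r)).2 h3
  filter_upwards [hex (ρ ^ 2) (by positivity),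
    tendsto_natCast_atTop_atTop.eventually_ge_atTop (ρ ^ 2), h4] with h h1 h2 h3
  exact ⟨h1, h2, fun i hi => h3 i (Finset.mem_range.2 hi)⟩

/-- A linear form that vanishes on a subspace and singles out one of finitely many vectors. -/
theorem exists_linearForm {E : Type*} [AddCommGroup E] [Module ℂ E] {r i₀ : ℕ} (hi₀ : i₀ < r)
    {f : ℕ → E} {U : Submodule ℂ E}
    (hf : ∀ m : ℕ → ℂ, ∑ i ∈ Finset.range r, m i • f i ∈ U → m i₀ = 0) :
    ∃ φ : E →ₗ[ℂ] ℂ, (∀ i < r, φ (f i) = if i = i₀ then 1 else 0) ∧ ∀ z ∈ U, φ z = 0 := by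
  -- The form is obtained by separating `f i₀` from the span of `U` and the other vectors.
  let N : Submodule ℂ E :=
    Submodule.span ℂ (f '' ((Finset.range r).erase i₀ : Finset ℕ)) ⊔ U
  have hN : f i₀ ∉ N := fun hmem => by
    obtain ⟨y, hy, z, hz, hyz⟩ := Submodule.mem_sup.1 hmem
    obtain ⟨m', hm'⟩ := (Submodule.mem_span_image_finset_iff_exists_fun ℂ).1 hy
    obtain ⟨m, hm⟩ : ∃ m : ℕ → ℂ, ∑ i ∈ (Finset.range r).erase i₀, m i • f i = y :=
      ⟨fun i => if hi : i ∈ (Finset.range r).erase i₀ then m' ⟨i, hi⟩ else 0, by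
        rw [← hm', ← Finset.sum_coe_sort]
        exact Finset.sum_congr rfl fun i _ => congrArg (· • _) (dif_pos i.2)⟩
    have := hf (fun i => if i = i₀ then 1 else -m i) (by
      have e : ∑ i ∈ (Finset.range r).erase i₀, (if i = i₀ then 1 else -m i) • f i = -y := by
        rw [← hm, ← Finset.sum_neg_distrib]
        exact Finset.sum_congr rfl fun i hi => by
          rw [if_neg (Finset.mem_erase.1 hi).1, neg_smul]
      rw [← Finset.add_sum_erase _ _ (Finset.mem_range.2 hi₀), if_pos rfl, one_smul, e, ← hyz]
      simpa using hz)
    simp at this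
  obtain ⟨φ, hφ, hker⟩ := Submodule.exists_le_ker_of_notMem hN
  refine ⟨(φ (f i₀))⁻¹ • φ, fun i hi => ?_, fun z hz => ?_⟩
  · split_ifs with hi0
    · rw [hi0, LinearMap.smul_apply, smul_eq_mul, inv_mul_cancel₀ hφ]
    · have : φ (f i) = 0 := hker (Submodule.mem_sup_left (Submodule.subset_span
        ⟨i, Finset.mem_coe.2 (Finset.mem_erase.2 ⟨hi0, Finset.mem_range.2 hi⟩), rfl⟩))
      rw [LinearMap.smul_apply, this, smul_zero]
  · have : φ z = 0 := hker (Submodule.mem_sup_right hz)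
    rw [LinearMap.smul_apply, this, smul_zero]

/-! ### The leading part of the orbit -/

namespace IsSpectralData

variable {d : ℕ} {A : Matrix (Fin d) (Fin d) ℚ} {x : Fin d → ℚ} {r K t i₀ : ℕ}
  {lam δ : ℕ → ℂ} {V : ℕ → ℕ → ℕ → Fin d → ℂ}

/-- If the dominating modulus is 0, all eigenvalues are 0, and A^K annihilates the chains of all
unit vectors. -/
theorem pow_eq_zero (h : IsSpectralData A x r K t i₀ lam δ V) (h0 : lam i₀ = 0) : A ^ K = 0 := by
  refine Matrix.ext_of_mulVec_single fun c => complexVec_injective ?_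
  rw [Matrix.zero_mulVec, complexVec_zero, ← complexEnd_pow_complexVec, ← h.sum_unit c, map_sum]
  refine Finset.sum_eq_zero fun i hi => ?_
  have hi := Finset.mem_range.1 hi
  have hz : lam i = 0 := by
    have := h.norm_le hi
    rw [h0, norm_zero] at this
    exact norm_le_zero_iff.1 this
  have := (h.chain c c.2.le i hi).aeval_pow_last le_rfl
  simpa [hz] using this

/-- The leading part of the `n`-th point of the orbit. -/
noncomputable def _root_.leadingPart {d : ℕ} (r t : ℕ) (lam δ : ℕ → ℂ)
    (V : ℕ → ℕ → ℕ → Fin d → ℂ) (n : ℕ) : Fin d → ℂ :=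
  ∑ i ∈ Finset.range r, ((n.choose t : ℂ) * lam i ^ (n - t)) • δ i • V d i t

theorem coeff_eq_zero (h : IsSpectralData A x r K t i₀ lam δ V)
    (hinj : ∀ i < r, ∀ j < r, lam i = lam j → i = j) {m : ℕ → ℂ}
    (hm : ∑ i ∈ Finset.range r, m i • δ i • V d i t = 0) : m i₀ = 0 := by
  have := h.eq_zero_of_sum_eq_zero hinj (m := fun i => m i * δ i)
    (by simpa only [mul_smul] using hm) i₀ h.index_lt
  simpa [h.eq_one, h.ne_zero] using this

theorem exists_functional (h : IsSpectralData A x r K t i₀ lam δ V)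
    (hinj : ∀ i < r, ∀ j < r, lam i = lam j → i = j) :
    ∃ φ : (Fin d → ℂ) →ₗ[ℂ] ℂ, ∀ i < r, φ (δ i • V d i t) = if i = i₀ then 1 else 0 := by
  obtain ⟨φ, hφ, -⟩ := exists_linearForm h.index_lt (f := fun i => δ i • V d i t) (U := ⊥)
    fun m hm => h.coeff_eq_zero hinj ((Submodule.mem_bot ℂ).1 hm)
  exact ⟨φ, hφ⟩

/-- The summands of the leading part rotate against each other as n varies. A form that isolates the
summand at `i₀` bounds the leading part below by a multiple of C(n,t) ρ^(n-t), and the error is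
smaller by a factor of order n. -/
theorem exists_norm_sub_leadingPart_le (h : IsSpectralData A x r K t i₀ lam δ V)
    (hinj : ∀ i < r, ∀ j < r, lam i = lam j → i = j) (h0 : lam i₀ ≠ 0) : ∃ B : ℝ, ∀ n ≥ 2 * K,
      0 < ‖leadingPart r t lam δ V n‖ ∧
      ‖complexVec ((A ^ n).mulVec x) - leadingPart r t lam δ V n‖ * (n - 2 * K : ℕ) ≤
        B * ‖leadingPart r t lam δ V n‖ := by
  obtain ⟨φ, hφ⟩ := h.exists_functional hinj
  have hρ := norm_pos_iff.2 h0
  obtain ⟨b, hb1, hb2, hb3⟩ := (eventually_bounds hρ lam δ fun i hi hδ =>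
    ((h.dominating i hi).resolve_left fun h1 => by simp [hδ] at h1).2).exists
  obtain ⟨H, hH⟩ : ∃ H : ℝ, ∀ i < r, ∀ k < K, ‖V d i k‖ ≤ H :=
    ⟨∑ i ∈ Finset.range r, ∑ k ∈ Finset.range K, ‖V d i k‖, fun i hi k hk =>
      (Finset.single_le_sum (f := fun k => ‖V d i k‖) (fun _ _ => norm_nonneg _)
        (Finset.mem_range.2 hk)).trans (Finset.single_le_sum
          (f := fun i => ∑ k ∈ Finset.range K, ‖V d i k‖)
          (fun _ _ => Finset.sum_nonneg fun _ _ => norm_nonneg _) (Finset.mem_range.2 hi))⟩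
  have hH0 : 0 ≤ H := (norm_nonneg _).trans (hH i₀ h.index_lt t h.height_lt)
  refine ⟨r * K * H * QSystem.ratioBound K b * ‖LinearMap.toContinuousLinearMap φ‖, fun n hn => ?_⟩
  have hmain : φ (leadingPart r t lam δ V n) = (n.choose t : ℂ) * lam i₀ ^ (n - t) := by
    rw [leadingPart, map_sum, Finset.sum_eq_single_of_mem i₀ (Finset.mem_range.2 h.index_lt)]
    · rw [map_smul, hφ i₀ h.index_lt, if_pos rfl, smul_eq_mul, mul_one]
    · intro i hi hne
      rw [map_smul, hφ i (Finset.mem_range.1 hi), if_neg hne, smul_zero]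
  have hnorm : (n.choose t : ℝ) * ‖lam i₀‖ ^ (n - t) ≤
      ‖LinearMap.toContinuousLinearMap φ‖ * ‖leadingPart r t lam δ V n‖ := by
    have := (LinearMap.toContinuousLinearMap φ).le_opNorm (leadingPart r t lam δ V n)
    rwa [LinearMap.coe_toContinuousLinearMap', hmain, norm_mul, norm_pow,
      Complex.norm_natCast] at this
  have hpos : 0 < (n.choose t : ℝ) * ‖lam i₀‖ ^ (n - t) :=
    mul_pos (by exact_mod_cast Nat.choose_pos (by have := h.height_lt; omega)) (by positivity)
  refine ⟨(norm_nonneg _).lt_of_ne fun h0 => ?_, ?_⟩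
  · rw [← h0, mul_zero] at hnorm; linarith
  · rw [h.pow_apply, leadingPart]
    refine (norm_sub_leading_mul_le hρ hb1 hb2 h.height_lt hH (fun i hi => ?_) hn).trans ?_
    · rcases h.dominating i hi with h1 | h1
      · exact Or.inl ⟨h1.1, h1.2, fun k hk htk => h.eq_zero_of_lt hi h1.1 hk htk⟩
      · exact Or.inr ⟨h1.1, hb3 i hi h1.1⟩
    · rw [mul_assoc _ ‖LinearMap.toContinuousLinearMap φ‖]
      exact mul_le_mul_of_nonneg_left hnorm (by positivity)

/-- For real `w k`, the real part of a complex combination is the combination with the real parts of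
the coefficients. -/
theorem reVec_leadingPart_mem {W : Submodule ℝ (EuclideanSpace ℝ (Fin d))} {p : ℕ}
    {w : ℕ → Fin d → ℂ} (hw : ∀ k < p, reVec (w k) ∈ W) (hreal : ∀ k < p, ∀ l, (w k l).im = 0)
    {c : ℕ → ℕ → ℂ}
    (hc : ∀ i < r, δ i • V d i t = ∑ k ∈ Finset.range p, c i k • w k) (m : ℕ → ℂ) :
    reVec (∑ i ∈ Finset.range r, m i • δ i • V d i t) ∈ W := by
  have : reVec (∑ i ∈ Finset.range r, m i • δ i • V d i t) =
      ∑ k ∈ Finset.range p, (∑ i ∈ Finset.range r, m i * c i k).re • reVec (w k) := by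
    ext l
    have e : (∑ i ∈ Finset.range r, m i • δ i • V d i t) l =
        ∑ k ∈ Finset.range p, (∑ i ∈ Finset.range r, m i * c i k) * w k l := by
      rw [Finset.sum_congr rfl fun i hi => congrArg (m i • ·) (hc i (Finset.mem_range.1 hi))]
      simp only [Finset.sum_apply, Pi.smul_apply, smul_eq_mul, Finset.mul_sum, Finset.sum_mul]
      rw [Finset.sum_comm]
      simp only [mul_assoc]
    have e1 : reVec (∑ i ∈ Finset.range r, m i • δ i • V d i t) l =
      ((∑ i ∈ Finset.range r, m i • δ i • V d i t) l).re := rfl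
    rw [e1, e, Complex.re_sum]
    simp only [WithLp.ofLp_sum, Finset.sum_apply, WithLp.ofLp_smul, Pi.smul_apply, smul_eq_mul]
    refine Finset.sum_congr rfl fun k hk => ?_
    rw [Complex.mul_re, hreal k (Finset.mem_range.1 hk), mul_zero, sub_zero]
    rfl
  rw [this]
  exact Submodule.sum_mem _ fun k hk => Submodule.smul_mem _ _ (hw k (Finset.mem_range.1 hk))

theorem orbitConvergesTo (h : IsSpectralData A x r K t i₀ lam δ V)
    (hinj : ∀ i < r, ∀ j < r, lam i = lam j → i = j) (h0 : lam i₀ ≠ 0)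
    {W : Submodule ℝ (EuclideanSpace ℝ (Fin d))}
    (hW : ∀ n, reVec (leadingPart r t lam δ V n) ∈ W) : OrbitConvergesTo A x W := by
  obtain ⟨B, hB⟩ := h.exists_norm_sub_leadingPart_le hinj h0
  set G := leadingPart r t lam δ V with hG
  let ε : ℕ → ℝ := fun n => B / (n - 2 * K : ℕ)
  have hε : Filter.Tendsto ε Filter.atTop (nhds 0) :=
    (tendsto_natCast_atTop_atTop.comp (Filter.tendsto_sub_atTop_nat (2 * K))).const_div_atTop B
  have hclose : ∀ n > 2 * K, ‖complexVec ((A ^ n).mulVec x) - G n‖ ≤ ε n * ‖G n‖ := fun n hn => by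
    have hpos : (0 : ℝ) < (n - 2 * K : ℕ) := by exact_mod_cast (by omega)
    rw [div_mul_eq_mul_div, le_div_iff₀ hpos]
    exact (hB n hn.le).2
  have hdiff : ∀ n, realVec ((A ^ n).mulVec x) - reVec (G n) =
      reVec (complexVec ((A ^ n).mulVec x) - G n) := fun n => by
    rw [← reVec_complexVec]; ext l; simp [reVec]
  -- The summand 1 keeps the orbit vector at least half as long as `G n`; the summand d makes the
  -- real part of `G n` non-zero.
  have hlarge : ∀ᶠ n in Filter.atTop, 2 * K < n ∧ ε n * (d + 1) < 1 / 2 := by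
    refine (Filter.eventually_gt_atTop _).and ?_
    have := hε.mul_const ((d : ℝ) + 1)
    rw [zero_mul] at this
    exact this.eventually (gt_mem_nhds (by norm_num))
  have key : ∀ᶠ n in Filter.atTop, realVec ((A ^ n).mulVec x) ≠ 0 ∧
      projDistTo (realVec ((A ^ n).mulVec x)) W ≤ 4 * d * ε n := by
    filter_upwards [hlarge] with n ⟨hn, hn2⟩
    have hGpos := (hB n hn.le).1
    have hc := hclose n hn
    have hε0 : 0 ≤ ε n := nonneg_of_mul_nonneg_left ((norm_nonneg _).trans hc) hGpos
    have hr1 : ‖G n‖ - ε n * ‖G n‖ ≤ ‖realVec ((A ^ n).mulVec x)‖ := by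
      refine le_trans ?_ (norm_complexVec_le _)
      have := norm_sub_norm_le (G n) (complexVec ((A ^ n).mulVec x))
      rw [norm_sub_rev] at this
      linarith
    have hεd : 0 ≤ ε n * d := by positivity
    have hr2 : ‖G n‖ / 2 ≤ ‖realVec ((A ^ n).mulVec x)‖ := by nlinarith
    have hd : ‖realVec ((A ^ n).mulVec x) - reVec (G n)‖ ≤ d * (ε n * ‖G n‖) := by
      rw [hdiff]
      exact (norm_reVec_le _).trans (by gcongr)
    have hpos : 0 < ‖realVec ((A ^ n).mulVec x)‖ := by linarith
    refine ⟨norm_pos_iff.1 hpos, ?_⟩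
    have hw0 : reVec (G n) ≠ 0 := fun h0 => by
      rw [h0, sub_zero] at hd
      nlinarith
    refine (projDistTo_le (norm_pos_iff.1 hpos) (hW n) hw0).trans ?_
    rw [div_le_iff₀ hpos]
    calc 2 * ‖realVec ((A ^ n).mulVec x) - reVec (G n)‖ ≤ 2 * (d * (ε n * ‖G n‖)) := by gcongr
      _ = 4 * d * ε n * (‖G n‖ / 2) := by ring
      _ ≤ _ := by gcongr
  -- A zero in the orbit would persist, but the orbit is eventually non-zero.
  refine ⟨fun m hm => ?_, ?_⟩
  · obtain ⟨n, hn, hne, -⟩ := ((Filter.eventually_ge_atTop m).and key).exists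
    refine hne ?_
    rw [← Nat.sub_add_cancel hn, pow_add, ← Matrix.mulVec_mulVec, hm, Matrix.mulVec_zero]
    ext; simp [realVec]
  · refine squeeze_zero' (Filter.Eventually.of_forall fun n => projDistTo_nonneg _ _)
      (key.mono fun n hn => hn.2) ?_
    simpa using hε.const_mul (4 * (d : ℝ))

end IsSpectralData

/-! ### From the unknowns to descriptions of algebraic numbers -/

namespace CoeffList

/-- The coefficients of `q (X - n)`. -/
def translate (n : ℤ) (q : List ℤ) : List ℤ :=
  q.foldr (fun c P => add [c] (mul [-n, 1] P)) []

theorem polyOfCoeffs_translate (n : ℤ) (q : List ℤ) :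
    polyOfCoeffs (translate n q) = (polyOfCoeffs q).comp (X - C n) := by
  induction q with
  | nil => simp [translate, polyOfCoeffs]
  | cons c q ih =>
    have : translate n (c :: q) = add [c] (mul [-n, 1] (translate n q)) := rfl
    rw [this, polyOfCoeffs_add, polyOfCoeffs_mul, ih, polyOfCoeffs_cons, polyOfCoeffs_cons,
      polyOfCoeffs_cons, polyOfCoeffs_cons,
      show polyOfCoeffs [] = 0 from rfl]
    simp only [C_neg, C_1, mul_zero, add_zero, mul_one, add_comp, C_comp, mul_comp, X_comp]
    ring

@[fun_prop]
theorem primrec_translate {α : Type*} [Primcodable α] {n : α → ℤ} {q : α → List ℤ}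
    (hn : Primrec n) (hq : Primrec q) : Primrec fun a => translate (n a) (q a) := by
  unfold translate
  refine Primrec.foldr_of (h := fun a c P => add [c] (mul [-n a, 1] P)) hq (Primrec.const []) ?_
  fun_prop

end CoeffList

namespace QSystem

/-- The algebraic number described by a pair as in `nearEqs`. -/
def algCode (c : NearCode) : AlgCode :=
  (CoeffList.translate c.1 c.2, (c.1, 1), (0, 1), (2, 1))

@[fun_prop]
theorem primrec_algCode {α : Type*} [Primcodable α] {c : α → NearCode} (hc : Primrec c) :
    Primrec fun a => algCode (c a) := by
  unfold algCode; fun_prop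

theorem norm_pow_sub_pow_le {α β : ℂ} (hα : ‖α‖ ≤ 2) (hβ : ‖β‖ ≤ 2) (m : ℕ) :
    ‖α ^ (m + 1) - β ^ (m + 1)‖ ≤ (m + 1) * 2 ^ m * ‖α - β‖ := by
  induction m with
  | zero => simp
  | succ m ih =>
    have e : α ^ (m + 1 + 1) - β ^ (m + 1 + 1) =
        α * (α ^ (m + 1) - β ^ (m + 1)) + (α - β) * β ^ (m + 1) := by ring
    rw [e]
    refine (norm_add_le _ _).trans ?_
    rw [norm_mul, norm_mul, norm_pow]
    calc _ ≤ 2 * ((m + 1) * 2 ^ m * ‖α - β‖) + ‖α - β‖ * 2 ^ (m + 1) := by gcongr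
      _ = _ := by push_cast; ring

theorem aeval_polyOfCoeffs (q : List ℤ) (z : ℂ) {N : ℕ} (hN : q.length ≤ N) :
    aeval z (polyOfCoeffs q) = ∑ j ∈ Finset.range N, (q.getD j 0 : ℂ) * z ^ j := by
  rcases N.eq_zero_or_pos with rfl | hN0
  · rw [List.length_eq_zero_iff.1 (Nat.le_zero.1 hN)]
    simp [polyOfCoeffs]
  rw [aeval_eq_sum_range' (n := N)]
  · simp [coeff_polyOfCoeffs, zsmul_eq_mul]
  · refine (Nat.lt_iff_le_pred hN0).2 (natDegree_le_iff_coeff_eq_zero.2 fun j hj => ?_)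
    rw [coeff_polyOfCoeffs, getD_of_length_le (by omega)]

/-- In q(α) - q(β) the linear term q₁ (α - β) outweighs all others, because |α^m - β^m| ≤ m 2^(m-1)
|α - β| on the disc. -/
theorem eq_of_dominated {q : List ℤ} (hq : dominated q = true) {α β : ℂ} (hα : ‖α‖ < 2)
    (hβ : ‖β‖ < 2) (h0 : aeval α (polyOfCoeffs q) = 0) (h1 : aeval β (polyOfCoeffs q) = 0) :
    α = β := by
  rw [aeval_polyOfCoeffs q _ (Nat.le_add_right q.length 2), Finset.sum_range_succ',
    Finset.sum_range_succ'] at h0 h1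
  rw [dominated, decide_eq_true_eq, sum_map_range] at hq
  by_contra hne
  have hpos : 0 < ‖α - β‖ := norm_pos_iff.2 (sub_ne_zero.2 hne)
  have e : ((q.getD 1 0 : ℤ) : ℂ) * (α - β) = -∑ j ∈ Finset.range q.length,
      ((q.getD (j + 2) 0 : ℤ) : ℂ) * (α ^ (j + 2) - β ^ (j + 2)) := by
    simp only [mul_sub, Finset.sum_sub_distrib]
    simp only [zero_add, pow_zero, pow_one, add_assoc, Nat.reduceAdd] at h0 h1
    linear_combination h0 - h1
  have h2 : ((q.getD 1 0).natAbs : ℝ) * ‖α - β‖ ≤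
      ((∑ j ∈ Finset.range q.length,
        (j + 2) * (q.getD (j + 2) 0).natAbs * 2 ^ (j + 1) : ℕ) : ℝ) * ‖α - β‖ := by
    have e2 := congrArg norm e
    rw [norm_neg, norm_mul, Complex.norm_intCast, ← Int.cast_abs, ← Nat.cast_natAbs] at e2
    rw [e2]
    refine (norm_sum_le _ _).trans ?_
    rw [Nat.cast_sum, Finset.sum_mul]
    refine Finset.sum_le_sum fun j _ => ?_
    rw [norm_mul, Complex.norm_intCast, ← Int.cast_abs, ← Nat.cast_natAbs]
    refine (mul_le_mul_of_nonneg_left (norm_pow_sub_pow_le hα.le hβ.le (j + 1))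
      (Nat.cast_nonneg _)).trans (le_of_eq ?_)
    push_cast
    ring
  have h3 := le_of_mul_le_mul_right h2 hpos
  exact absurd (Nat.cast_le.1 h3) (not_le.2 hq)

/-- The slack places `w` at distance at most 1 from the integer centre, hence strictly inside the
disc of radius 2, on which domination makes the polynomial injective. -/
theorem represents_algCode {c : NearCode} {w : ℝ} {s : ℝ} {P : ℕ → ℂ} (hP0 : P 0 = 1)
    (hP : ∀ j < c.2.length, P (j + 1) = P j * (w - c.1))
    (hsum : ∑ j ∈ Finset.range c.2.length, (c.2.getD j 0 : ℂ) * P j = 0)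
    (hs : ((w : ℂ) - c.1) ^ 2 + (s : ℂ) ^ 2 = 1) (hc : dominated c.2 = true) :
    (algCode c).Represents (w : ℂ) := by
  have hpow : ∀ j ≤ c.2.length, P j = ((w : ℂ) - c.1) ^ j := fun j => by
    induction j with
    | zero => intro _; rw [hP0, pow_zero]
    | succ j ih => intro hj; rw [hP j (by omega), ih (by omega), pow_succ]
  have heval : ∀ z : ℂ, aeval z (polyOfCoeffs (algCode c).1) =
      aeval (z - c.1) (polyOfCoeffs c.2) := fun z => by
    rw [algCode, CoeffList.polyOfCoeffs_translate, aeval_comp]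
    simp
  have hroot : aeval ((w : ℂ) - c.1) (polyOfCoeffs c.2) = 0 := by
    rw [aeval_polyOfCoeffs _ _ le_rfl, ← hsum]
    exact Finset.sum_congr rfl fun j hj => by rw [hpow j (Finset.mem_range.1 hj).le]
  have hnorm : ‖(w : ℂ) - c.1‖ < 2 := by
    have e1 : ((w : ℂ) - c.1) = ((w - c.1 : ℝ) : ℂ) := by push_cast; rfl
    have e2 : (w - c.1 : ℝ) ^ 2 + s ^ 2 = 1 := by exact_mod_cast hs
    rw [e1, Complex.norm_real, Real.norm_eq_abs, abs_lt]
    constructor <;> nlinarith [sq_nonneg s]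
  have hz : (⟨((algCode c).2.1.val : ℝ), ((algCode c).2.2.1.val : ℝ)⟩ : ℂ) = c.1 := by
    apply Complex.ext <;> simp [algCode, RatCode.val]
  have hr : (((algCode c).2.2.2.val : ℚ) : ℝ) = 2 := by simp [algCode, RatCode.val]
  unfold AlgCode.Represents
  simp only [hz, hr, heval]
  refine ⟨fun h0 => ?_, hroot, hnorm, fun β hβ hβ2 => ?_⟩
  · have hc0 : polyOfCoeffs c.2 = 0 := by
      have : (polyOfCoeffs c.2).comp (X - C c.1) = 0 := by
        rw [← CoeffList.polyOfCoeffs_translate]; exact h0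
      have h1 := congrArg (fun p => p.comp (X + C c.1)) this
      simpa [comp_assoc] using h1
    have h1 := congrArg (fun p => p.coeff 1) hc0
    simp only [coeff_polyOfCoeffs, coeff_zero] at h1
    rw [dominated, decide_eq_true_eq, h1] at hc
    simp at hc
  · have := eq_of_dominated hc hβ2 hnorm hβ hroot
    linear_combination this

/-! ### The limit space given by a solution of `limitSystem` -/

variable {a : List ℕ → ℂ} {d : ℕ} {A : Matrix (Fin d) (Fin d) ℚ} {x : Fin d → ℚ}
  {r K t i₀ s : ℕ} {codes : List (List NearCode)}

theorem holds_limitSystem (ha : a [] = 1) :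
    Holds a (limitSystem (rowsCode A) (vecCode x) r K t i₀ s codes) ↔
    Holds a (baseSystem (rowsCode A) (vecCode x) r K t i₀) ∧ s + 1 < K ∧
    Holds a (leadingEqs d r s codes.length) ∧ Holds a (basisEqs d r t codes.length) ∧
    ∀ k < codes.length, (codes.getD k []).length = d ∧
      ∀ l < d, Holds a (nearEqs k l ((codes.getD k []).getD l (0, []))) := by
  unfold limitSystem
  simp only [holds_append, holds_gate ha, decide_eq_true_eq, length_vecCode,
    holds_flatMap_range, and_assoc]

theorem injective_of_leadingEqs (ha : a [] = 1) {p : ℕ} (h : Holds a (leadingEqs d r s p)) :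
    ∀ i < r, ∀ j < r, a [0, i] = a [0, j] → i = j := fun i hi j hj hij => by
  have := ((holds_leadingEqs ha _ _ _ _).1 h).1 i hi j hj
  rw [hij, sub_self, zero_mul] at this
  by_contra hne
  rw [if_neg hne] at this
  exact zero_ne_one this

/-- Heights of chains are multiplicities, by `lt_multIn_minpoly_iff`. That criterion holds only
below K, so s + 1 < K is needed to bound multiplicities by s + 1; 0 < p ensures that the bound is
attained. -/
theorem leadingRoots_minpoly (ha : a [] = 1) {p : ℕ}
    (hb : Holds a (baseSystem (rowsCode A) (vecCode x) r K t i₀)) (hs : s + 1 < K)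
    (hl : Holds a (leadingEqs d r s p)) (hp : 0 < p) :
    leadingRoots (minpoly ℚ A) = {z | ∃ i < r, a [0, i] = z ∧ a [9, i] = 1} := by
  have hd := isSpectralData ha hb
  have hinj := injective_of_leadingEqs ha hl
  obtain ⟨-, h1, h2, h3⟩ := (holds_leadingEqs ha _ _ _ _).1 hl
  have hdec := hd.isDecomposition_unit hinj
  have hmult : ∀ i < r, ∀ k < K, k < multIn (minpoly ℚ A) (a [0, i]) ↔
      ∃ c : Fin d, vec a d [1, c, i, k] ≠ 0 := fun i hi k hk =>
    lt_multIn_minpoly_iff A hdec hi hk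
  have hι : ∀ i < r, a [9, i] = 0 ∨ a [9, i] = 1 := fun i hi => by
    have : a [9, i] * (a [9, i] - 1) = 0 := by rw [mul_sub, (h2 i hi).1, mul_one, sub_self]
    exact (mul_eq_zero.1 this).imp_right sub_eq_zero.1
  have hchar : ∀ i < r, a [9, i] = 1 ↔
      ‖a [0, i]‖ = ‖a [0, i₀]‖ ∧ s < multIn (minpoly ℚ A) (a [0, i]) := fun i hi => by
    rw [hmult i hi s (by omega), ← hd.eq_one_iff hi]
    constructor
    · intro h
      refine ⟨by simpa [h] using (h2 i hi).2.1, ?_⟩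
      by_contra! hall
      have := (h2 i hi).2.2
      rw [h, Finset.sum_eq_zero] at this
      · exact zero_ne_one this
      · intro c hc
        rw [hall ⟨c, Finset.mem_range.1 hc⟩, zero_dotProduct]
    · rintro ⟨h, c, hc⟩
      have := (h1 c c.2 i hi).2
      rw [h] at this
      exact (sub_eq_zero.1 ((smul_eq_zero.1 this).resolve_right hc)).symm
  have hex : ∃ i < r, a [9, i] = 1 := by
    by_contra! hall
    rw [Finset.sum_eq_zero fun i hi => (hι i (Finset.mem_range.1 hi)).resolve_right
      (hall i (Finset.mem_range.1 hi))] at h3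
    exact hp.ne (by exact_mod_cast h3)
  rw [leadingRoots_eq (minpoly_matrix_ne_zero A) (r := r) (lam := fun i => a [0, i])
    (ρ := ‖a [0, i₀]‖) (s := s) (fun z hz => hdec.exists_eq_of_isRoot
      (fun g hg => map_minpoly_dvd A hg) hz) (fun i hi _ => hd.norm_le hi) ?_ ?_]
  · ext z
    refine exists_congr fun i => and_congr_right fun hi => and_congr_right fun _ => ?_
    rw [hchar i hi]
  · intro i hi hnorm
    by_contra! hlt
    obtain ⟨c, hc⟩ := (hmult i hi (s + 1) hs).1 hlt
    have := (h1 c c.2 i hi).1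
    have e : a [6, i] = 1 := (hd.eq_one_iff hi).2 hnorm
    rw [e, one_smul] at this
    exact hc this
  · obtain ⟨i, hi, h⟩ := hex
    exact ⟨i, hi, (hchar i hi).1 h⟩

theorem ncard_leadingRoots (ha : a [] = 1) {p : ℕ}
    (hb : Holds a (baseSystem (rowsCode A) (vecCode x) r K t i₀)) (hs : s + 1 < K)
    (hl : Holds a (leadingEqs d r s p)) (hp : 0 < p) :
    (leadingRoots (minpoly ℚ A)).ncard = p := by
  classical
  have hinj := injective_of_leadingEqs ha hl
  obtain ⟨-, -, h2, h3⟩ := (holds_leadingEqs ha _ _ _ _).1 hl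
  have hset : leadingRoots (minpoly ℚ A) =
      (fun i => a [0, i]) '' ((Finset.range r).filter fun i => a [9, i] = 1 : Finset ℕ) := by
    rw [leadingRoots_minpoly ha hb hs hl hp]
    ext z
    simp only [Finset.coe_filter, Finset.mem_range, Set.mem_image, Set.mem_ofPred_eq]
    exact exists_congr fun i => by tauto
  rw [hset, Set.InjOn.ncard_image, Set.ncard_coe_finset]
  · have : (((Finset.range r).filter fun i => a [9, i] = 1).card : ℂ) = p := by
      rw [← h3, Finset.card_filter, Nat.cast_sum]
      refine Finset.sum_congr rfl fun i hi => ?_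
      have : a [9, i] * (a [9, i] - 1) = 0 := by
        rw [mul_sub, (h2 i (Finset.mem_range.1 hi)).1, mul_one, sub_self]
      rcases mul_eq_zero.1 this with h | h
      · simp [h]
      · simp [sub_eq_zero.1 h]
    exact_mod_cast this
  · intro i hi j hj hij
    simp only [Finset.coe_filter, Finset.mem_range, Set.mem_ofPred_eq] at hi hj
    exact hinj i hi.1 j hj.1 hij

/-- The vectors described by the output of the first algorithm. -/
noncomputable def basisVec (a : List ℕ → ℂ) (d p : ℕ) (k : Fin p) : EuclideanSpace ℝ (Fin d) :=
  reVec (vec a d [11, k])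

/-- The subspace described by the output of the first algorithm. -/
noncomputable def limitSpace (a : List ℕ → ℂ) (d p : ℕ) : Submodule ℝ (EuclideanSpace ℝ (Fin d)) :=
  Submodule.span ℝ (Set.range (basisVec a d p))

theorem im_eq_zero_of_basisEqs (ha : a [] = 1) {p : ℕ} (h : Holds a (basisEqs d r t p)) {k : ℕ}
    (hk : k < p) (l : Fin d) : (vec a d [11, k] l).im = 0 :=
  Complex.conj_eq_iff_im.1 (((holds_basisEqs ha _ _ _ _).1 h).2.1 k hk l).symm

theorem linearIndependent_basisVec (ha : a [] = 1) {p : ℕ} (h : Holds a (basisEqs d r t p)) :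
    LinearIndependent ℝ (basisVec a d p) := by
  rw [Fintype.linearIndependent_iff]
  intro g hg j
  have h1 := ((holds_basisEqs ha _ _ _ _).1 h).1 j j.2
  have h2 : ∑ k : Fin p, (g k : ℂ) • vec a d [11, k] = 0 := by
    ext l
    have := congrArg (fun v : EuclideanSpace ℝ (Fin d) => ((v l : ℝ) : ℂ)) hg
    simp only [WithLp.ofLp_sum, Finset.sum_apply, WithLp.ofLp_smul, Pi.smul_apply, smul_eq_mul,
      Complex.ofReal_sum, Complex.ofReal_mul, WithLp.ofLp_zero, Pi.zero_apply,
      Complex.ofReal_zero] at this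
    rw [Pi.zero_apply, ← this, Finset.sum_apply]
    refine Finset.sum_congr rfl fun k _ => ?_
    rw [Pi.smul_apply, smul_eq_mul]
    congr 1
    apply Complex.ext
    · rfl
    · exact im_eq_zero_of_basisEqs ha h k.2 l
  have h3 := congrArg (fun v => vec a d [12, j] ⬝ᵥ v) h2
  simp only [dotProduct_sum, dotProduct_smul, dotProduct_zero] at h3
  rw [Finset.sum_congr rfl fun (k : Fin p) _ => congrArg ((g k : ℂ) • ·) (h1 k k.2)] at h3
  simpa [Fin.val_inj] using h3

theorem finrank_limitSpace (ha : a [] = 1) {p : ℕ} (h : Holds a (basisEqs d r t p)) :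
    Module.finrank ℝ (limitSpace a d p) = p := by
  rw [limitSpace, finrank_span_eq_card (linearIndependent_basisVec ha h), Fintype.card_fin]

theorem reVec_sum_mem_limitSpace (ha : a [] = 1) {p : ℕ} (h : Holds a (basisEqs d r t p))
    (m : ℕ → ℂ) :
    reVec (∑ i ∈ Finset.range r, m i • a [6, i] • vec a d [1, d, i, t]) ∈ limitSpace a d p :=
  IsSpectralData.reVec_leadingPart_mem (δ := fun i => a [6, i])
    (V := fun c i k => vec a d [1, c, i, k]) (w := fun k => vec a d [11, k])
    (fun k hk => Submodule.subset_span (Set.mem_range_self (⟨k, hk⟩ : Fin p)))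
    (fun _ hk => im_eq_zero_of_basisEqs ha h hk) ((holds_basisEqs ha _ _ _ _).1 h).2.2 m

theorem forall₂_iff_getD {α β : Type*} {R : α → β → Prop} {l₁ : List α} {l₂ : List β} (x : α)
    (y : β) : List.Forall₂ R l₁ l₂ ↔
      l₁.length = l₂.length ∧ ∀ i < l₁.length, R (l₁.getD i x) (l₂.getD i y) := by
  rw [List.forall₂_iff_get]
  refine and_congr_right fun hlen => ⟨fun h i hi => ?_, fun h i h1 h2 => ?_⟩
  · rw [List.getD_eq_getElem _ _ hi, List.getD_eq_getElem _ _ (hlen ▸ hi)]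
    exact h i hi (hlen ▸ hi)
  · have := h i h1
    rwa [List.getD_eq_getElem _ _ h1, List.getD_eq_getElem _ _ h2] at this

theorem presentsSubspace_limitSpace (ha : a [] = 1)
    (h : Holds a (basisEqs d r t codes.length))
    (hc : ∀ k < codes.length, (codes.getD k []).length = d ∧
      ∀ l < d, Holds a (nearEqs k l ((codes.getD k []).getD l (0, [])))) :
    PresentsSubspace (codes.map (List.map algCode)) (limitSpace a d codes.length) := by
  refine ⟨List.ofFn (basisVec a d codes.length), ?_, ?_, ?_⟩
  · rw [forall₂_iff_getD [] 0]
    refine ⟨by simp, fun k hk => ?_⟩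
    rw [List.length_map] at hk
    obtain ⟨hlen, hnear⟩ := hc k hk
    have e : (codes.map (List.map algCode)).getD k [] = (codes.getD k []).map algCode := by
      simp [hk]
    have e' : (List.ofFn (basisVec a d codes.length)).getD k 0 = basisVec a d _ ⟨k, hk⟩ := by
      simp [hk]
    rw [e, e', forall₂_iff_getD (algCode (0, [])) 0]
    refine ⟨by simpa using hlen, fun l hl => ?_⟩
    rw [List.length_map, hlen] at hl
    have e2 : ((codes.getD k []).map algCode).getD l (algCode (0, [])) =
        algCode ((codes.getD k []).getD l (0, [])) := List.getD_map _ _ _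
    have e3 : (List.ofFn fun i => ((basisVec a d codes.length ⟨k, hk⟩ i : ℝ) : ℂ)).getD l 0 =
        ((basisVec a d codes.length ⟨k, hk⟩ ⟨l, hl⟩ : ℝ) : ℂ) := by simp [hl]
    have e4 : ((basisVec a d codes.length ⟨k, hk⟩ ⟨l, hl⟩ : ℝ) : ℂ) = a [11, k, l] := by
      apply Complex.ext
      · rfl
      · exact (im_eq_zero_of_basisEqs ha h hk ⟨l, hl⟩).symm
    rw [e2, e3]
    obtain ⟨⟨h1, h2, h3, h4⟩, h5⟩ := (holds_nearEqs ha _ _ _).1 (hnear l hl)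
    rw [← e4] at h2 h4
    exact represents_algCode h1 h2 h3 h4 h5
  · have := (linearIndependent_basisVec ha h)
    rw [← linearIndependent_equiv (finCongr (List.length_ofFn (f := basisVec a d codes.length)))]
      at this
    convert this using 1
    funext k
    exact List.get_ofFn _ _
  · rw [limitSpace]
    congr 1
    ext v
    simp [List.mem_ofFn]

/-- For p = 0 the non-zero leading vector at `i₀` would be an empty combination. -/
theorem length_pos_of_basisEqs (ha : a [] = 1) {p : ℕ}
    (hb : Holds a (baseSystem (rowsCode A) (vecCode x) r K t i₀))
    (h : Holds a (basisEqs d r t p)) : 0 < p := by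
  refine Nat.pos_of_ne_zero fun h0 => ?_
  subst h0
  have hd := isSpectralData ha hb
  have := ((holds_basisEqs ha _ _ _ _).1 h).2.2 i₀ hd.index_lt
  have e : a [6, i₀] = 1 := hd.eq_one
  rw [e, one_smul, Finset.range_zero, Finset.sum_empty] at this
  exact hd.ne_zero this

theorem apply_ne_zero_of_not_isNilpotent (ha : a [] = 1)
    (hb : Holds a (baseSystem (rowsCode A) (vecCode x) r K t i₀)) (hA : ¬ IsNilpotent A) :
    a [0, i₀] ≠ 0 := fun h0 => hA ⟨K, (isSpectralData ha hb).pow_eq_zero h0⟩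

end QSystem

/-! ### Algebraic solutions of linear equations -/

/-- There is a retraction of the complex numbers onto the algebraic numbers that is linear over the
algebraic numbers. -/
theorem exists_algebraic_retraction : ∃ π : ℂ →+ ℂ, (∀ z, IsAlgebraic ℚ (π z)) ∧
    (∀ z, IsAlgebraic ℚ z → π z = z) ∧ ∀ c z, IsAlgebraic ℚ c → π (c * z) = c * π z := by
  -- The retraction is an L-linear left inverse of the inclusion of L in ℂ.
  let L := algebraicClosure ℚ ℂ
  obtain ⟨π, hπ⟩ := (Algebra.linearMap L ℂ).exists_leftInverse_of_injective
    (LinearMap.ker_eq_bot.2 (algebraMap L ℂ).injective)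
  refine ⟨⟨⟨fun z => (π z : ℂ), by simp⟩, fun z w => by simp⟩, fun z => ?_, fun z hz => ?_,
    fun c z hc => ?_⟩
  · exact mem_algebraicClosure_iff.1 (π z).2
  · have := LinearMap.congr_fun hπ ⟨z, mem_algebraicClosure_iff.2 hz⟩
    exact congrArg Subtype.val this
  · have := π.map_smul (⟨c, mem_algebraicClosure_iff.2 hc⟩ : L) z
    exact congrArg Subtype.val this

/-! ### Existence of decompositions -/

/-- The generalised eigenspaces span E, and the chains are the images of the components under powers
of T - λ. Only eigenvalues that occur in some component are listed, which later makes every `lam i`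
a root of the minimal polynomial. -/
theorem exists_isDecomposition {E ι : Type*} [AddCommGroup E] [Module ℂ E] [FiniteDimensional ℂ E]
    [Fintype ι] (T : Module.End ℂ E) (y : ι → E) : ∃ r lam V,
    (∀ K, Module.finrank ℂ E ≤ K → IsDecomposition T y r K lam V) ∧
      ∀ i < r, ∃ c, V c i 0 ≠ 0 := by
  classical
  have h1 : ∀ c, ∃ f : ℂ →₀ E, (∀ μ, f μ ∈ T.maxGenEigenspace μ) ∧ (f.sum fun _ v => v) = y c :=
    fun c => by
      have : y c ∈ ⨆ μ, T.maxGenEigenspace μ := by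
        rw [Module.End.iSup_maxGenEigenspace_eq_top]; trivial
      exact (Submodule.mem_iSup_iff_exists_finsupp _ _).1 this
  choose f hf hsum using h1
  let S : Finset ℂ := Finset.univ.biUnion fun c => (f c).support
  let lam : ℕ → ℂ := fun i => if h : i < S.card then (S.equivFin.symm ⟨i, h⟩ : ℂ) else 0
  have hlam : ∀ i (h : i < S.card), lam i = S.equivFin.symm ⟨i, h⟩ := fun i h => dif_pos h
  refine ⟨S.card, lam, fun c i k => ((T - algebraMap ℂ _ (lam i)) ^ k) (f c (lam i)),
    fun K hK => ⟨fun c => ?_, fun c i hi => ⟨fun k hk => ?_, ?_⟩, fun i hi j hj hij => ?_⟩,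
    fun i hi => ?_⟩
  · rw [← hsum c, Finsupp.sum_of_support_subset (f c) (s := S) (fun μ hμ =>
      Finset.mem_biUnion.2 ⟨c, Finset.mem_univ _, hμ⟩) _ (by simp), Finset.sum_range]
    rw [← Finset.sum_coe_sort S, ← Equiv.sum_comp S.equivFin.symm fun μ : S => f c μ]
    refine Finset.sum_congr rfl fun i _ => ?_
    rw [hlam i i.2]
    simp
  · rw [pow_succ', Module.End.mul_apply]
    simp
  · have hm := hf c (lam i)
    rw [Module.End.maxGenEigenspace_eq_genEigenspace_finrank,
      Module.End.mem_genEigenspace_nat] at hm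
    have e := Nat.sub_add_cancel hK
    show ((T - algebraMap ℂ _ (lam i)) ^ K) (f c (lam i)) = 0
    rw [← e, pow_add, Module.End.mul_apply]
    rw [LinearMap.mem_ker] at hm
    have e2 : (T - algebraMap ℂ (Module.End ℂ E) (lam i)) = T - lam i • 1 := by
      rw [Algebra.algebraMap_eq_smul_one]
    rw [e2, hm, map_zero]
  · rw [hlam i hi, hlam j hj] at hij
    have := S.equivFin.symm.injective (Subtype.ext hij)
    simpa using this
  · have := (S.equivFin.symm ⟨i, hi⟩).2
    rw [← hlam i hi] at this
    obtain ⟨c, -, hc⟩ := Finset.mem_biUnion.1 this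
    exact ⟨c, by simpa using hc⟩

section

variable {d : ℕ} (A : Matrix (Fin d) (Fin d) ℚ)

theorem complexEnd_apply (v : Fin d → ℂ) (l : Fin d) :
    complexEnd A v l = ∑ m, (A l m : ℂ) * v m := by
  simp [complexEnd, Matrix.toLin'_apply, Matrix.mulVec, dotProduct]

/-- The decomposition of the unit vectors into generalised eigenvectors with algebraic entries. -/
theorem exists_isDecomposition_algebraic : ∃ r lam V,
    (∀ K, d ≤ K →
      IsDecomposition (complexEnd A) (fun c : Fin d => complexVec (Pi.single c 1)) r K lam V) ∧
    (∀ i < r, IsAlgebraic ℚ (lam i)) ∧ (∀ c i k l, IsAlgebraic ℚ (V c i k l)) ∧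
    ∀ i < r, aeval (lam i) (minpoly ℚ A) = 0 := by
  obtain ⟨r, lam, V, hV, hne⟩ := exists_isDecomposition (complexEnd A)
    (fun c : Fin d => complexVec (Pi.single c 1))
  simp only [Module.finrank_fin_fun] at hV
  have hroot : ∀ i < r, aeval (lam i) (minpoly ℚ A) = 0 := fun i hi => by
    have := (lt_multIn_minpoly_iff A (hV (d + 1) (by omega)) hi (Nat.succ_pos d)).2 (hne i hi)
    exact isRoot_map_iff.1 ((rootMultiplicity_pos ((Polynomial.map_ne_zero_iff
      (algebraMap ℚ ℂ).injective).2 (minpoly_matrix_ne_zero A))).1 this)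
  have halg : ∀ i < r, IsAlgebraic ℚ (lam i) := fun i hi =>
    ⟨_, minpoly_matrix_ne_zero A, hroot i hi⟩
  obtain ⟨π, h1, h2, h3⟩ := exists_algebraic_retraction
  have hrat : ∀ q : ℚ, IsAlgebraic ℚ (q : ℂ) := fun q => isAlgebraic_algebraMap q
  -- For fixed eigenvalues the conditions on the chains are linear with algebraic coefficients, so
  -- π, applied entrywise, preserves them.
  refine ⟨r, lam, fun c i k l => π (V c i k l), fun K hK =>
    ⟨fun c => ?_, fun c i hi => ⟨fun k hk => ?_, ?_⟩, (hV K hK).inj⟩, halg, fun c i k l => h1 _, hroot⟩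
  · ext l
    have := congrArg π (congrFun ((hV K hK).sum c) l)
    rw [complexVec, h2 _ (hrat _)] at this
    rw [complexVec, ← this, Finset.sum_apply, Finset.sum_apply, map_sum]
  · ext l
    have := congrArg π (congrFun (((hV K hK).chain c i hi).step k hk) l)
    rw [complexEnd_apply, map_sum] at this
    simp only [h3 _ _ (hrat _)] at this
    rw [complexEnd_apply, this]
    simp only [Pi.add_apply, Pi.smul_apply, smul_eq_mul, map_add, h3 _ _ (halg i hi)]
  · ext l
    have := congrArg π (congrFun ((hV K hK).chain c i hi).last l)
    simpa using this

end

theorem exists_greatest {P : ℕ → Prop} {n : ℕ} (hex : ∃ k, P k) (hb : ∀ k, P k → k < n) :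
    ∃ k, P k ∧ ∀ m, P m → m ≤ k := by
  classical
  obtain ⟨k, hk⟩ := hex
  exact ⟨Nat.findGreatest P n, Nat.findGreatest_spec (hb k hk).le hk,
    fun m hm => Nat.le_findGreatest (hb m hm).le hm⟩

theorem isAlgebraic_sum {ι : Type*} {s : Finset ι} {f : ι → ℂ}
    (h : ∀ i ∈ s, IsAlgebraic ℚ (f i)) : IsAlgebraic ℚ (∑ i ∈ s, f i) :=
  mem_algebraicClosure_iff.1 (sum_mem fun i hi => mem_algebraicClosure_iff.2 (h i hi))

theorem complexVec_eq_sum {d : ℕ} (x : Fin d → ℚ) :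
    complexVec x = ∑ c, (x c : ℂ) • complexVec (Pi.single c 1) := by
  ext l
  rw [Finset.sum_apply, Finset.sum_eq_single l]
  · simp [complexVec]
  · intro c _ hc
    simp [complexVec, hc.symm]
  · simp

/-- For a non-trivial starting point there are spectral data with algebraic entries; the dominating
eigenvalues at which `x` reaches its largest height are leading. -/
theorem exists_isSpectralData {d : ℕ} {A : Matrix (Fin d) (Fin d) ℚ} {x : Fin d → ℚ}
    (hx : NonTrivial A x) : ∃ r t i₀ s lam δ V, IsSpectralData A x r (d + 1) t i₀ lam δ V ∧
      (∀ i < r, ∀ j < r, lam i = lam j → i = j) ∧ (∀ i < r, IsAlgebraic ℚ (lam i)) ∧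
      (∀ c i k l, IsAlgebraic ℚ (V c i k l)) ∧ (∀ i < r, aeval (lam i) (minpoly ℚ A) = 0) ∧
      s < d ∧ (∀ i < r, δ i = 1 → ∀ c : Fin d, V c i (s + 1) = 0) ∧
      ∀ i < r, δ i = 1 → V d i t ≠ 0 → ∃ c : Fin d, V c i s ≠ 0 := by
  classical
  obtain ⟨r, lam, V₀, hV₀, hlam, halg, hroot⟩ := exists_isDecomposition_algebraic A
  -- The column of x is the same linear combination of the columns of the unit vectors as x itself,
  -- so both decompositions share their eigenvalues.
  let V : ℕ → ℕ → ℕ → Fin d → ℂ := fun c i k =>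
    if h : c < d then V₀ ⟨c, h⟩ i k else ∑ c, (x c : ℂ) • V₀ c i k
  have hVu : ∀ c : Fin d, V c = V₀ c := fun c => by
    funext i k; exact dif_pos c.2
  have hVd : ∀ i k, V d i k = ∑ c, (x c : ℂ) • V₀ c i k := fun i k => dif_neg (lt_irrefl d)
  have hzero : ∀ c i k, i < r → d ≤ k → V c i k = 0 := fun c i k hi hk => by
    have h0 := fun c => ((hV₀ k hk).chain c i hi).last
    by_cases hc : c < d
    · exact (dif_pos hc).trans (h0 _)
    · exact (dif_neg hc).trans (Finset.sum_eq_zero fun c _ => by rw [h0, smul_zero])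
  have hdec : IsDecomposition (complexEnd A) (fun c : Fin d => complexVec (Pi.single c 1))
      r (d + 1) lam (fun c => V c) := by
    have : (fun c : Fin d => V c) = V₀ := funext hVu
    rw [this]
    exact hV₀ _ (by omega)
  have hdecx : IsDecomposition (complexEnd A) (fun _ : Unit => complexVec x)
      r (d + 1) lam (fun _ => V d) := by
    refine ⟨fun _ => ?_, fun _ i hi => ⟨fun k hk => ?_, hzero d i _ hi (by omega)⟩, hdec.inj⟩
    · simp only [hVd]
      rw [Finset.sum_comm, complexVec_eq_sum]
      simp only [← Finset.smul_sum, (hV₀ d le_rfl).sum]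
    · simp only [hVd, map_sum, map_smul, ((hV₀ (d + 1) (by omega)).chain _ i hi).step k hk]
      simp only [smul_add, Finset.sum_add_distrib, Finset.smul_sum, smul_comm (lam i)]
  have hV : ∀ c i k l, IsAlgebraic ℚ (V c i k l) := fun c i k l => by
    by_cases hc : c < d
    · simp only [V, dif_pos hc, halg]
    · simp only [V, dif_neg hc, Finset.sum_apply, Pi.smul_apply, smul_eq_mul]
      exact isAlgebraic_sum fun c _ => (isAlgebraic_algebraMap (x c)).mul (halg _ _ _ _)
  have hmult : ∀ i < r, ∀ k < d + 1, k < multIn (minpoly ℚ A) (lam i) ↔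
      ∃ c : Fin d, V c i k ≠ 0 := fun i hi k hk => lt_multIn_minpoly_iff A hdec hi hk
  have hmultx : ∀ i < r, ∀ k < d + 1, k < multIn (vecMinpoly A x) (lam i) ↔ V d i k ≠ 0 :=
    fun i hi k hk => lt_multIn_vecMinpoly_iff A x hdecx hi hk
  have hpos : ∀ i < r, ∃ c : Fin d, V c i 0 ≠ 0 := fun i hi =>
    (hmult i hi 0 (Nat.succ_pos d)).1 ((rootMultiplicity_pos ((Polynomial.map_ne_zero_iff
      (algebraMap ℚ ℂ).injective).2 (minpoly_matrix_ne_zero A))).2 (isRoot_map_iff.2 (hroot i hi)))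
  obtain ⟨j, hj, hj0⟩ : ∃ j < r, V d j 0 ≠ 0 := by
    by_contra! hall
    refine hx.1 (complexVec_injective ?_)
    rw [complexVec_zero, ← hdecx.sum ()]
    exact Finset.sum_eq_zero fun i hi => hall i (Finset.mem_range.1 hi)
  obtain ⟨im, him, hmax⟩ := Finset.exists_max_image (Finset.range r) (fun i => ‖lam i‖)
    ⟨j, Finset.mem_range.2 hj⟩
  obtain ⟨ix, hix, hmaxx⟩ := Finset.exists_max_image
    ((Finset.range r).filter fun i => V d i 0 ≠ 0) (fun i => ‖lam i‖)
    ⟨j, Finset.mem_filter.2 ⟨Finset.mem_range.2 hj, hj0⟩⟩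
  simp only [Finset.mem_filter, Finset.mem_range] at him hmax hix hmaxx
  -- `s` is the top level of the chains of A at the spectral radius, `t` below that of x at the
  -- largest modulus occurring in x.
  obtain ⟨s, ⟨is, his, hisn, hisV⟩, hs⟩ := exists_greatest (n := d)
    (P := fun k => ∃ i < r, ‖lam i‖ = ‖lam im‖ ∧ ∃ c : Fin d, V c i k ≠ 0)
    ⟨0, im, him, rfl, hpos im him⟩ fun k ⟨i, hi, _, c, hc⟩ => by
      by_contra! hk
      exact hc (hzero c i k hi hk)
  obtain ⟨t, ⟨i₀, hi₀, hi₀n, hi₀V⟩, ht⟩ := exists_greatest (n := d)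
    (P := fun k => ∃ i < r, ‖lam i‖ = ‖lam ix‖ ∧ V d i k ≠ 0)
    ⟨0, ix, hix.1, rfl, hix.2⟩ fun k ⟨i, hi, _, hc⟩ => by
      by_contra! hk
      exact hc (hzero d i k hi hk)
  have hsd : s < d := by
    by_contra! hk
    obtain ⟨c, hc⟩ := hisV
    exact hc (hzero c is s his hk)
  have htd : t < d := by
    by_contra! hk
    exact hi₀V (hzero d i₀ t hi₀ hk)
  have hL := leadingRoots_eq (minpoly_matrix_ne_zero A) (r := r) (lam := lam) (ρ := ‖lam im‖)
    (s := s) (fun z hz => hdec.exists_eq_of_isRoot (fun g hg => map_minpoly_dvd A hg) hz)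
    (fun i hi _ => hmax i hi) (fun i hi hn => by
      by_contra! hlt
      have := hs (s + 1) ⟨i, hi, hn, (hmult i hi (s + 1) (by omega)).1 hlt⟩
      omega) ⟨is, his, hisn, (hmult is his s (by omega)).2 hisV⟩
  have hLx := leadingRoots_eq (vecMinpoly_ne_zero A x) (r := r) (lam := lam) (ρ := ‖lam ix‖)
    (s := t) (fun z hz => hdecx.exists_eq_of_isRoot (fun g hg => map_vecMinpoly_dvd A x (hg ())) hz)
    (fun i hi hr => hmaxx i ⟨hi, (hmultx i hi 0 (Nat.succ_pos d)).1 ((rootMultiplicity_pos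
      ((Polynomial.map_ne_zero_iff (algebraMap ℚ ℂ).injective).2
        (vecMinpoly_ne_zero A x))).2 hr)⟩) (fun i hi hn => by
      by_contra! hlt
      have := ht (t + 1) ⟨i, hi, hn, (hmultx i hi (t + 1) (by omega)).1 hlt⟩
      omega) ⟨i₀, hi₀, hi₀n, (hmultx i₀ hi₀ t (by omega)).2 hi₀V⟩
  have hsub := hx.2
  rw [hL, hLx] at hsub
  -- Non-triviality enters here; it also shows that the largest modulus in x is the spectral radius.
  have hlead : ∀ i < r, ‖lam i‖ = ‖lam ix‖ → V d i t ≠ 0 →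
      ‖lam i‖ = ‖lam im‖ ∧ ∃ c : Fin d, V c i s ≠ 0 := fun i hi hn hne => by
    obtain ⟨j, hj, hji, hjn, hjs⟩ := hsub ⟨i, hi, rfl, hn, (hmultx i hi t (by omega)).2 hne⟩
    have := hdec.inj j hj i hi hji
    subst this
    exact ⟨hjn, (hmult j hj s (by omega)).1 hjs⟩
  have hρ : ‖lam ix‖ = ‖lam im‖ := hi₀n ▸ (hlead i₀ hi₀ hi₀n hi₀V).1
  have hone : ∀ i, (if ‖lam i‖ = ‖lam im‖ then 1 else 0 : ℂ) = 1 → ‖lam i‖ = ‖lam im‖ :=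
    fun i h => by
      by_contra hne
      simp [hne] at h
  refine ⟨r, t, i₀, s, lam, fun i => if ‖lam i‖ = ‖lam im‖ then 1 else 0, V,
    ⟨fun c => hdec.sum c, hdecx.sum (), fun c hc => ?_, hi₀, by omega, fun i hi => ?_,
      fun i hi hδ => ?_, hi₀V⟩, hdec.inj, hlam, hV, hroot, hsd, fun i hi hδ c => ?_,
    fun i hi hδ hne => ?_⟩
  · rcases hc.lt_or_eq with hc | rfl
    · exact hdec.chain ⟨c, hc⟩
    · exact hdecx.chain ()
  · rw [hi₀n, hρ]
    rcases (hmax i hi).lt_or_eq with h | h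
    · exact Or.inr ⟨if_neg h.ne, h⟩
    · exact Or.inl ⟨if_pos h, h⟩
  · by_contra hne
    have := ht (t + 1) ⟨i, hi, (hone i hδ).trans hρ.symm, hne⟩
    omega
  · by_contra hne
    have := hs (s + 1) ⟨i, hi, hone i hδ, c, hne⟩
    omega
  · exact (hlead i hi ((hone i hδ).trans hρ.symm) hne).2

/-! ### Real bases -/

section

variable {ι : Type*} {d : ℕ}

/-- A conjugation-invariant family of independent vectors has a real family with the same number
of elements spanning the same complex space. -/
theorem exists_real_of_star [Fintype ι] {u : ι → Fin d → ℂ} (hu : LinearIndependent ℂ u)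
    (halg : ∀ i l, IsAlgebraic ℚ (u i l)) {σ : ι → ι} (hσ : ∀ i, u (σ i) = star (u i))
    {P : ι → Prop} (hP : ∀ i, (P i ∧ σ i = i) ∨ (P i ∧ ¬ P (σ i)) ∨ (¬ P i ∧ P (σ i))) :
    ∃ w : ι → Fin d → ℂ, LinearIndependent ℂ w ∧ (∀ i l, IsAlgebraic ℚ (w i l)) ∧
      (∀ i l, (w i l).im = 0) ∧ ∀ i, u i ∈ Submodule.span ℂ (Set.range w) := by
  classical
  -- `P` picks one member of each conjugate pair: it contributes its real part, the other one its
  -- imaginary part. Self-conjugate vectors are already real.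
  let w : ι → Fin d → ℂ := fun i l => if P i then ((u i l).re : ℂ) else ((u i l).im : ℂ)
  have hmem : ∀ i, w i ∈ Submodule.span ℂ (Set.range w) := fun i =>
    Submodule.subset_span ⟨i, rfl⟩
  have hspan : ∀ i, u i ∈ Submodule.span ℂ (Set.range w) := fun i => by
    have hσ' : ∀ l, u (σ i) l = (starRingEnd ℂ) (u i l) := fun l => congrFun (hσ i) l
    rcases hP i with ⟨h1, h2⟩ | ⟨h1, h2⟩ | ⟨h1, h2⟩
    · have : u i = w i := by
        ext l
        have := hσ' l
        rw [h2] at this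
        simp only [w, if_pos h1]
        exact (Complex.conj_eq_iff_re.1 this.symm).symm
      rw [this]; exact hmem i
    · have : u i = w i + (-Complex.I) • w (σ i) := by
        ext l
        simp only [w, Pi.add_apply, Pi.smul_apply, smul_eq_mul, if_pos h1, if_neg h2, hσ']
        apply Complex.ext <;> simp
      rw [this]; exact add_mem (hmem i) (Submodule.smul_mem _ _ (hmem _))
    · have : u i = w (σ i) + Complex.I • w i := by
        ext l
        simp only [w, Pi.add_apply, Pi.smul_apply, smul_eq_mul, if_neg h1, if_pos h2, hσ']
        apply Complex.ext <;> simp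
      rw [this]; exact add_mem (hmem _) (Submodule.smul_mem _ _ (hmem _))
  refine ⟨w, ?_, fun i l => ?_, fun i l => ?_, hspan⟩
  -- The span of `w` contains that of the independent family `u`, which has the same number of
  -- elements.
  · rw [linearIndependent_iff_card_le_finrank_span, Set.finrank]
    have h1 := finrank_span_eq_card hu
    rw [← h1]
    exact Submodule.finrank_mono (Submodule.span_le.2 (Set.range_subset_iff.2 hspan))
  · have h := QSystem.isAlgebraic_re_im (halg i l)
    simp only [w]
    split_ifs
    exacts [QSystem.isAlgebraic_ofReal h.1, QSystem.isAlgebraic_ofReal h.2]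
  · simp only [w]
    split_ifs <;> simp

/-- A left inverse of the map from coefficients to combinations provides a dual family; the
algebraic retraction preserves its equations because `w` has algebraic entries. -/
theorem exists_dual [Fintype ι] [DecidableEq ι] {w : ι → Fin d → ℂ} (hw : LinearIndependent ℂ w)
    (halg : ∀ i l, IsAlgebraic ℚ (w i l)) : ∃ y : ι → Fin d → ℂ,
      (∀ i l, IsAlgebraic ℚ (y i l)) ∧ ∀ i j, y i ⬝ᵥ w j = if i = j then 1 else 0 := by
  obtain ⟨π, h1, h2, h3⟩ := exists_algebraic_retraction
  obtain ⟨g, hg⟩ := (Fintype.linearCombination ℂ w).exists_leftInverse_of_injective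
    (LinearMap.ker_eq_bot.2 (linearIndependent_iff_injective_fintypeLinearCombination.1 hw))
  refine ⟨fun i l => π (g (Pi.single l 1) i), fun i l => h1 _, fun i j => ?_⟩
  have h4 : g (w j) i = if i = j then 1 else 0 := by
    have := congrFun (LinearMap.congr_fun hg (Pi.single j 1)) i
    simpa [Fintype.linearCombination_apply_single, Pi.single_apply] using this
  rw [LinearMap.pi_apply_eq_sum_univ g (w j)] at h4
  have h5 := congrArg π h4
  rw [Finset.sum_apply, map_sum] at h5
  have e : ∀ l : Fin d, (fun m => if l = m then (1 : ℂ) else 0) = Pi.single l 1 := fun l => by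
    ext m; simp [Pi.single_apply, eq_comm (a := l)]
  simp only [Pi.smul_apply, smul_eq_mul, h3 _ _ (halg _ _), e] at h5
  rw [dotProduct]
  refine (Finset.sum_congr rfl fun l _ => mul_comm _ _).trans (h5.trans ?_)
  split_ifs
  exacts [h2 _ isAlgebraic_one, map_zero π]

theorem exists_coeffs_of_mem_span [Fintype ι] {w : ι → Fin d → ℂ} {v : Fin d → ℂ}
    (hw : ∀ i l, IsAlgebraic ℚ (w i l)) (hv : ∀ l, IsAlgebraic ℚ (v l))
    (h : v ∈ Submodule.span ℂ (Set.range w)) :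
    ∃ c : ι → ℂ, (∀ i, IsAlgebraic ℚ (c i)) ∧ v = ∑ i, c i • w i := by
  obtain ⟨π, h1, h2, h3⟩ := exists_algebraic_retraction
  obtain ⟨c, hc⟩ := (Submodule.mem_span_range_iff_exists_fun ℂ).1 h
  refine ⟨fun i => π (c i), fun i => h1 _, ?_⟩
  ext l
  have := congrArg π (congrFun hc l)
  rw [h2 _ (hv l), Finset.sum_apply, map_sum] at this
  rw [← this, Finset.sum_apply]
  refine Finset.sum_congr rfl fun i _ => ?_
  rw [Pi.smul_apply, Pi.smul_apply, smul_eq_mul, smul_eq_mul, mul_comm, h3 _ _ (hw i l), mul_comm]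

end

/-! ### Conjugation -/

section

variable {d : ℕ} {A : Matrix (Fin d) (Fin d) ℚ}

theorem complexEnd_star (v : Fin d → ℂ) : complexEnd A (star v) = star (complexEnd A v) := by
  ext l
  rw [Pi.star_apply, complexEnd_apply, complexEnd_apply, star_sum]
  refine Finset.sum_congr rfl fun m _ => ?_
  simp

theorem star_complexVec (x : Fin d → ℚ) : star (complexVec x) = complexVec x := by
  ext l
  simp [complexVec]

theorem IsJordanChain.star {lam : ℂ} {K : ℕ} {v : ℕ → Fin d → ℂ}
    (h : IsJordanChain (complexEnd A) lam K v) :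
    IsJordanChain (complexEnd A) (star lam) K (fun k => star (v k)) :=
  ⟨fun k hk => by rw [complexEnd_star, h.step k hk, star_add, star_smul],
    by rw [h.last, star_zero]⟩

/-- Uniqueness of the decomposition. -/
theorem eq_of_chains {r K : ℕ} {lam : ℕ → ℂ} (hinj : ∀ i < r, ∀ j < r, lam i = lam j → i = j)
    {E : Type*} [AddCommGroup E] [Module ℂ E] {T : Module.End ℂ E} {V V' : ℕ → ℕ → E}
    (h : ∀ i < r, IsJordanChain T (lam i) K (V i)) (h' : ∀ i < r, IsJordanChain T (lam i) K (V' i))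
    (hsum : ∑ i ∈ Finset.range r, V i 0 = ∑ i ∈ Finset.range r, V' i 0) {i k : ℕ} (hi : i < r)
    (hk : k ≤ K) : V i k = V' i k := by
  have h0 := eq_zero_of_sum_eq_zero (T := T) (s := Finset.range r) (K := K) (lam := lam)
    (w := fun i => V i 0 - V' i 0)
    (fun i hi j hj => hinj i (Finset.mem_range.1 hi) j (Finset.mem_range.1 hj)) (fun i hi => by
      rw [map_sub, (h i (Finset.mem_range.1 hi)).aeval_pow_last le_rfl,
        (h' i (Finset.mem_range.1 hi)).aeval_pow_last le_rfl, sub_zero])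
    (by rw [Finset.sum_sub_distrib, hsum, sub_self]) i (Finset.mem_range.2 hi)
  rw [← (h i hi).aeval_pow hk, ← (h' i hi).aeval_pow hk, sub_eq_zero.1 h0]

theorem aeval_star {f : ℚ[X]} {z : ℂ} (h : aeval z f = 0) : aeval (star z) f = 0 := by
  have := aeval_algHom_apply (Complex.conjAe.toAlgHom.restrictScalars ℚ) z f
  rw [h, map_zero] at this
  exact this

namespace IsSpectralData

variable {x : Fin d → ℚ} {r K t i₀ : ℕ} {lam δ : ℕ → ℂ} {V : ℕ → ℕ → ℕ → Fin d → ℂ}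

/-- Conjugation permutes the roots of the rational minimal polynomial. The decomposed vectors are
real, so by uniqueness conjugation permutes their components in the same way. -/
theorem exists_star (h : IsSpectralData A x r K t i₀ lam δ V)
    (hinj : ∀ i < r, ∀ j < r, lam i = lam j → i = j)
    (hroot : ∀ i < r, aeval (lam i) (minpoly ℚ A) = 0) : ∃ σ : ℕ → ℕ, ∀ i < r, σ i < r ∧
      lam (σ i) = star (lam i) ∧ σ (σ i) = i ∧ ∀ c ≤ d, ∀ k ≤ K, V c (σ i) k = star (V c i k) := by
  have h1 : ∀ i, ∃ j, i < r → j < r ∧ lam j = star (lam i) := fun i => by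
    by_cases hi : i < r
    · obtain ⟨j, hj⟩ := (h.isDecomposition_unit hinj).exists_eq_of_isRoot
        (fun g hg => map_minpoly_dvd A hg) (isRoot_map_iff.2 (aeval_star (hroot i hi)))
      exact ⟨j, fun _ => hj⟩
    · exact ⟨0, fun h => absurd h hi⟩
  choose σ hσ using h1
  have hσσ : ∀ i < r, σ (σ i) = i := fun i hi =>
    hinj _ (hσ _ (hσ i hi).1).1 i hi (by rw [(hσ _ (hσ i hi).1).2, (hσ i hi).2, star_star])
  refine ⟨σ, fun i hi => ⟨(hσ i hi).1, (hσ i hi).2, hσσ i hi, fun c hc k hk => ?_⟩⟩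
  have hreal : star (∑ i ∈ Finset.range r, V c i 0) = ∑ i ∈ Finset.range r, V c i 0 := by
    rcases hc.lt_or_eq with hc | rfl
    · rw [h.sum_unit ⟨c, hc⟩, star_complexVec]
    · rw [h.sum_vec, star_complexVec]
  have := eq_of_chains hinj (T := complexEnd A) (V := V c)
    (V' := fun i k => star (V c (σ i) k)) (h.chain c hc) (fun i hi => by
      have := (h.chain c hc _ (hσ i hi).1).star
      rwa [(hσ i hi).2, star_star] at this) (by
      rw [← star_sum, ← hreal]
      congr 1
      refine Finset.sum_nbij' σ σ ?_ ?_ ?_ ?_ ?_ <;> intro i hi <;>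
        simp only [Finset.mem_range] at hi ⊢
      · exact (hσ i hi).1
      · exact (hσ i hi).1
      · exact hσσ i hi
      · exact hσσ i hi
      · rw [hσσ i hi]) (hσ i hi).1 hk
  rw [this, hσσ i hi]

end IsSpectralData

end

theorem IsJordanChain.aeval_pow_apply {E : Type*} [AddCommGroup E] [Module ℂ E]
    {T : Module.End ℂ E} {lam : ℂ} {K : ℕ} {v : ℕ → E} (h : IsJordanChain T lam K v) {k : ℕ}
    (hk : k ≤ K) : aeval T ((X - C lam) ^ K) (v k) = 0 := by
  rw [← h.aeval_pow hk, aeval_aeval_comm, h.aeval_pow_last le_rfl, map_zero]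

open Classical in
/-- The indices of the leading eigenvalues. -/
noncomputable def leadingIndices (r d s : ℕ) (δ : ℕ → ℂ) (V : ℕ → ℕ → ℕ → Fin d → ℂ) : Finset ℕ :=
  (Finset.range r).filter fun i => δ i = 1 ∧ ∃ c : Fin d, V c i s ≠ 0

theorem mem_leadingIndices {r d s : ℕ} {δ : ℕ → ℂ} {V : ℕ → ℕ → ℕ → Fin d → ℂ} {i : ℕ} :
    i ∈ leadingIndices r d s δ V ↔ i < r ∧ δ i = 1 ∧ ∃ c : Fin d, V c i s ≠ 0 := by
  simp [leadingIndices]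

/-- Existence of a real algebraic basis of a space that contains all limit points and has the right
dimension. -/
theorem IsSpectralData.exists_basis {d : ℕ} {A : Matrix (Fin d) (Fin d) ℚ} {x : Fin d → ℚ}
    {r K t i₀ s : ℕ} {lam δ : ℕ → ℂ} {V : ℕ → ℕ → ℕ → Fin d → ℂ}
    (h : IsSpectralData A x r K t i₀ lam δ V) (hinj : ∀ i < r, ∀ j < r, lam i = lam j → i = j)
    (hV : ∀ c i k l, IsAlgebraic ℚ (V c i k l))
    (hroot : ∀ i < r, aeval (lam i) (minpoly ℚ A) = 0) (hs : s ≤ K)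
    (hlead : ∀ i < r, δ i = 1 → V d i t ≠ 0 → ∃ c : Fin d, V c i s ≠ 0) :
    ∃ (w y : Fin (leadingIndices r d s δ V).card → Fin d → ℂ)
      (c : ℕ → Fin (leadingIndices r d s δ V).card → ℂ),
      (∀ k l, IsAlgebraic ℚ (w k l)) ∧ (∀ k l, IsAlgebraic ℚ (y k l)) ∧
      (∀ i k, IsAlgebraic ℚ (c i k)) ∧ (∀ k l, (w k l).im = 0) ∧
      (∀ k k', y k ⬝ᵥ w k' = if k = k' then 1 else 0) ∧
      ∀ i < r, δ i • V d i t = ∑ k, c i k • w k := by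
  classical
  set I := leadingIndices r d s δ V with hI
  obtain ⟨σ, hσ⟩ := h.exists_star hinj hroot
  have hσI : ∀ i ∈ I, σ i ∈ I := fun i hi => by
    rw [mem_leadingIndices] at hi ⊢
    obtain ⟨hi, hδ, c, hc⟩ := hi
    obtain ⟨h1, h2, -, h3⟩ := hσ i hi
    refine ⟨h1, (h.eq_one_iff h1).2 ?_, c, ?_⟩
    · rw [h2, norm_star]; exact (h.eq_one_iff hi).1 hδ
    · rw [h3 c c.2.le s hs]; simpa using hc
  -- Taking the least column gives conjugate eigenvalues the same choice.
  let m : ℕ → ℕ := fun i => sInf {c | c < d ∧ V c i s ≠ 0}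
  have hm : ∀ i ∈ I, m i < d ∧ V (m i) i s ≠ 0 := fun i hi => by
    obtain ⟨-, -, c, hc⟩ := mem_leadingIndices.1 hi
    exact Nat.sInf_mem (s := {c | c < d ∧ V c i s ≠ 0}) ⟨c, c.2, hc⟩
  -- Leading eigenvalues at which x has no leading vector are filled up with another generalised
  -- eigenvector, so that the dimension is the number of leading eigenvalues.
  let u : I → Fin d → ℂ := fun i => if V d i t ≠ 0 then V d i t else V (m i) i s
  have hu0 : ∀ i, u i ≠ 0 := fun i => by
    simp only [u]
    split_ifs with h1
    exacts [h1, (hm i i.2).2]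
  have hchain : ∀ i : I, aeval (complexEnd A) ((X - C (lam i)) ^ K) (u i) = 0 := fun i => by
    have hi := (mem_leadingIndices.1 i.2).1
    simp only [u]
    split_ifs with h1
    · exact (h.chain d le_rfl i hi).aeval_pow_apply h.height_lt.le
    · exact (h.chain _ (hm i i.2).1.le i hi).aeval_pow_apply hs
  have hu : LinearIndependent ℂ u := by
    rw [Fintype.linearIndependent_iff]
    intro g hg i
    have := _root_.eq_zero_of_sum_eq_zero (T := complexEnd A) (s := Finset.univ) (K := K)
      (lam := fun i : I => lam i) (w := fun i => g i • u i)
      (fun i _ j _ hij => Subtype.ext (hinj _ (mem_leadingIndices.1 i.2).1 _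
        (mem_leadingIndices.1 j.2).1 hij)) (fun i _ => by rw [map_smul, hchain, smul_zero]) hg i
      (Finset.mem_univ i)
    exact (smul_eq_zero.1 this).resolve_right (hu0 i)
  obtain ⟨w, hw1, hw2, hw3, hw4⟩ := exists_real_of_star hu (fun i l => by
      simp only [u]; split_ifs <;> exact hV _ _ _ _)
    (σ := fun i => ⟨σ i, hσI i i.2⟩) (P := fun i => 0 ≤ (lam i).im) (fun i => by
      obtain ⟨h1, h2, -, h3⟩ := hσ i (mem_leadingIndices.1 i.2).1
      have hmσ : m (σ i) = m i := by
        simp only [m]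
        congr 1
        ext c
        exact and_congr_right fun hc => by rw [h3 c hc.le s hs, star_ne_zero]
      simp only [u, hmσ]
      rw [h3 d le_rfl t h.height_lt.le, h3 _ (hm i i.2).1.le s hs]
      by_cases h0 : V d i t = 0 <;> simp [h0]) (fun i => by
      obtain ⟨h1, h2, -, h3⟩ := hσ i (mem_leadingIndices.1 i.2).1
      have him : (lam (σ i)).im = -(lam i).im := by rw [h2]; rfl
      simp only [him]
      rcases lt_trichotomy (lam i).im 0 with h0 | h0 | h0
      · right; right; constructor <;> linarith
      · left
        refine ⟨h0.ge, Subtype.ext (hinj _ h1 _ (mem_leadingIndices.1 i.2).1 ?_)⟩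
        rw [h2]; exact Complex.conj_eq_iff_im.2 h0
      · right; left; constructor <;> linarith)
  obtain ⟨y, hy1, hy2⟩ := exists_dual hw1 hw2
  have hc : ∀ i, ∃ c : I → ℂ, (∀ k, IsAlgebraic ℚ (c k)) ∧
      (i < r → δ i • V d i t = ∑ k, c k • w k) := fun i => by
    by_cases hi : i < r ∧ δ i = 1 ∧ V d i t ≠ 0
    · obtain ⟨hi, hδ, hne⟩ := hi
      have hiI : i ∈ I := mem_leadingIndices.2 ⟨hi, hδ, hlead i hi hδ hne⟩
      obtain ⟨c, hc1, hc2⟩ := exists_coeffs_of_mem_span hw2 (fun l => hV d i t l)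
        (by simpa only [u, if_pos hne] using hw4 ⟨i, hiI⟩)
      exact ⟨c, hc1, fun _ => by rw [hδ, one_smul, hc2]⟩
    · refine ⟨0, fun k => isAlgebraic_zero, fun hir => ?_⟩
      rcases h.eq_zero_or_one hir with h0 | h1
      · simp [h0]
      · have : V d i t = 0 := by by_contra h2; exact hi ⟨hir, h1, h2⟩
        simp [this]
  choose c hc1 hc2 using hc
  refine ⟨fun k => w (I.equivFin.symm k), fun k => y (I.equivFin.symm k),
    fun i k => c i (I.equivFin.symm k), fun k => hw2 _, fun k => hy1 _, fun i k => hc1 _ _,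
    fun k => hw3 _, fun k k' => ?_, fun i hi => ?_⟩
  · rw [hy2]; simp
  · rw [hc2 i hi]
    exact (Equiv.sum_comp I.equivFin.symm fun k => c i k • w k).symm

/-! ### Existence of descriptions of algebraic numbers -/

/-- For an annihilating integer polynomial of least degree the root is simple. -/
theorem exists_aeval_derivative_ne_zero {α : ℝ} (h : IsAlgebraic ℚ α) :
    ∃ f : ℤ[X], aeval α f = 0 ∧ aeval α (derivative f) ≠ 0 := by
  classical
  have hZ : IsAlgebraic ℤ α := (IsFractionRing.isAlgebraic_iff ℤ ℚ ℝ).2 h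
  obtain ⟨g, hg0, hg⟩ := hZ
  have hex : ∃ k, ∃ f : ℤ[X], f ≠ 0 ∧ aeval α f = 0 ∧ f.natDegree = k := ⟨_, g, hg0, hg, rfl⟩
  obtain ⟨f, hf0, hf, hdeg⟩ := Nat.find_spec hex
  refine ⟨f, hf, fun hd => ?_⟩
  by_cases h0 : derivative f = 0
  · have := eq_C_of_natDegree_eq_zero (derivative_eq_zero.1 h0)
    rw [this, aeval_C] at hf
    simp only [algebraMap_int_eq, eq_intCast, Int.cast_eq_zero] at hf
    rw [this, hf, C_0] at hf0
    exact hf0 rfl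
  · have hlt : (derivative f).natDegree < f.natDegree :=
      natDegree_derivative_lt fun h1 => h0 (by rw [eq_C_of_natDegree_eq_zero h1, derivative_C])
    exact Nat.find_min hex (hdeg ▸ hlt) ⟨_, h0, hd, rfl⟩

theorem eval_hasseDeriv {R : Type*} [CommRing R] (f : R[X]) (k : ℕ) (z : R) :
    eval z (hasseDeriv k f) = ∑ i ∈ Finset.range (f.natDegree + 1),
      (i.choose k : R) * f.coeff i * z ^ (i - k) := by
  rw [hasseDeriv_apply, Polynomial.sum_over_range _ (by simp), eval_finsetSum]
  simp

/-- `scaleRoots f M` is M^D f(X / M), D being the degree, so its j-th Taylor coefficient at n is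
M^(D-j) times that of f at n / M: for large M the linear coefficient wins over the higher ones. -/
theorem coeff_taylor_scaleRoots (f : ℤ[X]) (n : ℤ) {M : ℕ} (hM : 0 < M) (j : ℕ) :
    (((taylor n (scaleRoots f M)).coeff j : ℤ) : ℝ) * M ^ j =
      M ^ f.natDegree * aeval ((n : ℝ) / M) (hasseDeriv j f) := by
  have hM' : (M : ℝ) ≠ 0 := by exact_mod_cast hM.ne'
  rw [taylor_coeff, eval_hasseDeriv, aeval_def, eval₂_eq_eval_map, hasseDeriv_apply]
  rw [Polynomial.sum_over_range _ (by simp), Polynomial.map_sum, eval_finsetSum,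
    natDegree_scaleRoots, Int.cast_sum, Finset.sum_mul, Finset.mul_sum]
  refine Finset.sum_congr rfl fun i hi => ?_
  rw [coeff_scaleRoots, map_monomial, eval_monomial]
  rcases lt_or_ge i j with hij | hij
  · simp [Nat.choose_eq_zero_of_lt hij]
  · have e1 : (M : ℝ) ^ f.natDegree = M ^ (f.natDegree - i) * M ^ (i - j) * M ^ j := by
      rw [← pow_add, ← pow_add]
      congr 1
      rw [Finset.mem_range] at hi
      omega
    rw [div_pow, e1]
    push_cast
    field_simp
    simp only [eq_intCast]
    ring

theorem tendsto_floor_div (α : ℝ) :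
    Filter.Tendsto (fun M : ℕ => (⌊M * α⌋ : ℝ) / M) Filter.atTop (nhds α) := by
  have h1 : Filter.Tendsto (fun M : ℕ => (1 : ℝ) / M) Filter.atTop (nhds 0) :=
    tendsto_const_div_atTop_nhds_zero_nat 1
  rw [tendsto_iff_norm_sub_tendsto_zero]
  refine squeeze_zero' (Filter.Eventually.of_forall fun _ => norm_nonneg _) ?_ h1
  filter_upwards [Filter.eventually_gt_atTop 0] with M hM
  have hM' : (0 : ℝ) < M := by exact_mod_cast hM
  have e : (⌊M * α⌋ : ℝ) / M - α = (⌊M * α⌋ - M * α) / M := by field_simp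
  rw [e, norm_div, Real.norm_natCast]
  refine div_le_div_of_nonneg_right ?_ hM'.le
  rw [Real.norm_eq_abs, abs_le]
  constructor <;> linarith [Int.floor_le (M * α), Int.lt_floor_add_one (M * α)]

namespace QSystem

/-- Large multiples of an algebraic number have a description. -/
theorem eventually_exists_nearCode {α : ℝ} (h : IsAlgebraic ℚ α) :
    ∀ᶠ M : ℕ in Filter.atTop, ∃ c : NearCode, dominated c.2 = true ∧ |M * α - c.1| ≤ 1 ∧
      aeval (M * α - c.1 : ℝ) (polyOfCoeffs c.2) = 0 := by
  obtain ⟨f, hf, hf'⟩ := exists_aeval_derivative_ne_zero h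
  set D := f.natDegree with hD
  let F : ℕ → ℕ → ℝ := fun j M => aeval ((⌊M * α⌋ : ℝ) / M) (hasseDeriv j f)
  have hF : ∀ j, Filter.Tendsto (F j) Filter.atTop (nhds (aeval α (hasseDeriv j f))) := fun j =>
    ((Polynomial.continuous_aeval (hasseDeriv j f)).tendsto α).comp (tendsto_floor_div α)
  -- The root α is simple, so this grows without bound, while the weighted sum of the higher
  -- coefficients converges; this yields domination.
  have hF1 : Filter.Tendsto (fun M : ℕ => M * |F 1 M|) Filter.atTop Filter.atTop := by
    refine Filter.Tendsto.atTop_mul_pos (abs_pos.2 hf') tendsto_natCast_atTop_atTop ?_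
    have := (hF 1).abs
    rwa [hasseDeriv_one] at this
  have hS := tendsto_finsetSum (Finset.range (D + 1)) fun j _ =>
    ((hF (j + 2)).abs.const_mul ((j + 2 : ℝ) * 2 ^ (j + 1)))
  filter_upwards [hF1.eventually_gt_atTop (∑ j ∈ Finset.range (D + 1),
      ((j + 2 : ℝ) * 2 ^ (j + 1)) * |aeval α (hasseDeriv (j + 2) f)| + 1),
    hS.eventually (gt_mem_nhds (lt_add_one _)), Filter.eventually_gt_atTop 0] with M h1 h2 hM
  have hlt := h2.trans h1
  set n := ⌊M * α⌋ with hn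
  set q := taylor n (scaleRoots f M) with hq
  let l : List ℤ := (List.range (D + 1)).map q.coeff
  have hqdeg : q.natDegree = D := by rw [hq, natDegree_taylor, natDegree_scaleRoots]
  have hl : ∀ j, l.getD j 0 = q.coeff j := fun j => by
    simp only [l]
    rw [getD_map_range]
    split_ifs with hj
    · rfl
    · rw [coeff_eq_zero_of_natDegree_lt (by omega)]
  have hpoly : polyOfCoeffs l = q := by
    ext j; rw [coeff_polyOfCoeffs, hl]
  have hM0 : (0 : ℝ) < M := by exact_mod_cast hM
  have hM1 : (1 : ℝ) ≤ M := by exact_mod_cast hM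
  have hcoeff := fun j => coeff_taylor_scaleRoots f n hM j
  refine ⟨(n, l), ?_, ?_, ?_⟩
  · rw [dominated, decide_eq_true_eq, sum_map_range]
    have hlen : l.length = D + 1 := by simp [l]
    rw [hlen]
    simp only [hl]
    have hb : ∀ j, |(q.coeff (j + 2) : ℝ)| * M ^ 2 ≤ M ^ D * |F (j + 2) M| := fun j => by
      have := congrArg abs (hcoeff (j + 2))
      rw [abs_mul, abs_mul, abs_of_pos (pow_pos hM0 _), abs_of_pos (pow_pos hM0 _)] at this
      calc |(q.coeff (j + 2) : ℝ)| * M ^ 2 ≤ |(q.coeff (j + 2) : ℝ)| * M ^ (j + 2) := by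
            refine mul_le_mul_of_nonneg_left (pow_le_pow_right₀ hM1 ?_) (abs_nonneg _)
            omega
        _ = _ := this
    have h1' : |(q.coeff 1 : ℝ)| * M = M ^ D * |F 1 M| := by
      have := congrArg abs (hcoeff 1)
      rw [abs_mul, abs_mul, abs_of_pos (pow_pos hM0 _), abs_of_pos (pow_pos hM0 _), pow_one] at this
      exact this
    have key : ((∑ j ∈ Finset.range (D + 1),
        (j + 2) * (q.coeff (j + 2)).natAbs * 2 ^ (j + 1) : ℕ) : ℝ) * M ^ 2 <
        ((q.coeff 1).natAbs : ℝ) * M ^ 2 := by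
      rw [Nat.cast_sum, Finset.sum_mul]
      calc _ ≤ ∑ j ∈ Finset.range (D + 1), M ^ D * (((j + 2 : ℝ) * 2 ^ (j + 1)) * |F (j + 2) M|) := by
            refine Finset.sum_le_sum fun j _ => ?_
            push_cast
            rw [Nat.cast_natAbs, Int.cast_abs]
            calc _ = ((j + 2 : ℝ) * 2 ^ (j + 1)) * (|(q.coeff (j + 2) : ℝ)| * M ^ 2) := by ring
              _ ≤ ((j + 2 : ℝ) * 2 ^ (j + 1)) * (M ^ D * |F (j + 2) M|) := by
                  exact mul_le_mul_of_nonneg_left (hb j) (by positivity)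
              _ = _ := by ring
        _ = M ^ D * ∑ j ∈ Finset.range (D + 1), ((j + 2 : ℝ) * 2 ^ (j + 1)) * |F (j + 2) M| := by
            rw [Finset.mul_sum]
        _ < M ^ D * (M * |F 1 M|) := by gcongr
        _ = _ := by
            rw [Nat.cast_natAbs, Int.cast_abs]
            linear_combination -(M : ℝ) * h1'
    exact_mod_cast lt_of_mul_lt_mul_right key (by positivity)
  · rw [abs_le]
    constructor <;> linarith [Int.floor_le (M * α), Int.lt_floor_add_one (M * α)]
  · rw [hpoly, hq]
    have e1 : aeval (M * α - n : ℝ) (taylor n (scaleRoots f M)) =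
        aeval (M * α : ℝ) (scaleRoots f M) := by
      rw [taylor_apply, aeval_comp]
      simp
    have e2 := scaleRoots_aeval_eq_zero (r := (M : ℤ)) hf
    rw [e1, ← e2]
    simp
-- Algebraic solutions of the systems
theorem isAlgebraic_sqrt {x : ℝ} (h : IsAlgebraic ℚ x) : IsAlgebraic ℚ (√x) := by
  rcases le_total 0 x with hx | hx
  · exact IsAlgebraic.of_pow two_pos (by rwa [Real.sq_sqrt hx])
  · rw [Real.sqrt_eq_zero_of_nonpos hx]; exact isAlgebraic_zero

theorem isAlgebraic_norm_sq {z : ℂ} (h : IsAlgebraic ℚ z) : IsAlgebraic ℚ (‖z‖ ^ 2) := by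
  rw [Complex.sq_norm, Complex.normSq_apply]
  have := isAlgebraic_re_im h
  exact (this.1.mul this.1).add (this.2.mul this.2)

/-- Extension of a vector by zero. -/
noncomputable def extend {d : ℕ} (v : Fin d → ℂ) (l : ℕ) : ℂ := if h : l < d then v ⟨l, h⟩ else 0

theorem extend_apply {d : ℕ} (v : Fin d → ℂ) (l : Fin d) : extend v l = v l := dif_pos l.2

theorem isAlgebraic_extend {d : ℕ} {v : Fin d → ℂ} (h : ∀ l, IsAlgebraic ℚ (v l)) (l : ℕ) :
    IsAlgebraic ℚ (extend v l) := by
  unfold extend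
  split_ifs
  exacts [h _, isAlgebraic_zero]

/-- The values of the unknowns of `baseSystem`. -/
noncomputable def baseAssignment {d : ℕ} (A : Matrix (Fin d) (Fin d) ℚ) (x : Fin d → ℚ) (r : ℕ)
    (lam δ : ℕ → ℂ) (V : ℕ → ℕ → ℕ → Fin d → ℂ) (g : ℕ → ℝ) (y : Fin d → ℂ) : List ℕ → ℂ
  | [] => 1
  | [0, i] => if i < r then lam i else 0
  | [1, c, i, k, l] => extend (V c i k) l
  | [2, l, m] => if h : l < d then extend (complexVec (A ⟨l, h⟩)) m else 0
  | [3, c, l] => if h : c < d then extend (complexVec (Pi.single ⟨c, h⟩ 1)) l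
      else extend (complexVec x) l
  | [4, i] => if i < r then g i else 0
  | [5, i] => if i < r then (g i : ℂ)⁻¹ else 0
  | [6, i] => if i < r then δ i else 0
  | [7, l] => extend y l
  | _ => 0

theorem isAlgebraic_complexVec {d : ℕ} (x : Fin d → ℚ) (l : Fin d) :
    IsAlgebraic ℚ (complexVec x l) := isAlgebraic_algebraMap (x l)

theorem isAlgebraic_baseAssignment {d : ℕ} (A : Matrix (Fin d) (Fin d) ℚ) (x : Fin d → ℚ) {r : ℕ}
    {lam δ : ℕ → ℂ} {V : ℕ → ℕ → ℕ → Fin d → ℂ} {g : ℕ → ℝ} {y : Fin d → ℂ}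
    (hlam : ∀ i < r, IsAlgebraic ℚ (lam i)) (hδ : ∀ i < r, IsAlgebraic ℚ (δ i))
    (hV : ∀ c i k l, IsAlgebraic ℚ (V c i k l)) (hg : ∀ i < r, IsAlgebraic ℚ (g i))
    (hy : ∀ l, IsAlgebraic ℚ (y l)) (v : List ℕ) :
    IsAlgebraic ℚ (baseAssignment A x r lam δ V g y v) := by
  unfold baseAssignment
  split
  · exact isAlgebraic_one
  · split_ifs with h
    exacts [hlam _ h, isAlgebraic_zero]
  · exact isAlgebraic_extend (hV _ _ _) _
  · split_ifs
    exacts [isAlgebraic_extend (isAlgebraic_complexVec _) _, isAlgebraic_zero]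
  · split_ifs
    exacts [isAlgebraic_extend (isAlgebraic_complexVec _) _,
      isAlgebraic_extend (isAlgebraic_complexVec _) _]
  · split_ifs with h
    exacts [isAlgebraic_ofReal (hg _ h), isAlgebraic_zero]
  · split_ifs with h
    exacts [(isAlgebraic_ofReal (hg _ h)).inv, isAlgebraic_zero]
  · split_ifs with h
    exacts [hδ _ h, isAlgebraic_zero]
  · exact isAlgebraic_extend hy _
  · exact isAlgebraic_zero

theorem holds_baseAssignment {d : ℕ} {A : Matrix (Fin d) (Fin d) ℚ} {x : Fin d → ℚ}
    {r K t i₀ : ℕ} {lam δ : ℕ → ℂ} {V : ℕ → ℕ → ℕ → Fin d → ℂ} {g : ℕ → ℝ} {y : Fin d → ℂ}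
    (h : IsSpectralData A x r K t i₀ lam δ V)
    (hg : ∀ i < r, ‖lam i‖ ^ 2 + g i ^ 2 = ‖lam i₀‖ ^ 2) (hy : V d i₀ t ⬝ᵥ y = 1) :
    Holds (baseAssignment A x r lam δ V g y)
      (baseSystem (rowsCode A) (vecCode x) r K t i₀) := by
  set a := baseAssignment A x r lam δ V g y
  have ha : a [] = 1 := rfl
  have h1 : ∀ c i k, vec a d [1, c, i, k] = V c i k := fun c i k =>
    funext fun l => extend_apply _ _
  have h0 : ∀ i < r, a [0, i] = lam i := fun i hi => if_pos hi
  have h4 : ∀ i < r, a [4, i] = g i := fun i hi => if_pos hi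
  have h5 : ∀ i < r, a [5, i] = (g i : ℂ)⁻¹ := fun i hi => if_pos hi
  have h6 : ∀ i < r, a [6, i] = δ i := fun i hi => if_pos hi
  have h7 : vec a d [7] = y := funext fun l => extend_apply _ _
  have h2 : mat a d = A.map (algebraMap ℚ ℂ) := by
    ext l m
    exact (dif_pos l.2).trans (extend_apply _ _)
  have h3 : ∀ c : Fin d, vec a d [3, c] = complexVec (Pi.single c 1) := fun c =>
    funext fun l => (dif_pos c.2).trans (extend_apply _ _)
  have h3' : vec a d [3, d] = complexVec x :=
    funext fun l => (dif_neg (lt_irrefl d)).trans (extend_apply _ _)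
  rw [holds_baseSystem ha, holds_chainEqs ha, holds_modulusEqs ha, holds_heightEqs ha]
  refine ⟨h2, h3', h3, ⟨fun c hc => ?_, fun c hc i hi k hk => ?_, fun c hc i hi => ?_⟩,
    fun i hi => ?_, ⟨fun i hi => ?_, ?_⟩, h.index_lt, h.height_lt⟩
  · simp only [h1]
    rcases hc.lt_or_eq with hc | rfl
    · rw [h3 ⟨c, hc⟩]; exact h.sum_unit ⟨c, hc⟩
    · rw [h3']; exact h.sum_vec
  · rw [h1, h1, h0 i hi, h2, ← (h.chain c hc i hi).step k hk, complexEnd, Matrix.toLin'_apply]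
  · rw [h1]; exact (h.chain c hc i hi).last
  · rw [h0 i hi, h4 i hi, h5 i hi, h6 i hi, h0 _ h.index_lt, Complex.norm_real, Real.norm_eq_abs,
      sq_abs]
    refine ⟨hg i hi, ?_⟩
    have hgi := hg i hi
    rcases h.dominating i hi with ⟨hδ, hn⟩ | ⟨hδ, hn⟩
    · have : g i = 0 := by
        rw [hn] at hgi
        simpa using hgi
      simp [hδ, this]
    · have : (g i : ℂ) ≠ 0 := fun h0 => by
        have h0 : g i = 0 := by exact_mod_cast h0
        rw [h0] at hgi
        nlinarith [norm_nonneg (lam i)]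
      exact ⟨Or.inl hδ, by rw [hδ, mul_inv_cancel₀ this, zero_add]⟩
  · rw [h1, h6 i hi]
    rcases h.eq_zero_or_one hi with hδ | hδ
    · rw [hδ, zero_smul]
    · rw [h.height i hi hδ, smul_zero]
  · rw [h1, h7, hy]

theorem exists_dotProduct_eq_one {d : ℕ} {v : Fin d → ℂ} (hv : v ≠ 0)
    (halg : ∀ l, IsAlgebraic ℚ (v l)) :
    ∃ y : Fin d → ℂ, (∀ l, IsAlgebraic ℚ (y l)) ∧ v ⬝ᵥ y = 1 := by
  obtain ⟨l, hl⟩ := Function.ne_iff.1 hv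
  refine ⟨Pi.single l (v l)⁻¹, fun m => ?_, ?_⟩
  · rw [Pi.single_apply]
    split_ifs
    exacts [(halg l).inv, isAlgebraic_zero]
  · rw [dotProduct_single, mul_inv_cancel₀ hl]

/-- A solution of `baseSystem`. -/
theorem exists_baseAssignment {d : ℕ} {A : Matrix (Fin d) (Fin d) ℚ} {x : Fin d → ℚ}
    {r K t i₀ : ℕ} {lam δ : ℕ → ℂ} {V : ℕ → ℕ → ℕ → Fin d → ℂ}
    (h : IsSpectralData A x r K t i₀ lam δ V) (hlam : ∀ i < r, IsAlgebraic ℚ (lam i))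
    (hV : ∀ c i k l, IsAlgebraic ℚ (V c i k l)) : ∃ a : List ℕ → ℂ,
      Solves a (baseSystem (rowsCode A) (vecCode x) r K t i₀) ∧ (∀ i < r, a [0, i] = lam i) ∧
      (∀ i < r, a [6, i] = δ i) ∧ ∀ c i k, vec a d [1, c, i, k] = V c i k := by
  obtain ⟨y, hy1, hy2⟩ := exists_dotProduct_eq_one h.ne_zero (hV d i₀ t)
  refine ⟨baseAssignment A x r lam δ V (fun i => √(‖lam i₀‖ ^ 2 - ‖lam i‖ ^ 2)) y,
    ⟨rfl, isAlgebraic_baseAssignment A x hlam (fun i hi => ?_) hV (fun i hi => ?_) hy1,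
      holds_baseAssignment h (fun i hi => ?_) hy2⟩, fun i hi => if_pos hi, fun i hi => if_pos hi,
    fun c i k => funext fun l => extend_apply _ _⟩
  · rcases h.eq_zero_or_one hi with hδ | hδ <;> rw [hδ]
    exacts [isAlgebraic_zero, isAlgebraic_one]
  · exact isAlgebraic_sqrt ((isAlgebraic_norm_sq (hlam _ h.index_lt)).sub
      (isAlgebraic_norm_sq (hlam i hi)))
  · rw [Real.sq_sqrt]
    · ring
    · exact sub_nonneg.2 (pow_le_pow_left₀ (norm_nonneg _) (h.norm_le hi) 2)

/-- The base system uses only `[]` and unknowns with tags below 8, so a solution may be extended by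
redefining the other tags. -/
theorem holds_baseSystem_congr {a b : List ℕ → ℂ} (ha : a [] = 1) (hb : b [] = 1)
    (hab : ∀ n < 8, ∀ v, b (n :: v) = a (n :: v)) {d : ℕ} {A : Matrix (Fin d) (Fin d) ℚ}
    {x : Fin d → ℚ} {r K t i₀ : ℕ} :
    Holds b (baseSystem (rowsCode A) (vecCode x) r K t i₀) ↔
      Holds a (baseSystem (rowsCode A) (vecCode x) r K t i₀) := by
  have hvec : ∀ n < 8, ∀ v, vec b d (n :: v) = vec a d (n :: v) := fun n hn v =>
    funext fun l => hab n hn _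
  have hmat : mat b d = mat a d := by
    ext l m; exact hab 2 (by norm_num) _
  rw [holds_baseSystem ha, holds_baseSystem hb, holds_chainEqs ha, holds_modulusEqs ha,
    holds_heightEqs ha, holds_chainEqs hb, holds_modulusEqs hb, holds_heightEqs hb]
  simp only [hmat, hvec 1 (by norm_num), hvec 3 (by norm_num), hvec 7 (by norm_num),
    hab 0 (by norm_num), hab 4 (by norm_num), hab 5 (by norm_num), hab 6 (by norm_num)]

/-- The values of the unknowns of `limitSystem`. -/
noncomputable def limitAssignment (a : List ℕ → ℂ) (I : Finset ℕ) {d : ℕ}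
    (z : ℕ → ℕ → Fin d → ℂ) (w y : ℕ → Fin d → ℂ) (c : ℕ → ℕ → ℂ) (N : ℕ → ℕ → ℤ) : List ℕ → ℂ
  | [8, i, j] => (a [0, i] - a [0, j])⁻¹
  | [9, i] => if i ∈ I then 1 else 0
  | [10, i, c, l] => extend (z i c) l
  | [11, k, l] => extend (w k) l
  | [12, k, l] => extend (y k) l
  | [13, i, k] => c i k
  | [14, k, l, j] => (extend (w k) l - N k l) ^ j
  | [15, k, l] => (√(1 - ((extend (w k) l).re - N k l) ^ 2) : ℝ)
  | v => a v

theorem isAlgebraic_limitAssignment {a : List ℕ → ℂ} (ha : ∀ v, IsAlgebraic ℚ (a v)) (I : Finset ℕ)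
    {d : ℕ} {z : ℕ → ℕ → Fin d → ℂ} {w y : ℕ → Fin d → ℂ} {c : ℕ → ℕ → ℂ} (N : ℕ → ℕ → ℤ)
    (hz : ∀ i c l, IsAlgebraic ℚ (z i c l)) (hw : ∀ k l, IsAlgebraic ℚ (w k l))
    (hy : ∀ k l, IsAlgebraic ℚ (y k l)) (hc : ∀ i k, IsAlgebraic ℚ (c i k)) (v : List ℕ) :
    IsAlgebraic ℚ (limitAssignment a I z w y c N v) := by
  unfold limitAssignment
  split
  · exact ((ha _).sub (ha _)).inv
  · split_ifs
    exacts [isAlgebraic_one, isAlgebraic_zero]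
  · exact isAlgebraic_extend (hz _ _) _
  · exact isAlgebraic_extend (hw _) _
  · exact isAlgebraic_extend (hy _) _
  · exact hc _ _
  · exact ((isAlgebraic_extend (hw _) _).sub (isAlgebraic_intCast _)).pow _
  · exact isAlgebraic_ofReal (isAlgebraic_sqrt (isAlgebraic_one.sub
      (((isAlgebraic_re_im (isAlgebraic_extend (hw _) _)).1.sub (isAlgebraic_intCast _)).pow 2)))
  · exact ha _

/-- The first algorithm halts for non-trivial starting points. -/
theorem exists_solves_limitSystem {d : ℕ} {A : Matrix (Fin d) (Fin d) ℚ} {x : Fin d → ℚ}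
    (hx : NonTrivial A x) : ∃ r K t i₀ s codes a,
      Solves a (limitSystem (rowsCode A) (vecCode x) r K t i₀ s codes) := by
  classical
  obtain ⟨r, t, i₀, s, lam, δ, V, h, hinj, hlam, hV, hroot, hsd, hsV, hlead⟩ :=
    exists_isSpectralData hx
  obtain ⟨a, ⟨ha1, haalg, hahold⟩, ha0, ha6, haV⟩ := exists_baseAssignment h hlam hV
  have hbasis := h.exists_basis hinj hV hroot (by omega) hlead
  have hmem : ∀ i, i ∈ leadingIndices r d s δ V ↔ i < r ∧ δ i = 1 ∧ ∃ c : Fin d, V c i s ≠ 0 :=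
    fun i => mem_leadingIndices
  generalize leadingIndices r d s δ V = I at hbasis hmem
  obtain ⟨w₀, y₀, c₀, hw₀, hy₀, hc₀, hreal₀, hdual₀, hcomb₀⟩ := hbasis
  have hz : ∀ i, ∃ z : ℕ → Fin d → ℂ, (∀ c l, IsAlgebraic ℚ (z c l)) ∧
      ∑ c ∈ Finset.range d, V c i s ⬝ᵥ z c = if i ∈ I then 1 else 0 := fun i => by
    by_cases hi : i ∈ I
    · obtain ⟨-, -, c, hc⟩ := (hmem i).1 hi
      obtain ⟨y, hy1, hy2⟩ := exists_dotProduct_eq_one hc (hV c i s)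
      refine ⟨fun c' => if c' = c then y else 0, fun c' l => ?_, ?_⟩
      · dsimp only
        split_ifs
        exacts [hy1 l, isAlgebraic_zero]
      · rw [if_pos hi, Finset.sum_eq_single_of_mem (c : ℕ) (Finset.mem_range.2 c.2)]
        · simp only [if_pos, hy2]
        · intro c' _ hne
          simp only [if_neg hne, dotProduct_zero]
    · exact ⟨fun _ => 0, fun _ _ => isAlgebraic_zero, by simp [hi]⟩
  choose z hz1 hz2 using hz
  -- One multiplier serves all entries. Scaling the basis by M leaves its span unchanged; the dual
  -- family and the coefficients are divided by M.
  obtain ⟨M, hM, hM0⟩ := ((Filter.eventually_all.2 fun k : Fin I.card => Filter.eventually_all.2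
    fun l : Fin d => eventually_exists_nearCode (isAlgebraic_re_im (hw₀ k l)).1).and
      (Filter.eventually_gt_atTop 0)).exists
  choose code hcode1 hcode2 hcode3 using hM
  have hM0' : (M : ℂ) ≠ 0 := by exact_mod_cast hM0.ne'
  have hMalg : IsAlgebraic ℚ (M : ℂ) := isAlgebraic_natCast M
  let codes : List (List NearCode) := List.ofFn fun k => List.ofFn fun l => code k l
  have hcodes : codes.length = I.card := by simp [codes]
  let w : ℕ → Fin d → ℂ := fun k => if hk : k < I.card then (M : ℂ) • w₀ ⟨k, hk⟩ else 0
  let y : ℕ → Fin d → ℂ := fun k => if hk : k < I.card then (M : ℂ)⁻¹ • y₀ ⟨k, hk⟩ else 0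
  let c : ℕ → ℕ → ℂ := fun i k => if hk : k < I.card then (M : ℂ)⁻¹ * c₀ i ⟨k, hk⟩ else 0
  have hw' : ∀ k : Fin I.card, w k = (M : ℂ) • w₀ k := fun k => dif_pos k.2
  have hy' : ∀ k : Fin I.card, y k = (M : ℂ)⁻¹ • y₀ k := fun k => dif_pos k.2
  have hc' : ∀ i (k : Fin I.card), c i k = (M : ℂ)⁻¹ * c₀ i k := fun i k => dif_pos k.2
  let N : ℕ → ℕ → ℤ := fun k l => ((codes.getD k []).getD l (0, [])).1
  set b := limitAssignment a I z w y c N with hb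
  have hb1 : b [] = 1 := ha1
  have hcongr : ∀ n < 8, ∀ v, b (n :: v) = a (n :: v) := fun n hn v => by
    interval_cases n <;> rfl
  have hb0 : ∀ i < r, b [0, i] = lam i := fun i hi => (hcongr 0 (by norm_num) _).trans (ha0 i hi)
  have hb6 : ∀ i < r, b [6, i] = δ i := fun i hi => (hcongr 6 (by norm_num) _).trans (ha6 i hi)
  have hbV : ∀ c i k, vec b d [1, c, i, k] = V c i k := fun c i k =>
    (funext fun _ => hcongr 1 (by norm_num) _ : vec b d [1, c, i, k] = vec a d [1, c, i, k]).trans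
      (haV c i k)
  have hb9 : ∀ i, b [9, i] = if i ∈ I then 1 else 0 := fun i => rfl
  have hb11 : ∀ k, vec b d [11, k] = w k := fun k => funext fun l => extend_apply _ _
  have hb12 : ∀ k, vec b d [12, k] = y k := fun k => funext fun l => extend_apply _ _
  have hb10 : ∀ i c, vec b d [10, i, c] = z i c := fun i c => funext fun l => extend_apply _ _
  have hwreal : ∀ k l, (w k l).im = 0 := fun k l => by
    simp only [w]
    split_ifs with hk
    · simp [hreal₀]
    · simp
  refine ⟨r, d + 1, t, i₀, s, codes, b, hb1, isAlgebraic_limitAssignment haalg I N hz1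
    (fun k l => ?_) (fun k l => ?_) (fun i k => ?_), (holds_limitSystem hb1).2
    ⟨(holds_baseSystem_congr ha1 hb1 hcongr).2 hahold, by omega, ?_, ?_, fun k hk => ⟨?_, ?_⟩⟩⟩
  · simp only [w]
    split_ifs
    exacts [hMalg.mul (hw₀ _ _), isAlgebraic_zero]
  · simp only [y]
    split_ifs
    exacts [hMalg.inv.mul (hy₀ _ _), isAlgebraic_zero]
  · simp only [c]
    split_ifs
    exacts [hMalg.inv.mul (hc₀ _ _), isAlgebraic_zero]
  · rw [holds_leadingEqs hb1, hcodes]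
    refine ⟨fun i hi j hj => ?_, fun c hc i hi => ?_, fun i hi => ?_, ?_⟩
    · have e : b [8, i, j] = (a [0, i] - a [0, j])⁻¹ := rfl
      rw [e, hcongr 0 (by norm_num), hcongr 0 (by norm_num), ha0 i hi, ha0 j hj]
      split_ifs with hij
      · rw [hij, sub_self, zero_mul]
      · exact mul_inv_cancel₀ (sub_ne_zero.2 fun h => hij (hinj i hi j hj h))
    · rw [hb6 i hi, hb9, hbV, hbV]
      rcases h.eq_zero_or_one hi with hδ | hδ
      · have : i ∉ I := fun hiI => by
          have := ((hmem i).1 hiI).2.1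
          simp [hδ] at this
        simp [hδ, this]
      · refine ⟨by rw [hsV i hi hδ ⟨c, hc⟩, smul_zero], ?_⟩
        by_cases hiI : i ∈ I
        · simp [hδ, hiI]
        · have : V c i s = 0 := by
            by_contra hne
            exact hiI ((hmem i).2 ⟨hi, hδ, ⟨c, hc⟩, hne⟩)
          rw [this, smul_zero]
    · rw [hb6 i hi, hb9]
      simp only [hbV, hb10]
      refine ⟨by simp, ?_, hz2 i⟩
      by_cases hiI : i ∈ I
      · rw [((hmem i).1 hiI).2.1, mul_one]
      · simp [hiI]
    · simp only [hb9]
      rw [Finset.sum_ite_mem, Finset.inter_eq_right.2 fun i hi =>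
        Finset.mem_range.2 ((hmem i).1 hi).1]
      simp
  · rw [holds_basisEqs hb1, hcodes]
    refine ⟨fun k hk k' hk' => ?_, fun k hk l => ?_, fun i hi => ?_⟩
    · rw [hb11, hb12, hw' ⟨k', hk'⟩, hy' ⟨k, hk⟩, smul_dotProduct, dotProduct_smul, hdual₀]
      simp [hM0']
    · rw [hb11]
      exact (Complex.conj_eq_iff_im.2 (hwreal k l)).symm
    · rw [hb6 i hi, hbV, hcomb₀ i hi, Finset.sum_range]
      refine Finset.sum_congr rfl fun k _ => ?_
      have e : b [13, i, k] = c i k := rfl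
      rw [hb11, e, hw', hc', smul_smul, mul_comm, ← mul_assoc, mul_inv_cancel₀ hM0', one_mul]
  · rw [hcodes] at hk
    simp [codes, hk]
  · intro l hl
    rw [hcodes] at hk
    have hN : (codes.getD k []).getD l (0, []) = code ⟨k, hk⟩ ⟨l, hl⟩ := by
      simp [codes, hk, hl]
    have hwk : b [11, k, l] = ((M * (w₀ ⟨k, hk⟩ ⟨l, hl⟩).re : ℝ) : ℂ) := by
      have : b [11, k, l] = w k ⟨l, hl⟩ := dif_pos hl
      rw [this]
      apply Complex.ext
      · rw [hw' ⟨k, hk⟩]; simp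
      · rw [hwreal]; simp
    have hP : ∀ j, b [14, k, l, j] = (b [11, k, l] - (code ⟨k, hk⟩ ⟨l, hl⟩).1) ^ j := fun j => by
      rw [← hN]; rfl
    have hS : b [15, k, l] = (√(1 - ((b [11, k, l]).re - (code ⟨k, hk⟩ ⟨l, hl⟩).1) ^ 2) : ℝ) := by
      rw [← hN]; rfl
    have h2 := hcode2 ⟨k, hk⟩ ⟨l, hl⟩
    have h3 := hcode3 ⟨k, hk⟩ ⟨l, hl⟩
    rw [hN, holds_nearEqs hb1]
    refine ⟨⟨by rw [hP, pow_zero], fun j _ => by rw [hP, hP, pow_succ], ?_, ?_⟩, hcode1 _ _⟩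
    · simp only [hP]
      rw [← aeval_polyOfCoeffs _ _ le_rfl, hwk]
      have := congrArg (algebraMap ℝ ℂ) h3
      rw [← aeval_algebraMap_apply, map_zero] at this
      simpa using this
    · rw [hS, hwk, Complex.norm_real, Complex.ofReal_re, Real.norm_eq_abs,
        abs_of_nonneg (Real.sqrt_nonneg _)]
      have h4 : (0 : ℝ) ≤ 1 - (M * (w₀ ⟨k, hk⟩ ⟨l, hl⟩).re - (code ⟨k, hk⟩ ⟨l, hl⟩).1) ^ 2 := by
        rw [sub_nonneg, sq_le_one_iff_abs_le_one]; exact h2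
      have h5 := Real.sq_sqrt h4
      rw [← Complex.ofReal_pow, h5]
      push_cast
      ring

/-! ### The orbit meets the subspace -/

section

variable {a : List ℕ → ℂ} {d k : ℕ} {A : Matrix (Fin d) (Fin d) ℚ} {x : Fin d → ℚ}
  {u : Fin k → Fin d → ℚ}

theorem vec_orbit (ha : a [] = 1) {N : ℕ} (hA : mat a d = A.map (algebraMap ℚ ℂ))
    (hx : vec a d [3, d] = complexVec x) (h : Holds a (orbitEqs d N)) {n : ℕ} (hn : n ≤ N) :
    vec a d [23, n] = complexVec ((A ^ n).mulVec x) := by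
  obtain ⟨h0, h1⟩ := (holds_orbitEqs ha d N).1 h
  induction n with
  | zero => rw [h0, hx, pow_zero, Matrix.one_mulVec]
  | succ n ih =>
    rw [← h1 n (by omega), ih (by omega), hA, ← Matrix.toLin'_apply]
    refine (complexEnd_complexVec A _).trans ?_
    rw [Matrix.mulVec_mulVec, ← pow_succ']

theorem holds_orbitEqs_of_eq (ha : a [] = 1) {N : ℕ} (hA : mat a d = A.map (algebraMap ℚ ℂ))
    (hx : vec a d [3, d] = complexVec x)
    (h : ∀ n, vec a d [23, n] = complexVec ((A ^ n).mulVec x)) : Holds a (orbitEqs d N) := by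
  refine (holds_orbitEqs ha d N).2 ⟨by rw [h, hx, pow_zero, Matrix.one_mulVec], fun n _ => ?_⟩
  rw [h, h, hA, ← Matrix.toLin'_apply]
  refine (complexEnd_complexVec A _).trans ?_
  rw [Matrix.mulVec_mulVec, ← pow_succ']

/-- A ℚ-linear retraction of ℂ onto ℚ turns the complex coefficients into rational ones. -/
theorem mem_span_of_complex {v : Fin d → ℚ} {c : Fin k → ℂ}
    (h : complexVec v = ∑ j, c j • complexVec (u j)) : v ∈ Submodule.span ℚ (Set.range u) := by
  obtain ⟨π, hπ⟩ := (Algebra.linearMap ℚ ℂ).exists_leftInverse_of_injective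
    (LinearMap.ker_eq_bot.2 (algebraMap ℚ ℂ).injective)
  refine (Submodule.mem_span_range_iff_exists_fun ℚ).2 ⟨fun j => π (c j), ?_⟩
  ext l
  have h1 := congrArg π (congrFun h l)
  have h2 : π (complexVec v l) = v l := LinearMap.congr_fun hπ (v l)
  rw [h2, Finset.sum_apply, map_sum] at h1
  rw [h1, Finset.sum_apply]
  refine Finset.sum_congr rfl fun j _ => ?_
  have : (c j • complexVec (u j)) l = u j l • c j := by
    rw [Pi.smul_apply, smul_eq_mul, mul_comm, Rat.smul_def]; rfl
  rw [this, map_smul, Pi.smul_apply, smul_eq_mul, smul_eq_mul, mul_comm]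

theorem complexVec_sum (c : Fin k → ℚ) :
    complexVec (∑ j, c j • u j) = ∑ j, (c j : ℂ) • complexVec (u j) := by
  ext l
  simp [complexVec]

theorem holds_hitSystem (ha : a [] = 1) (n : ℕ) :
    Holds a (hitSystem (rowsCode A) (vecCode x) (rowsCode u) n) ↔
      mat a d = A.map (algebraMap ℚ ℂ) ∧ vec a d [3, d] = complexVec x ∧
      (∀ j : Fin k, vec a d [16, j] = complexVec (u j)) ∧ Holds a (orbitEqs d n) ∧
      ∑ j ∈ Finset.range k, a [24, j] • vec a d [16, j] = vec a d [23, n] := by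
  unfold hitSystem
  simp only [holds_append, length_vecCode, length_rowsCode, holds_constRows_matrix ha,
    holds_constRow_vecCode ha, holds_constRows_rowsCode ha, holds_combinationEqs ha, and_assoc]
  rfl

theorem mem_span_of_hitSystem (ha : a [] = 1) {n : ℕ}
    (h : Holds a (hitSystem (rowsCode A) (vecCode x) (rowsCode u) n)) :
    (A ^ n).mulVec x ∈ Submodule.span ℚ (Set.range u) := by
  obtain ⟨h1, h2, h3, h4, h5⟩ := (holds_hitSystem ha n).1 h
  refine mem_span_of_complex (c := fun j => a [24, (j : ℕ)]) ?_
  rw [← vec_orbit ha h1 h2 h4 le_rfl, ← h5, Finset.sum_range]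
  exact Finset.sum_congr rfl fun j _ => by rw [h3]

/-- The values of the unknowns of `hitSystem`. -/
noncomputable def hitAssignment (A : Matrix (Fin d) (Fin d) ℚ) (x : Fin d → ℚ)
    (u : Fin k → Fin d → ℚ) (c : Fin k → ℚ) : List ℕ → ℂ
  | [] => 1
  | [2, l, m] => if h : l < d then extend (complexVec (A ⟨l, h⟩)) m else 0
  | [3, _, l] => extend (complexVec x) l
  | [16, j, l] => if h : j < k then extend (complexVec (u ⟨j, h⟩)) l else 0
  | [23, n, l] => extend (complexVec ((A ^ n).mulVec x)) l
  | [24, j] => extend (complexVec c) j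
  | _ => 0

theorem exists_solves_hitSystem {n : ℕ}
    (h : (A ^ n).mulVec x ∈ Submodule.span ℚ (Set.range u)) :
    ∃ a, Solves a (hitSystem (rowsCode A) (vecCode x) (rowsCode u) n) := by
  obtain ⟨c, hc⟩ := (Submodule.mem_span_range_iff_exists_fun ℚ).1 h
  have hext : ∀ {d : ℕ} (v : Fin d → ℚ) l, IsAlgebraic ℚ (extend (complexVec v) l) :=
    fun v => isAlgebraic_extend (isAlgebraic_complexVec v)
  have ha : hitAssignment A x u c [] = 1 := rfl
  refine ⟨hitAssignment A x u c, ha, fun v => ?_, (holds_hitSystem ha n).2 ?_⟩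
  · unfold hitAssignment
    split
    · exact isAlgebraic_one
    · split_ifs
      exacts [hext _ _, isAlgebraic_zero]
    · exact hext _ _
    · split_ifs
      exacts [hext _ _, isAlgebraic_zero]
    · exact hext _ _
    · exact hext _ _
    · exact isAlgebraic_zero
  · have hA : mat (hitAssignment A x u c) d = A.map (algebraMap ℚ ℂ) := by
      ext l m
      exact (dif_pos l.2).trans (extend_apply _ _)
    have hx : vec (hitAssignment A x u c) d [3, d] = complexVec x :=
      funext fun l => extend_apply _ _
    have hu : ∀ j : Fin k, vec (hitAssignment A x u c) d [16, j] = complexVec (u j) := fun j =>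
      funext fun l => (dif_pos j.2).trans (extend_apply _ _)
    have ho : ∀ n, vec (hitAssignment A x u c) d [23, n] = complexVec ((A ^ n).mulVec x) :=
      fun n => funext fun l => extend_apply _ _
    have hcj : ∀ j : Fin k, hitAssignment A x u c [24, j] = c j := fun j => extend_apply _ _
    refine ⟨hA, hx, hu, holds_orbitEqs_of_eq ha hA hx ho, ?_⟩
    rw [ho, ← hc, complexVec_sum, Finset.sum_range]
    exact Finset.sum_congr rfl fun j _ => by rw [hu, hcj]

/-! ### The orbit misses the subspace -/

theorem holds_missSystem (ha : a [] = 1) {r K t i₀ h : ℕ} :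
    Holds a (missSystem (rowsCode A) (vecCode x) (rowsCode u) r K t i₀ h) ↔
      Holds a (baseSystem (rowsCode A) (vecCode x) r K t i₀) ∧
      (∀ j : Fin k, vec a d [16, j] = complexVec (u j)) ∧
      Holds a (orbitEqs d (escapeIndex r K h)) ∧ Holds a (functionalEqs d r K t i₀ k) ∧
      Holds a (boundEqs r K i₀ h) ∧ Holds a (separationEqs d (escapeIndex r K h) k) := by
  unfold missSystem
  simp only [holds_append, length_vecCode, length_rowsCode, holds_constRows_rowsCode ha, and_assoc]
  rfl

theorem dotProduct_eq_zero_of_mem {v : Fin d → ℚ} (h : v ∈ Submodule.span ℚ (Set.range u))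
    {φ : Fin d → ℂ} (hφ : ∀ j, φ ⬝ᵥ complexVec (u j) = 0) : φ ⬝ᵥ complexVec v = 0 := by
  obtain ⟨c, rfl⟩ := (Submodule.mem_span_range_iff_exists_fun ℚ).1 h
  rw [complexVec_sum, dotProduct_sum]
  exact Finset.sum_eq_zero fun j _ => by rw [dotProduct_smul, hφ, smul_zero]

/-- Before the escape index each point has its own separating form. From then on the form `[17]`
vanishes on U, whereas its leading value on the orbit has modulus C(n,t) ρ^(n-t), which the
remaining terms cannot cancel. -/
theorem notMem_span_of_missSystem (ha : a [] = 1) {r K t i₀ h : ℕ}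
    (hm : Holds a (missSystem (rowsCode A) (vecCode x) (rowsCode u) r K t i₀ h)) (n : ℕ) :
    (A ^ n).mulVec x ∉ Submodule.span ℚ (Set.range u) := by
  obtain ⟨hb, hu, ho, hf, hbd, hs⟩ := (holds_missSystem ha).1 hm
  intro hmem
  have hd := isSpectralData ha hb
  obtain ⟨hA, hx, -, -, hmod, -, -, -⟩ := (holds_baseSystem ha _ _ _ _ _ _).1 hb
  rw [holds_modulusEqs ha] at hmod
  rcases lt_or_ge n (escapeIndex r K h) with hn | hn
  · obtain ⟨h1, h2⟩ := (holds_separationEqs ha _ _ _).1 hs n hn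
    rw [vec_orbit ha hA hx ho hn.le, dotProduct_eq_zero_of_mem hmem fun j => by
      rw [← hu j]; exact h2 j j.2] at h1
    exact zero_ne_one h1
  · obtain ⟨f1, f2, f3⟩ := (holds_functionalEqs ha _ _ _ _ _ _).1 hf
    obtain ⟨b1, b2, b3, b4⟩ := (holds_boundEqs ha _ _ _ _).1 hbd
    have h0 : vec a d [17] ⬝ᵥ complexVec ((A ^ n).mulVec x) = 0 :=
      dotProduct_eq_zero_of_mem hmem fun j => by rw [← hu j]; exact f1 j j.2
    have hh : (0 : ℝ) ≤ h := Nat.cast_nonneg h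
    have hρ : 0 < ‖a [0, i₀]‖ := by
      refine (norm_nonneg _).lt_of_ne fun h0 => ?_
      rw [← h0] at b3
      nlinarith [sq_nonneg ‖a [21]‖]
    have hρ1 : 1 ≤ h * ‖a [0, i₀]‖ ^ 2 := by nlinarith [sq_nonneg ‖a [21]‖]
    have hρ2 : ‖a [0, i₀]‖ ^ 2 ≤ h := by nlinarith [sq_nonneg ‖a [22]‖]
    have hh1 : (1 : ℝ) ≤ h := by nlinarith
    have hw : ∀ i < r, ∀ k < K, ‖a [18, i, k]‖ ≤ h := fun i hi k hk => by
      have := b1 i hi k hk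
      refine le_of_sq_le_sq ?_ hh
      nlinarith [sq_nonneg ‖a [19, i, k]‖]
    have hnK : 2 * K ≤ n := by unfold escapeIndex at hn; omega
    have key := norm_sub_leading_mul_le (lam := fun i => a [0, i]) (δ := fun i => a [6, i])
      (w := fun i k => a [18, i, k]) hρ hρ1 hρ2 hd.height_lt hw (fun i hi => by
        rcases hd.dominating i hi with ⟨h1, h2⟩ | ⟨h1, h2⟩
        · refine Or.inl ⟨h1, h2, fun k hk htk => ?_⟩
          rw [← f2 i hi k hk]
          have : vec a d [1, d, i, k] = 0 := hd.eq_zero_of_lt hi h1 hk htk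
          rw [this, dotProduct_zero]
        · refine Or.inr ⟨h1, ?_⟩
          have e1 := b2 i hi
          have h1 : a [6, i] = 0 := h1
          rw [h1, add_zero] at e1
          have e2 : (h : ℝ) * ‖a [4, i]‖ ^ 2 = 1 + ‖a [20, i]‖ ^ 2 := by exact_mod_cast e1
          have e3 := (hmod i hi).1
          have e4 : ‖a [0, i₀]‖ ^ 2 - ‖a [0, i]‖ ^ 2 = ‖a [4, i]‖ ^ 2 := by linarith
          rw [e4, e2]
          nlinarith [sq_nonneg ‖a [20, i]‖]) hnK
    have hsum : ∑ i ∈ Finset.range r, ∑ k ∈ Finset.range K,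
        ((n.choose k : ℂ) * a [0, i] ^ (n - k)) • a [18, i, k] = 0 := by
      rw [← h0, hd.pow_apply, dotProduct_sum]
      refine Finset.sum_congr rfl fun i hi => ?_
      rw [dotProduct_sum]
      refine Finset.sum_congr rfl fun k hk => ?_
      rw [dotProduct_smul, f2 i (Finset.mem_range.1 hi) k (Finset.mem_range.1 hk)]
    have hlead : ∑ i ∈ Finset.range r, ((n.choose t : ℂ) * a [0, i] ^ (n - t)) •
        a [6, i] • a [18, i, t] = (n.choose t : ℂ) * a [0, i₀] ^ (n - t) := by
      rw [Finset.sum_eq_single_of_mem i₀ (Finset.mem_range.2 hd.index_lt)]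
      · rw [smul_eq_mul (a [6, i₀]), f3 i₀ hd.index_lt, if_pos rfl, smul_eq_mul, mul_one]
      · intro i hi hne
        rw [smul_eq_mul (a [6, i]), f3 i (Finset.mem_range.1 hi), if_neg hne, smul_zero]
    -- If the form vanishes on the n-th point, the error equals the leading term in size, and `key`
    -- bounds n - 2K by a number that `escapeIndex` exceeds.
    rw [hsum, hlead, zero_sub, norm_neg, norm_mul, norm_pow, Complex.norm_natCast, mul_comm] at key
    have hM : 0 < (n.choose t : ℝ) * ‖a [0, i₀]‖ ^ (n - t) :=
      mul_pos (by exact_mod_cast Nat.choose_pos (by have := hd.height_lt; omega)) (by positivity)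
    have h1 := le_of_mul_le_mul_right key hM
    have h2 : n - 2 * K ≤ r * K * h * ratioBound K h := by exact_mod_cast h1
    unfold escapeIndex at hn
    omega

end

/-! ### Existence of certificates for a miss -/

section

variable {d k : ℕ} {A : Matrix (Fin d) (Fin d) ℚ} {x : Fin d → ℚ} {u : Fin k → Fin d → ℚ}

/-- A linear form given by a vector with rational entries that separates a vector from a
subspace. -/
theorem exists_separating {v : Fin d → ℚ} (hv : v ∉ Submodule.span ℚ (Set.range u)) :
    ∃ ψ : Fin d → ℚ, complexVec ψ ⬝ᵥ complexVec v = 1 ∧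
      ∀ j, complexVec ψ ⬝ᵥ complexVec (u j) = 0 := by
  obtain ⟨f, hf, hker⟩ := Submodule.exists_le_ker_of_notMem hv
  have hdot : ∀ w : Fin d → ℚ, complexVec (fun l => (f v)⁻¹ * f (Pi.single l 1)) ⬝ᵥ complexVec w =
      (((f v)⁻¹ * f w : ℚ) : ℂ) := fun w => by
    rw [LinearMap.pi_apply_eq_sum_univ f w, dotProduct, Finset.mul_sum]
    push_cast
    refine Finset.sum_congr rfl fun l _ => ?_
    have e : (fun m => if l = m then (1 : ℚ) else 0) = Pi.single l 1 := by
      ext m; simp [Pi.single_apply, eq_comm (a := l)]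
    rw [e]
    simp only [complexVec, smul_eq_mul]
    push_cast
    ring
  refine ⟨fun l => (f v)⁻¹ * f (Pi.single l 1), ?_, fun j => ?_⟩
  · rw [hdot, inv_mul_cancel₀ hf, Rat.cast_one]
  · have : f (u j) = 0 := hker (Submodule.subset_span ⟨j, rfl⟩)
    rw [hdot, this, mul_zero, Rat.cast_zero]

theorem reVec_sum_mem_realSpan (c : Fin k → ℂ) :
    reVec (∑ j, c j • complexVec (u j)) ∈ realSpan u := by
  have : reVec (∑ j, c j • complexVec (u j)) = ∑ j, (c j).re • realVec (u j) := by
    ext l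
    have e : reVec (∑ j, c j • complexVec (u j)) l = ((∑ j, c j • complexVec (u j)) l).re := rfl
    rw [e, Finset.sum_apply, Complex.re_sum, WithLp.ofLp_sum, Finset.sum_apply]
    refine Finset.sum_congr rfl fun j _ => ?_
    simp [complexVec, realVec]
  rw [this]
  exact Submodule.sum_mem _ fun j _ =>
    Submodule.smul_mem _ _ (Submodule.subset_span ⟨j, rfl⟩)

theorem eq_zero_of_reVec {v : Fin d → ℂ} (h1 : reVec v = 0) (h2 : reVec ((-Complex.I) • v) = 0) :
    v = 0 := by
  ext l
  have e1 : (v l).re = 0 := congrArg (fun w : EuclideanSpace ℝ (Fin d) => w l) h1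
  have e2 : (((-Complex.I) • v) l).re = 0 := congrArg (fun w : EuclideanSpace ℝ (Fin d) => w l) h2
  rw [Pi.smul_apply, smul_eq_mul] at e2
  exact Complex.ext e1 (by simpa using e2)

/-- A linear form with algebraic coefficients that vanishes on the subspace and on all leading
vectors but one. -/
theorem exists_functional {r K t i₀ : ℕ} {lam δ : ℕ → ℂ} {V : ℕ → ℕ → ℕ → Fin d → ℂ}
    (h : IsSpectralData A x r K t i₀ lam δ V) (hinj : ∀ i < r, ∀ j < r, lam i = lam j → i = j)
    (halg : ∀ i < r, ∀ l, IsAlgebraic ℚ ((δ i • V d i t) l))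
    {W : Submodule ℝ (EuclideanSpace ℝ (Fin d))}
    (hW : ∀ m : ℕ → ℂ, reVec (∑ i ∈ Finset.range r, m i • δ i • V d i t) ∈ W)
    (hWu : W ⊓ realSpan u = ⊥) : ∃ φ : Fin d → ℂ, (∀ l, IsAlgebraic ℚ (φ l)) ∧
      (∀ j, φ ⬝ᵥ complexVec (u j) = 0) ∧
      ∀ i < r, φ ⬝ᵥ (δ i • V d i t) = if i = i₀ then 1 else 0 := by
  -- The hypothesis on W and U is about real spaces. It is applied to the real parts of the relation
  -- and of its multiple by -i, hence to the real and imaginary parts of the common vector.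
  have hindep : ∀ (m : ℕ → ℂ) (c : Fin k → ℂ), ∑ i ∈ Finset.range r, m i • δ i • V d i t =
      ∑ j, c j • complexVec (u j) → m i₀ = 0 := fun m c hmc => by
    have hre : ∀ (m : ℕ → ℂ) (c : Fin k → ℂ), ∑ i ∈ Finset.range r, m i • δ i • V d i t =
        ∑ j, c j • complexVec (u j) → reVec (∑ i ∈ Finset.range r, m i • δ i • V d i t) = 0 :=
      fun m c hmc => by
        have : reVec (∑ i ∈ Finset.range r, m i • δ i • V d i t) ∈ W ⊓ realSpan u :=
          ⟨hW m, by rw [hmc]; exact reVec_sum_mem_realSpan c⟩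
        rwa [hWu, Submodule.mem_bot] at this
    refine h.coeff_eq_zero hinj (m := m) (eq_zero_of_reVec (hre m c hmc) ?_)
    have h2 := hre (fun i => -Complex.I * m i) (fun j => -Complex.I * c j) (by
      simp only [mul_smul (-Complex.I), ← Finset.smul_sum]
      rw [hmc])
    simpa only [mul_smul (-Complex.I), ← Finset.smul_sum] using h2
  obtain ⟨φ, hφ, hker⟩ := exists_linearForm h.index_lt (f := fun i => δ i • V d i t)
    (U := Submodule.span ℂ (Set.range fun j => complexVec (u j))) fun m hm => by
      obtain ⟨c, hc⟩ := (Submodule.mem_span_range_iff_exists_fun ℂ).1 hm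
      exact hindep m c hc.symm
  obtain ⟨π, h1, h2, h3⟩ := exists_algebraic_retraction
  have hdot : ∀ w : Fin d → ℂ, (∀ l, IsAlgebraic ℚ (w l)) →
      (fun l => π (φ (Pi.single l 1))) ⬝ᵥ w = π (φ w) :=
    fun w hw => by
      rw [LinearMap.pi_apply_eq_sum_univ φ w, dotProduct, map_sum]
      refine Finset.sum_congr rfl fun l _ => ?_
      have e : (fun m => if l = m then (1 : ℂ) else 0) = Pi.single l 1 := by
        ext m; simp [Pi.single_apply, eq_comm (a := l)]
      rw [e, smul_eq_mul, h3 _ _ (hw l), mul_comm]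
  refine ⟨fun l => π (φ (Pi.single l 1)), fun l => h1 _, fun j => ?_,
    fun i hi => ?_⟩
  · rw [hdot _ (isAlgebraic_complexVec _), hker _ (Submodule.subset_span ⟨j, rfl⟩), map_zero]
  · rw [hdot _ (halg i hi), hφ i hi]
    split_ifs
    exacts [h2 _ isAlgebraic_one, map_zero π]

/-- The values of the unknowns of `missSystem`. -/
noncomputable def missAssignment (a : List ℕ → ℂ) (A : Matrix (Fin d) (Fin d) ℚ) (x : Fin d → ℚ)
    (u : Fin k → Fin d → ℚ) (i₀ h : ℕ) (φ : Fin d → ℂ) (ψ : ℕ → Fin d → ℚ) : List ℕ → ℂ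
  | [16, j, l] => if h : j < k then extend (complexVec (u ⟨j, h⟩)) l else 0
  | [17, l] => extend φ l
  | [18, i, k] => φ ⬝ᵥ vec a d [1, d, i, k]
  | [19, i, k] => (√(h - ‖φ ⬝ᵥ vec a d [1, d, i, k]‖ ^ 2) : ℝ)
  | [20, i] => (√(h * ‖a [4, i]‖ ^ 2 + (a [6, i]).re - 1) : ℝ)
  | [21] => (√(h * ‖a [0, i₀]‖ ^ 2 - 1) : ℝ)
  | [22] => (√(h - ‖a [0, i₀]‖ ^ 2) : ℝ)
  | [23, n, l] => extend (complexVec ((A ^ n).mulVec x)) l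
  | [24, n, l] => extend (complexVec (ψ n)) l
  | v => a v

theorem isAlgebraic_dotProduct {v w : Fin d → ℂ} (hv : ∀ l, IsAlgebraic ℚ (v l))
    (hw : ∀ l, IsAlgebraic ℚ (w l)) : IsAlgebraic ℚ (v ⬝ᵥ w) :=
  isAlgebraic_sum fun l _ => (hv l).mul (hw l)

theorem isAlgebraic_missAssignment {a : List ℕ → ℂ} (ha : ∀ v, IsAlgebraic ℚ (a v))
    (A : Matrix (Fin d) (Fin d) ℚ) (x : Fin d → ℚ) (u : Fin k → Fin d → ℚ) (i₀ h : ℕ)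
    {φ : Fin d → ℂ} (hφ : ∀ l, IsAlgebraic ℚ (φ l)) (ψ : ℕ → Fin d → ℚ) (v : List ℕ) :
    IsAlgebraic ℚ (missAssignment a A x u i₀ h φ ψ v) := by
  have hext : ∀ {d : ℕ} (v : Fin d → ℚ) l, IsAlgebraic ℚ (extend (complexVec v) l) :=
    fun v => isAlgebraic_extend (isAlgebraic_complexVec v)
  have hsqrt : ∀ {y : ℝ}, IsAlgebraic ℚ y → IsAlgebraic ℚ ((√y : ℝ) : ℂ) := fun hy =>
    isAlgebraic_ofReal (isAlgebraic_sqrt hy)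
  have hz : ∀ i k, IsAlgebraic ℚ (φ ⬝ᵥ vec a d [1, d, i, k]) := fun i k =>
    isAlgebraic_dotProduct hφ fun l => ha _
  have hh : IsAlgebraic ℚ (h : ℝ) := isAlgebraic_natCast h
  unfold missAssignment
  split
  · split_ifs
    exacts [hext _ _, isAlgebraic_zero]
  · exact isAlgebraic_extend hφ _
  · exact hz _ _
  · exact hsqrt (hh.sub (isAlgebraic_norm_sq (hz _ _)))
  · exact hsqrt (((hh.mul (isAlgebraic_norm_sq (ha _))).add (isAlgebraic_re_im (ha _)).1).sub
      isAlgebraic_one)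
  · exact hsqrt ((hh.mul (isAlgebraic_norm_sq (ha _))).sub isAlgebraic_one)
  · exact hsqrt (hh.sub (isAlgebraic_norm_sq (ha _)))
  · exact hext _ _
  · exact hext _ _
  · exact ha _

/-- If the orbit misses the subspace, this is certified by a solution of `missSystem`. -/
theorem exists_solves_missSystem {a : List ℕ → ℂ} (ha : a [] = 1) (haalg : ∀ v, IsAlgebraic ℚ (a v))
    {r K t i₀ : ℕ} (hb : Holds a (baseSystem (rowsCode A) (vecCode x) r K t i₀))
    (hinj : ∀ i < r, ∀ j < r, a [0, i] = a [0, j] → i = j) (h0 : a [0, i₀] ≠ 0)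
    {W : Submodule ℝ (EuclideanSpace ℝ (Fin d))}
    (hW : ∀ m : ℕ → ℂ,
      reVec (∑ i ∈ Finset.range r, m i • a [6, i] • vec a d [1, d, i, t]) ∈ W)
    (hWu : W ⊓ realSpan u = ⊥)
    (hmiss : ∀ n, (A ^ n).mulVec x ∉ Submodule.span ℚ (Set.range u)) :
    ∃ h b, Solves b (missSystem (rowsCode A) (vecCode x) (rowsCode u) r K t i₀ h) := by
  have hd := isSpectralData ha hb
  obtain ⟨hA, hx, -, -, hmod, -, -, -⟩ := (holds_baseSystem ha _ _ _ _ _ _).1 hb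
  rw [holds_modulusEqs ha] at hmod
  obtain ⟨φ, hφ1, hφ2, hφ3⟩ := exists_functional hd hinj (fun i _ l => (haalg _).mul (haalg _)) hW hWu
  choose ψ hψ1 hψ2 using fun n => exists_separating (hmiss n)
  -- All requirements on h hold for large h; they are what makes the radicands of the slack unknowns
  -- non-negative.
  obtain ⟨h, ⟨hh1, hh2, hh3⟩, hh4⟩ := ((eventually_bounds (norm_pos_iff.2 h0) (fun i => a [0, i])
    (fun i => a [6, i]) fun i hi hδ => ((hd.dominating i hi).resolve_left fun h1 => by
      have h2 : a [6, i] = 1 := h1.1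
      rw [hδ] at h2
      exact zero_ne_one h2).2).and (tendsto_natCast_atTop_atTop.eventually_ge_atTop
        (∑ i ∈ Finset.range r, ∑ k ∈ Finset.range K,
          ‖φ ⬝ᵥ vec a d [1, d, i, k]‖ ^ 2))).exists
  have hz : ∀ i < r, ∀ k < K, ‖φ ⬝ᵥ vec a d [1, d, i, k]‖ ^ 2 ≤ h := fun i hi k hk =>
    ((Finset.single_le_sum (f := fun k => ‖φ ⬝ᵥ vec a d [1, d, i, k]‖ ^ 2)
      (fun _ _ => by positivity) (Finset.mem_range.2 hk)).trans (Finset.single_le_sum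
        (f := fun i => ∑ k ∈ Finset.range K, ‖φ ⬝ᵥ vec a d [1, d, i, k]‖ ^ 2)
        (fun _ _ => Finset.sum_nonneg fun _ _ => by positivity) (Finset.mem_range.2 hi))).trans hh4
  set b := missAssignment a A x u i₀ h φ ψ with hb'
  have hb1 : b [] = 1 := ha
  have hcongr : ∀ n < 8, ∀ v, b (n :: v) = a (n :: v) := fun n hn v => by
    interval_cases n <;> rfl
  have hvec : ∀ n < 8, ∀ v, vec b d (n :: v) = vec a d (n :: v) := fun n hn v =>
    funext fun l => hcongr n hn _
  have hbA : mat b d = A.map (algebraMap ℚ ℂ) := by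
    rw [← hA]
    ext l m; exact hcongr 2 (by norm_num) _
  have hbx : vec b d [3, d] = complexVec x := by rw [hvec 3 (by norm_num), hx]
  have h16 : ∀ j : Fin k, vec b d [16, j] = complexVec (u j) := fun j =>
    funext fun l => (dif_pos j.2).trans (extend_apply _ _)
  have h17 : vec b d [17] = φ := funext fun l => extend_apply _ _
  have h23 : ∀ n, vec b d [23, n] = complexVec ((A ^ n).mulVec x) :=
    fun n => funext fun l => extend_apply _ _
  have h24 : ∀ n, vec b d [24, n] = complexVec (ψ n) := fun n => funext fun l => extend_apply _ _
  have hsqrt : ∀ y : ℝ, 0 ≤ y → ‖((√y : ℝ) : ℂ)‖ ^ 2 = y := fun y hy => by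
    rw [Complex.norm_real, Real.norm_eq_abs, sq_abs, Real.sq_sqrt hy]
  refine ⟨h, b, hb1, isAlgebraic_missAssignment haalg A x u i₀ h hφ1 ψ, (holds_missSystem hb1).2
    ⟨(holds_baseSystem_congr ha hb1 hcongr).2 hb, h16, holds_orbitEqs_of_eq hb1 hbA hbx h23,
      (holds_functionalEqs hb1 _ _ _ _ _ _).2 ⟨fun j hj => ?_, fun i hi k hk => ?_,
        fun i hi => ?_⟩, (holds_boundEqs hb1 _ _ _ _).2 ⟨fun i hi k hk => ?_, fun i hi => ?_,
          ?_, ?_⟩, (holds_separationEqs hb1 _ _ _).2 fun n hn => ⟨?_, fun j hj => ?_⟩⟩⟩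
  · rw [h17, h16 ⟨j, hj⟩, hφ2]
  · rw [h17, hvec 1 (by norm_num)]; rfl
  · rw [← hφ3 i hi, dotProduct_smul, hcongr 6 (by norm_num)]; rfl
  · have e18 : b [18, i, k] = φ ⬝ᵥ vec a d [1, d, i, k] := rfl
    have e19 : b [19, i, k] = (√(h - ‖φ ⬝ᵥ vec a d [1, d, i, k]‖ ^ 2) : ℝ) := rfl
    rw [e18, e19, hsqrt _ (sub_nonneg.2 (hz i hi k hk))]
    ring
  · have e20 : b [20, i] = (√(h * ‖a [4, i]‖ ^ 2 + (a [6, i]).re - 1) : ℝ) := rfl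
    obtain ⟨m1, m2, m3⟩ := hmod i hi
    have hre : a [6, i] = ((a [6, i]).re : ℂ) ∧ 0 ≤ h * ‖a [4, i]‖ ^ 2 + (a [6, i]).re - 1 := by
      rcases hd.eq_zero_or_one hi with hδ | hδ <;> have hδ : a [6, i] = _ := hδ
      · have := hh3 i hi hδ
        have e : ‖a [0, i₀]‖ ^ 2 - ‖a [0, i]‖ ^ 2 = ‖a [4, i]‖ ^ 2 := by linarith
        rw [e] at this
        rw [hδ]
        simp only [Complex.zero_re, Complex.ofReal_zero, true_and]
        linarith
      · rw [hδ]
        simp only [Complex.one_re, Complex.ofReal_one, true_and]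
        have : (0 : ℝ) ≤ h * ‖a [4, i]‖ ^ 2 := by positivity
        linarith
    rw [hcongr 4 (by norm_num), hcongr 6 (by norm_num), e20, ← Complex.ofReal_pow ‖(_ : ℂ)‖ 2,
      ← Complex.ofReal_pow ‖((√_ : ℝ) : ℂ)‖ 2, hsqrt _ hre.2]
    conv_lhs => rw [hre.1]
    push_cast
    ring
  · have e21 : b [21] = (√(h * ‖a [0, i₀]‖ ^ 2 - 1) : ℝ) := rfl
    rw [hcongr 0 (by norm_num), e21, hsqrt _ (sub_nonneg.2 hh1)]
    ring
  · have e22 : b [22] = (√(h - ‖a [0, i₀]‖ ^ 2) : ℝ) := rfl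
    rw [hcongr 0 (by norm_num), e22, hsqrt _ (sub_nonneg.2 hh2)]
    ring
  · rw [h23, h24, hψ1]
  · rw [h24, h16 ⟨j, hj⟩, hψ2]

end

end QSystem

/-! ### Unbounded search for certificates -/

section
variable {α β γ : Type*} [Primcodable β]

/-- Search for the first `b` that passes the test; the output is computed from it. -/
def certifiedSearch (test : α → β → Bool) (out : β → γ) (a : α) : Part γ :=
  Nat.rfindOpt fun n => (Encodable.decode n : Option β).bind fun b =>
    if test a b = true then some (out b) else none

theorem partrec_certifiedSearch [Primcodable α] [Primcodable γ] {test : α → β → Bool}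
    {out : β → γ} (ht : Primrec fun p : α × β => test p.1 p.2) (ho : Primrec out) :
    Partrec (certifiedSearch test out) := by
  refine Partrec.rfindOpt (Primrec.to_comp ?_)
  refine Primrec.option_bind (Primrec.decode.comp Primrec.snd) ?_
  refine Primrec.ite (Primrec.eq.comp
    (ht.comp (Primrec.pair (Primrec.fst.comp Primrec.fst) Primrec.snd)) (Primrec.const true)) ?_
    (Primrec.const none)
  exact Primrec.option_some.comp (ho.comp Primrec.snd)

theorem exists_of_mem_certifiedSearch {test : α → β → Bool} {out : β → γ} {a : α} {c : γ}
    (h : c ∈ certifiedSearch test out a) : ∃ b, test a b = true ∧ out b = c := by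
  obtain ⟨n, hn⟩ := Nat.rfindOpt_spec h
  obtain ⟨b, -, hb⟩ := Option.bind_eq_some_iff.1 (Option.mem_def.1 hn)
  by_cases ht : test a b = true
  · rw [if_pos ht] at hb
    exact ⟨b, ht, Option.some_injective _ hb⟩
  · simp [ht] at hb

theorem exists_mem_certifiedSearch {test : α → β → Bool} {out : β → γ} {a : α} {b : β}
    (h : test a b = true) : ∃ c, c ∈ certifiedSearch test out a := by
  refine Part.dom_iff_mem.1 (Nat.rfindOpt_dom.2 ⟨Encodable.encode b, out b, ?_⟩)
  simp [h]

end

namespace QSystem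

/-! ### The two algorithms -/

/-- The data to be guessed in the computation of the limit subspace. -/
abbrev LimitData := (ℕ × ℕ × ℕ × ℕ × ℕ × List (List NearCode)) × Cert

/-- Verification of the data for the limit subspace. -/
def checkLimit (input : List (List RatCode) × List RatCode) (g : LimitData) : Bool :=
  check (limitSystem input.1 input.2 g.1.1 g.1.2.1 g.1.2.2.1 g.1.2.2.2.1 g.1.2.2.2.2.1
    g.1.2.2.2.2.2) g.2

/-- The computation of the limit subspace. -/
def limitAlgorithm : List (List RatCode) × List RatCode →. List (List AlgCode) :=
  certifiedSearch checkLimit fun g => g.1.2.2.2.2.2.map (List.map algCode)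

theorem partrec_limitAlgorithm : Partrec limitAlgorithm := by
  refine partrec_certifiedSearch ?_ (by fun_prop)
  unfold checkLimit
  fun_prop

/-- The data to be guessed by the decision procedure: the answer and a justification of it. -/
abbrev DecisionData := Bool × (ℕ × ℕ × ℕ × ℕ × ℕ) × Cert

/-- Verification of the data for the decision procedure. -/
def checkDecision (input : List (List RatCode) × List RatCode × List (List RatCode))
    (g : DecisionData) : Bool :=
  check (bif g.1 then hitSystem input.1 input.2.1 input.2.2 g.2.1.1
    else missSystem input.1 input.2.1 input.2.2 g.2.1.1 g.2.1.2.1 g.2.1.2.2.1 g.2.1.2.2.2.1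
      g.2.1.2.2.2.2) g.2.2

/-- The decision procedure for the question whether the orbit meets a given subspace. -/
def decisionAlgorithm :
    List (List RatCode) × List RatCode × List (List RatCode) →. Bool :=
  certifiedSearch checkDecision Prod.fst

theorem partrec_decisionAlgorithm : Partrec decisionAlgorithm := by
  refine partrec_certifiedSearch ?_ Primrec.fst
  unfold checkDecision
  fun_prop

/-! ### Correctness -/

section
variable {d k : ℕ} {A : Matrix (Fin d) (Fin d) ℚ} {x : Fin d → ℚ} {u : Fin k → Fin d → ℚ}

theorem exists_mem_limitAlgorithm (hx : NonTrivial A x) :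
    ∃ b, b ∈ limitAlgorithm (rowsCode A, vecCode x) := by
  obtain ⟨r, K, t, i₀, s, codes, h⟩ := exists_solves_limitSystem hx
  obtain ⟨c, hc⟩ := (exists_check_iff _).2 h
  exact exists_mem_certifiedSearch (b := ((r, K, t, i₀, s, codes), c)) hc

theorem exists_solves_of_mem_limitAlgorithm {b : List (List AlgCode)}
    (h : b ∈ limitAlgorithm (rowsCode A, vecCode x)) :
    ∃ r K t i₀ s codes a, Solves a (limitSystem (rowsCode A) (vecCode x) r K t i₀ s codes) ∧
      codes.map (List.map algCode) = b := by
  obtain ⟨⟨⟨r, K, t, i₀, s, codes⟩, c⟩, hc, rfl⟩ := exists_of_mem_certifiedSearch h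
  obtain ⟨a, ha⟩ := exists_solves_of_check hc
  exact ⟨r, K, t, i₀, s, codes, a, ha, rfl⟩

/-- Any answer given is correct, without assumptions on x or U, because both kinds of certificates
are sound. -/
theorem iff_of_mem_decisionAlgorithm {answer : Bool}
    (h : answer ∈ decisionAlgorithm (rowsCode A, vecCode x, rowsCode u)) :
    answer = true ↔ ∃ n : ℕ, (A ^ n).mulVec x ∈ Submodule.span ℚ (Set.range u) := by
  obtain ⟨⟨b, ⟨r, K, t, i₀, h⟩, c⟩, hc, rfl⟩ := exists_of_mem_certifiedSearch h
  obtain ⟨a, ha⟩ := exists_solves_of_check hc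
  cases b with
  | true => exact ⟨fun _ => ⟨r, mem_span_of_hitSystem ha.one ha.holds⟩, fun _ => rfl⟩
  | false =>
    exact ⟨fun h => absurd h Bool.false_ne_true,
      fun ⟨n, hn⟩ => absurd hn (notMem_span_of_missSystem ha.one ha.holds n)⟩

theorem exists_mem_decisionAlgorithm {a : List ℕ → ℂ} (ha : a [] = 1)
    (haalg : ∀ v, IsAlgebraic ℚ (a v)) {r K t i₀ : ℕ}
    (hb : Holds a (baseSystem (rowsCode A) (vecCode x) r K t i₀))
    (hinj : ∀ i < r, ∀ j < r, a [0, i] = a [0, j] → i = j)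
    {W : Submodule ℝ (EuclideanSpace ℝ (Fin d))}
    (hW : ∀ m : ℕ → ℂ,
      reVec (∑ i ∈ Finset.range r, m i • a [6, i] • vec a d [1, d, i, t]) ∈ W)
    (hWu : W ⊓ realSpan u = ⊥) :
    ∃ answer, answer ∈ decisionAlgorithm (rowsCode A, vecCode x, rowsCode u) := by
  by_cases hhit : ∃ n, (A ^ n).mulVec x ∈ Submodule.span ℚ (Set.range u)
  · obtain ⟨n, hn⟩ := hhit
    obtain ⟨c, hc⟩ := (exists_check_iff _).2 (exists_solves_hitSystem hn)
    exact exists_mem_certifiedSearch (b := (true, (n, 0, 0, 0, 0), c)) hc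
  · have hmiss := not_exists.1 hhit
    -- If all eigenvalues are zero, the orbit reaches 0, which lies in every subspace.
    have h0 : a [0, i₀] ≠ 0 := fun h0 => hmiss K <| by
      rw [(isSpectralData ha hb).pow_eq_zero h0, Matrix.zero_mulVec]
      exact zero_mem _
    obtain ⟨h, hsol⟩ := exists_solves_missSystem ha haalg hb hinj h0 hW hWu hmiss
    obtain ⟨c, hc⟩ := (exists_check_iff _).2 hsol
    exact exists_mem_certifiedSearch (b := (false, (r, K, t, i₀, h), c)) hc

end

end QSystem

/-! ### The main theorem -/

open QSystem

theorem theorem1 :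
    ∃ (algW : List (List RatCode) × List RatCode →. List (List AlgCode))
      (algD : List (List RatCode) × List RatCode × List (List RatCode) →. Bool),
      Partrec algW ∧ Partrec algD ∧
      ∀ (d : ℕ) (A : Matrix (Fin d) (Fin d) ℚ) (x : Fin d → ℚ), NonTrivial A x →
        ∃ b ∈ algW (rowsCode A, vecCode x),
        ∃ W : Submodule ℝ (EuclideanSpace ℝ (Fin d)),
          PresentsSubspace b W ∧
          Module.finrank ℝ W = (leadingRoots (minpoly ℚ A)).ncard ∧
          (¬ IsNilpotent A → OrbitConvergesTo A x W) ∧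
          ∀ (k : ℕ) (u : Fin k → Fin d → ℚ), W ⊓ realSpan u = ⊥ →
            ∃ answer : Bool, algD (rowsCode A, vecCode x, rowsCode u) = Part.some answer ∧
              (answer = true ↔
                ∃ n : ℕ, (A ^ n).mulVec x ∈ Submodule.span ℚ (Set.range u)) := by
  refine ⟨limitAlgorithm, decisionAlgorithm, partrec_limitAlgorithm, partrec_decisionAlgorithm,
    fun d A x hx => ?_⟩
  obtain ⟨b, hb⟩ := exists_mem_limitAlgorithm hx
  -- The solution behind the certificate found by the first search defines W. The same solution
  -- proves that the second search halts, although that search never sees W.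
  obtain ⟨r, K, t, i₀, s, codes, a, ⟨ha, haalg, hsys⟩, rfl⟩ :=
    exists_solves_of_mem_limitAlgorithm hb
  obtain ⟨hbase, hs, hlead, hbasis, hc⟩ := (holds_limitSystem ha).1 hsys
  have hinj := injective_of_leadingEqs ha hlead
  refine ⟨_, hb, limitSpace a d codes.length, presentsSubspace_limitSpace ha hbasis hc, ?_,
    fun hA => ?_, fun k u hWu => ?_⟩
  · rw [finrank_limitSpace ha hbasis,
      ncard_leadingRoots ha hbase hs hlead (length_pos_of_basisEqs ha hbase hbasis)]
  · exact (isSpectralData ha hbase).orbitConvergesTo hinj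
      (apply_ne_zero_of_not_isNilpotent ha hbase hA)
      fun n => reVec_sum_mem_limitSpace ha hbasis _
  · obtain ⟨answer, hanswer⟩ := exists_mem_decisionAlgorithm ha haalg hbase hinj
      (reVec_sum_mem_limitSpace ha hbasis) hWu
    exact ⟨answer, Part.eq_some_iff.2 hanswer, iff_of_mem_decisionAlgorithm hanswer⟩
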